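/- Let $\alpha\in\mathbb R$, $\mathbb T=\mathbb R/2\pi\mathbb Z$, and let $M=(\mathbb R\setminus\{0\})\times\mathbb T$ carry the Riemannian metric $g=dx^2+|x|^{-2\alpha}d\theta^2$, with volume $d\omega=|x|^{-\alpha}\,dx\,d\theta$ and Laplace–Beltrami operator $$\Delta=\partial_x^2+|x|^{2\alpha}\partial_\theta^2-\frac{\alpha}{x}\,\partial_x .$$ Consider $\Delta|_{C_c^\infty(M)}$ as an unbounded operator on the real Hilbert space $L^2(M,d\omega)$, and write $\Delta^*$ for its adjoint. Its Friedrichs extension $\Delta_F$ is the restriction of $\Delta^*$ to the set of all $u\in\operatorname{dom}\Delta^*$ that belong to $H^1_0(M,d\omega)$, the closure of $C_c^\infty(M)$ for the norm $\big(\int_M u^2+(\partial_xu)^2+|x|^{2\alpha}(\partial_\theta u)^2\,d\omega\big)^{1/2}$. A Markovian extension of $\Delta|_{C_c^\infty(M)}$ is a non-positive self-adjoint extension $A$ that generates a strongly continuous semigroup $\{e^{tA}\}_{t\ge0}$ such that $0\le u\le1$ a.e. implies $0\le e^{tA}u\le1$ a.e., for all $u\in L^2(M,d\omega)$ and $t>0$.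 The operator $\Delta|_{C_c^\infty(M)}$ is Markov unique if $\Delta_F$ is its only Markovian extension, that is, if the set of its Markovian extensions is $\{\Delta_F\}$. It is essentially self-adjoint if its closure is self-adjoint. **Proposition.** For every $\alpha\in\mathbb R$, the operator $\Delta|_{C_c^\infty(M)}$ is Markov unique if and only if $\alpha\notin(-1,1)$. Moreover, Markov uniqueness is strictly weaker than essential self-adjointness for this family of operators: for every $\alpha\in\mathbb R$, if $\Delta|_{C_c^\infty(M)}$ is essentially self-adjoint then it is Markov unique, and there is an $\alpha\in\mathbb R$ for which it is Markov unique but not essentially self-adjoint. -/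

import Mathlib

open MeasureTheory Filter Topology Set
open scoped ContDiff NNReal

noncomputable section

namespace ConicSurface

instance twoPiPos : Fact (0 < 2 * Real.pi) := ⟨Real.two_pi_pos⟩

/-- The circle `𝕋 = ℝ / 2πℤ`. -/
abbrev Torus : Type := AddCircle (2 * Real.pi)

/-- The cylinder `ℝ × 𝕋`. The surface `M = (ℝ \ {0}) × 𝕋` is its open subset `surface`; functions
with compact support in `M` are extended by zero to the cylinder. -/
abbrev Cyl : Type := ℝ × Torus

/-- The open subset `M = (ℝ \ {0}) × 𝕋` of the cylinder. -/
def surface : Set Cyl := {p | p.1 ≠ 0}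

/-- The Riemannian volume `dω = |x|^{-α} dx dθ` of the metric `dx² + |x|^{-2α} dθ²`. It is regarded
as a measure on the cylinder, for which `{0} × 𝕋` is a null set, so that `L²(ω)` is `L²(M, dω)`. -/
def vol (α : ℝ) : Measure Cyl :=
  (volume : Measure Cyl).withDensity fun p => ENNReal.ofReal (|p.1| ^ (-α))

/-- The real Hilbert space `L²(M, dω)`. -/
abbrev L2 (α : ℝ) : Type := Lp ℝ 2 (vol α)

/-- The lift of a function on the cylinder to its universal cover `ℝ × ℝ`. -/
def lift (f : Cyl → ℝ) : ℝ × ℝ → ℝ := fun q => f (q.1, (q.2 : Torus))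

/-- `C_c^∞(M)`: smooth functions with compact support contained in `M`. Smoothness on the cylinder
is smoothness on the universal cover. -/
def testFn : Submodule ℝ (Cyl → ℝ) where
  carrier := {f | ContDiff ℝ ∞ (lift f) ∧ HasCompactSupport f ∧ tsupport f ⊆ surface}
  zero_mem' := by
    refine ⟨contDiff_const (c := (0 : ℝ)), HasCompactSupport.zero, ?_⟩
    have h : tsupport (0 : Cyl → ℝ) = ∅ := by
      rw [tsupport_eq_empty_iff]
    rw [h]
    exact empty_subset _
  add_mem' := by
    rintro f g ⟨hf, hf', hf''⟩ ⟨hg, hg', hg''⟩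
    exact ⟨hf.add hg, hf'.add hg', (tsupport_add f g).trans (union_subset hf'' hg'')⟩
  smul_mem' := by
    rintro c f ⟨hf, hf', hf''⟩
    have hs : tsupport (c • f) ⊆ tsupport f :=
      closure_mono (Function.support_const_smul_subset c f)
    exact ⟨contDiff_const.smul hf, hf'.mono' ((subset_tsupport _).trans hs), hs.trans hf''⟩

/-- The partial derivative `∂ₓ f`. -/
def dx (f : Cyl → ℝ) : Cyl → ℝ := fun p => deriv (fun s : ℝ => f (s, p.2)) p.1

/-- The partial derivative `∂_θ f`. -/
def dtheta (f : Cyl → ℝ) : Cyl → ℝ :=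
  fun p => deriv (fun t : ℝ => f (p.1, p.2 + (t : Torus))) 0

theorem testFn.hasDerivAt_dx {f : Cyl → ℝ} (hf : f ∈ testFn) (x s : ℝ) :
    HasDerivAt (fun y : ℝ => f (y, (s : Torus))) (fderiv ℝ (lift f) (x, s) (1, 0)) x := by
  have h : HasFDerivAt (lift f) (fderiv ℝ (lift f) (x, s)) (x, s) :=
    (hf.1.differentiable (by simp) (x, s)).hasFDerivAt
  have h2 : HasDerivAt (fun y : ℝ => (y, s)) ((1 : ℝ), (0 : ℝ)) x :=
    (hasDerivAt_id x).prodMk (hasDerivAt_const x s)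
  exact h.comp_hasDerivAt x h2

theorem testFn.hasDerivAt_dtheta {f : Cyl → ℝ} (hf : f ∈ testFn) (x s : ℝ) :
    HasDerivAt (fun t : ℝ => f (x, (s : Torus) + (t : Torus)))
      (fderiv ℝ (lift f) (x, s) (0, 1)) 0 := by
  have h : HasFDerivAt (lift f) (fderiv ℝ (lift f) (x, s)) ((fun t : ℝ => (x, s + t)) 0) := by
    simpa using (hf.1.differentiable (by simp) (x, s)).hasFDerivAt
  have h2 : HasDerivAt (fun t : ℝ => (x, s + t)) ((0 : ℝ), (1 : ℝ)) 0 :=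
    (hasDerivAt_const 0 x).prodMk ((hasDerivAt_id (0 : ℝ)).const_add s)
  have := h.comp_hasDerivAt (0 : ℝ) h2
  refine this.congr_of_eventuallyEq (Eventually.of_forall fun t => ?_)
  simp [lift]

theorem lift_dx {f : Cyl → ℝ} (hf : f ∈ testFn) :
    lift (dx f) = fun q => fderiv ℝ (lift f) q (1, 0) := by
  funext q
  exact (testFn.hasDerivAt_dx hf q.1 q.2).deriv

theorem lift_dtheta {f : Cyl → ℝ} (hf : f ∈ testFn) :
    lift (dtheta f) = fun q => fderiv ℝ (lift f) q (0, 1) := by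
  funext q
  exact (testFn.hasDerivAt_dtheta hf q.1 q.2).deriv

theorem lift_injective : Function.Injective lift := by
  intro f g h
  funext p
  obtain ⟨x, t⟩ := p
  obtain ⟨s, rfl⟩ := QuotientAddGroup.mk_surjective t
  exact congrFun h (x, s)

theorem testFn.of_support {f g : Cyl → ℝ} (hf : f ∈ testFn) (hg : ContDiff ℝ ∞ (lift g))
    (h : ∀ p, p ∉ tsupport f → g p = 0) : g ∈ testFn := by
  have hs : Function.support g ⊆ tsupport f := fun p hp => by
    by_contra hc
    exact hp (h p hc)
  exact ⟨hg, hf.2.1.mono' hs, (closure_minimal hs (isClosed_tsupport f)).trans hf.2.2⟩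

theorem dx_mem {f : Cyl → ℝ} (hf : f ∈ testFn) : dx f ∈ testFn := by
  refine testFn.of_support hf ?_ fun p hp => ?_
  · rw [lift_dx hf]
    exact (hf.1.fderiv_right (m := ∞) (by simp)).clm_apply contDiff_const
  · have h0 : f =ᶠ[𝓝 p] 0 := notMem_tsupport_iff_eventuallyEq.mp hp
    have hc : Tendsto (fun s : ℝ => (s, p.2)) (𝓝 p.1) (𝓝 p) :=
      (Continuous.prodMk_left p.2).tendsto p.1
    have : (fun s : ℝ => f (s, p.2)) =ᶠ[𝓝 p.1] fun _ => 0 := hc.eventually h0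
    simp [dx, this.deriv_eq]

theorem dtheta_mem {f : Cyl → ℝ} (hf : f ∈ testFn) : dtheta f ∈ testFn := by
  refine testFn.of_support hf ?_ fun p hp => ?_
  · rw [lift_dtheta hf]
    exact (hf.1.fderiv_right (m := ∞) (by simp)).clm_apply contDiff_const
  · have h0 : f =ᶠ[𝓝 p] 0 := notMem_tsupport_iff_eventuallyEq.mp hp
    have hc : Tendsto (fun t : ℝ => (p.1, p.2 + (t : Torus))) (𝓝 0) (𝓝 p) := by
      have : Continuous (fun t : ℝ => (p.1, p.2 + (t : Torus))) :=
        continuous_const.prodMk (continuous_const.add (AddCircle.continuous_mk' _))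
      simpa using this.tendsto 0
    have : (fun t : ℝ => f (p.1, p.2 + (t : Torus))) =ᶠ[𝓝 0] fun _ => 0 := hc.eventually h0
    simp [dtheta, this.deriv_eq]

theorem mul_mem {c : ℝ → ℝ} (hc : ∀ x, x ≠ 0 → ContDiffAt ℝ ∞ c x) {f : Cyl → ℝ}
    (hf : f ∈ testFn) : (fun p => c p.1 * f p) ∈ testFn := by
  refine testFn.of_support hf ?_ fun p hp => ?_
  · rw [contDiff_iff_contDiffAt]
    intro q
    by_cases hq : ((q.1, (q.2 : Torus)) : Cyl) ∈ tsupport f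
    · have hq0 : q.1 ≠ 0 := hf.2.2 hq
      exact ((hc q.1 hq0).comp q contDiffAt_fst).mul hf.1.contDiffAt
    · have h0 : f =ᶠ[𝓝 (q.1, (q.2 : Torus))] 0 := notMem_tsupport_iff_eventuallyEq.mp hq
      have hcont : Continuous (fun q : ℝ × ℝ => ((q.1, (q.2 : Torus)) : Cyl)) :=
        continuous_fst.prodMk ((AddCircle.continuous_mk' _).comp continuous_snd)
      have h1 := (hcont.tendsto q).eventually h0
      refine (contDiffAt_const (c := (0 : ℝ))).congr_of_eventuallyEq ?_
      filter_upwards [h1] with r hr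
      simp only [Pi.zero_apply] at hr
      simp [lift, hr]
  · simp [image_eq_zero_of_notMem_tsupport hp]

theorem contDiffAt_abs_rpow (b : ℝ) (x : ℝ) (hx : x ≠ 0) :
    ContDiffAt ℝ ∞ (fun y : ℝ => |y| ^ b) x :=
  (contDiffAt_abs hx).rpow_const_of_ne (abs_ne_zero.mpr hx)

/-- `∂ₓ` as a linear map on `C_c^∞(M)`. -/
def dxL : testFn →ₗ[ℝ] testFn where
  toFun f := ⟨dx f, dx_mem f.2⟩
  map_add' f g := by
    apply Subtype.ext
    apply lift_injective
    funext q
    have h := (testFn.hasDerivAt_dx f.2 q.1 q.2).add (testFn.hasDerivAt_dx g.2 q.1 q.2)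
    have e : lift (dx f) q + lift (dx g) q = _ :=
      congrArg₂ (· + ·) (congrFun (lift_dx f.2) q) (congrFun (lift_dx g.2) q)
    exact h.deriv.trans e.symm
  map_smul' c f := by
    apply Subtype.ext
    apply lift_injective
    funext q
    have h := (testFn.hasDerivAt_dx f.2 q.1 q.2).const_mul c
    have e : c * lift (dx f) q = _ := congrArg (c * ·) (congrFun (lift_dx f.2) q)
    exact h.deriv.trans e.symm

/-- `∂_θ` as a linear map on `C_c^∞(M)`. -/
def dthetaL : testFn →ₗ[ℝ] testFn where
  toFun f := ⟨dtheta f, dtheta_mem f.2⟩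
  map_add' f g := by
    apply Subtype.ext
    apply lift_injective
    funext q
    have h := (testFn.hasDerivAt_dtheta f.2 q.1 q.2).add (testFn.hasDerivAt_dtheta g.2 q.1 q.2)
    have e : lift (dtheta f) q + lift (dtheta g) q = _ :=
      congrArg₂ (· + ·) (congrFun (lift_dtheta f.2) q) (congrFun (lift_dtheta g.2) q)
    exact h.deriv.trans e.symm
  map_smul' c f := by
    apply Subtype.ext
    apply lift_injective
    funext q
    have h := (testFn.hasDerivAt_dtheta f.2 q.1 q.2).const_mul c
    have e : c * lift (dtheta f) q = _ := congrArg (c * ·) (congrFun (lift_dtheta f.2) q)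
    exact h.deriv.trans e.symm

/-- Multiplication by a function of `x` that is smooth on `ℝ \ {0}`, on `C_c^∞(M)`. -/
def mulL (c : ℝ → ℝ) (hc : ∀ x, x ≠ 0 → ContDiffAt ℝ ∞ c x) : testFn →ₗ[ℝ] testFn where
  toFun f := ⟨fun p => c p.1 * f.1 p, mul_mem hc f.2⟩
  map_add' f g := by
    apply Subtype.ext
    funext p
    exact mul_add _ _ _
  map_smul' r f := by
    apply Subtype.ext
    funext p
    exact mul_left_comm _ _ _

/-- The Laplace-Beltrami operator `Δ = ∂ₓ² + |x|^{2α} ∂_θ² - (α/x) ∂ₓ` on `C_c^∞(M)`. -/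
def laplace (α : ℝ) : testFn →ₗ[ℝ] testFn :=
  dxL ∘ₗ dxL
    + mulL (fun x => |x| ^ (2 * α)) (contDiffAt_abs_rpow (2 * α)) ∘ₗ dthetaL ∘ₗ dthetaL
    - mulL (fun x => α / x) (fun _ hx => contDiffAt_const.div contDiffAt_id hx) ∘ₗ dxL

theorem laplace_apply (α : ℝ) (f : testFn) (p : Cyl) :
    (laplace α f : Cyl → ℝ) p =
      dx (dx f) p + |p.1| ^ (2 * α) * dtheta (dtheta f) p - α / p.1 * dx f p := rfl

theorem testFn.continuous {f : Cyl → ℝ} (hf : f ∈ testFn) : Continuous f := by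
  have h : IsOpenQuotientMap (Prod.map (id : ℝ → ℝ) (QuotientAddGroup.mk : ℝ → Torus)) :=
    IsOpenQuotientMap.id.prodMap QuotientAddGroup.isOpenQuotientMap_mk
  exact h.continuous_comp_iff.mp hf.1.continuous

theorem vol_lt_top (α : ℝ) {K : Set Cyl} (hK : IsCompact K) (hs : K ⊆ surface) :
    vol α K < ⊤ := by
  have hc : ContinuousOn (fun p : Cyl => |p.1| ^ (-α)) K := fun p hp =>
    (((continuous_fst.abs).continuousAt).rpow_const
      (Or.inl (abs_ne_zero.mpr (hs hp)))).continuousWithinAt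
  obtain ⟨C, hC⟩ := hK.bddAbove_image hc
  have hm := hK.isClosed.measurableSet
  rw [vol, withDensity_apply _ hm]
  calc ∫⁻ p in K, ENNReal.ofReal (|p.1| ^ (-α))
      ≤ ∫⁻ _ in K, ENNReal.ofReal C := setLIntegral_mono' hm fun p hp =>
        ENNReal.ofReal_le_ofReal (hC (mem_image_of_mem _ hp))
    _ = ENNReal.ofReal C * volume K := by simp
    _ < ⊤ := ENNReal.mul_lt_top ENNReal.ofReal_lt_top hK.measure_lt_top

theorem testFn.memLp (α : ℝ) {f : Cyl → ℝ} (hf : f ∈ testFn) : MemLp f 2 (vol α) := by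
  have hK : IsCompact (tsupport f) := hf.2.1
  have hfin : IsFiniteMeasure ((vol α).restrict (tsupport f)) :=
    ⟨by simpa using vol_lt_top α hK hf.2.2⟩
  obtain ⟨C, hC⟩ := hf.2.1.exists_bound_of_continuous (testFn.continuous hf)
  have h : MemLp f 2 ((vol α).restrict (tsupport f)) :=
    MemLp.of_bound (testFn.continuous hf).aestronglyMeasurable C (Eventually.of_forall hC)
  have h2 := (memLp_indicator_iff_restrict (isClosed_tsupport f).measurableSet).mpr h
  rwa [Set.indicator_eq_self.mpr (subset_tsupport f)] at h2

/-- The canonical map `C_c^∞(M) → L²(M, dω)`. -/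
def toL2 (α : ℝ) : testFn →ₗ[ℝ] L2 α where
  toFun f := (testFn.memLp α f.2).toLp f
  map_add' _ _ := rfl
  map_smul' _ _ := rfl

theorem toL2_injective (α : ℝ) : Function.Injective (toL2 α) := by
  intro f g h
  have h1 : (f : Cyl → ℝ) =ᵐ[vol α] g := 
    (MemLp.toLp_eq_toLp_iff (testFn.memLp α f.2) (testFn.memLp α g.2)).mp h
  have hm : Measurable fun p : Cyl => ENNReal.ofReal (|p.1| ^ (-α)) := by fun_prop
  have h2 : (f : Cyl → ℝ) =ᵐ[volume] g := by
    have h3 := (ae_withDensity_iff hm).mp h1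
    filter_upwards [h3] with p hp
    by_cases h0 : p.1 = 0
    · have hz : ∀ k : testFn, (k : Cyl → ℝ) p = 0 := fun k =>
        image_eq_zero_of_notMem_tsupport fun hk => k.2.2.2 hk h0
      rw [hz f, hz g]
    · exact hp (ENNReal.ofReal_pos.mpr (Real.rpow_pos_of_pos (abs_pos.mpr h0) _)).ne'
  exact Subtype.ext ((Continuous.ae_eq_iff_eq volume (testFn.continuous f.2)
    (testFn.continuous g.2)).mp h2)

/-- `Δ|_{C_c^∞(M)}` as an unbounded operator on `L²(M, dω)`. -/
def laplacian (α : ℝ) : L2 α →ₗ.[ℝ] L2 α where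
  domain := LinearMap.range (toL2 α)
  toFun := toL2 α ∘ₗ laplace α ∘ₗ
    (LinearEquiv.ofInjective (toL2 α) (toL2_injective α)).symm.toLinearMap

theorem laplacian_apply (α : ℝ) (f : testFn) :
    laplacian α ⟨toL2 α f, LinearMap.mem_range_self _ f⟩ = toL2 α (laplace α f) := by
  have h : (LinearEquiv.ofInjective (toL2 α) (toL2_injective α)).symm
      ⟨toL2 α f, LinearMap.mem_range_self _ f⟩ = f := by
    rw [LinearEquiv.symm_apply_eq]
    rfl
  exact congrArg (fun k => toL2 α (laplace α k)) h

/-- `H¹₀(M, dω)`, the closure of `C_c^∞(M)` for the norm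
`(‖u‖² + ‖∂ₓ u‖² + ‖|x|^α ∂_θ u‖²)^{1/2}`, the last two terms being `∫ g(∇u, ∇u) dω`: the elements
`u` of `L²(M, dω)` for which there are test functions `fₙ → u` in `L²` such that `∂ₓ fₙ` and
`|x|^α ∂_θ fₙ` converge in `L²`. It is the domain of the closure of the form `(-Δ f, h)` on
`C_c^∞(M)`. -/
def H10 (α : ℝ) : Submodule ℝ (L2 α) :=
  (LinearMap.range ((toL2 α).prod ((toL2 α ∘ₗ dxL).prod
    (toL2 α ∘ₗ mulL (fun x => |x| ^ α) (contDiffAt_abs_rpow α) ∘ₗ dthetaL)))).topologicalClosure.map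
      (LinearMap.fst ℝ (L2 α) (L2 α × L2 α))

/-- The Friedrichs extension `Δ_F`: the restriction of the adjoint `Δ*` (which is the distributional
`Δ` on `{u ∈ L² | Δu ∈ L²}`) to `H²₀(M, dω) = {u ∈ H¹₀(M, dω) | Δu ∈ L²(M, dω)}`. -/
def friedrichs (α : ℝ) : L2 α →ₗ.[ℝ] L2 α :=
  (laplacian α).adjoint.domRestrict (H10 α)

/-- `T` is a strongly continuous semigroup on the Hilbert space `H`. -/
structure IsC0Semigroup {H : Type*} [NormedAddCommGroup H] [InnerProductSpace ℝ H]
    (T : ℝ≥0 → H →L[ℝ] H) : Prop where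
  map_zero : T 0 = ContinuousLinearMap.id ℝ H
  map_add : ∀ s t, T (s + t) = (T s).comp (T t)
  continuous : ∀ u, Continuous fun t => T t u

/-- `A` is the generator of `T`: `u ∈ dom A` and `A u = v` if and only if `(T_t u - u) / t → v` in
norm as `t → 0⁺`. -/
def IsGenerator {H : Type*} [NormedAddCommGroup H] [InnerProductSpace ℝ H]
    (A : H →ₗ.[ℝ] H) (T : ℝ≥0 → H →L[ℝ] H) : Prop :=
  ∀ u v : H, (u, v) ∈ A.graph ↔
    Tendsto (fun t : ℝ≥0 => (t : ℝ)⁻¹ • (T t u - u)) (𝓝[>] 0) (𝓝 v)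

/-- A family of operators on `L²(X, m)` is Markovian if `0 ≤ u ≤ 1` a.e. implies `0 ≤ T_t u ≤ 1`
a.e. for every `t > 0`. -/
def IsMarkovianFamily {X : Type*} [MeasurableSpace X] {m : Measure X}
    (T : ℝ≥0 → Lp ℝ 2 m →L[ℝ] Lp ℝ 2 m) : Prop :=
  ∀ u : Lp ℝ 2 m, (∀ᵐ p ∂m, 0 ≤ u p ∧ u p ≤ 1) →
    ∀ t : ℝ≥0, 0 < t → ∀ᵐ p ∂m, 0 ≤ T t u p ∧ T t u p ≤ 1

/-- A Markovian operator on `L²(X, m)`: non-positive, self-adjoint, and the generator of a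
strongly continuous semigroup (necessarily unique) that is Markovian. -/
structure IsMarkovianOperator {X : Type*} [MeasurableSpace X] {m : Measure X}
    (A : Lp ℝ 2 m →ₗ.[ℝ] Lp ℝ 2 m) : Prop where
  selfAdjoint : IsSelfAdjoint A
  nonpos : ∀ u : A.domain, inner ℝ (A u) (u : Lp ℝ 2 m) ≤ 0
  semigroup : ∃ T : ℝ≥0 → Lp ℝ 2 m →L[ℝ] Lp ℝ 2 m,
    IsC0Semigroup T ∧ IsGenerator A T ∧ IsMarkovianFamily T

/-- The Markovian extensions of `Δ|_{C_c^∞(M)}`. -/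
def markovianExtensions (α : ℝ) : Set (L2 α →ₗ.[ℝ] L2 α) :=
  {A | laplacian α ≤ A ∧ IsMarkovianOperator A}

/-- `Δ|_{C_c^∞(M)}` is Markov unique: the Friedrichs extension is its only Markovian extension. -/
def MarkovUnique (α : ℝ) : Prop := markovianExtensions α = {friedrichs α}

/-- `Δ|_{C_c^∞(M)}` is essentially self-adjoint: its closure is self-adjoint. -/
def EssentiallySelfAdjoint (α : ℝ) : Prop := IsSelfAdjoint (laplacian α).closure

end ConicSurface

end

/-! Let `H¹` be the space of functions in `L²(ω)` whose weak gradient is in `L²` (`weakGradGraph`),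
and `H¹₀` the closure of the test functions (`formSpace α testFn`). The domain of every Markovian
extension lies in `H¹`, so Markov uniqueness is governed by whether a function in `H¹` can be
distinguished from `H¹₀` at `x = 0`. Near the singularity the radial energy is `∫ |x|^{-α} |u'|² dx`
and the mass is `∫ |x|^{-α} u² dx`. A nonzero boundary value has finite mass only if `α < 1`, and is
seen by the energy only if `α > -1`.

If `-1 < α < 1`, the closure of the energy on smooth functions that are constant near `{0} × 𝕋` is a
second Dirichlet form. Its operator is Markovian: the resolvent minimizes `‖u - f‖² + ε ‖∇u‖²`, and
composition with a normal contraction fixing exactly `[0, 1]` does not raise this functional when `0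
≤ f ≤ 1`. The contraction `squash` is smooth, so that it acts on the core. A cutoff function lies in
the domain of this operator but not in `H¹₀`, because the trace at `0⁺` is continuous for the energy
norm (`inner_trace`, `cutoff_notMem_H10`, `not_markovUnique`).

If `α ∉ (-1, 1)`, take a Markovian extension `A` with semigroup `T` and `u ∈ dom A`. For a symmetric
sub-Markovian operator given by a kernel, the double integral of `((u(x) - u(y)) - φ(x)(ψ(x) -
ψ(y)))²` is non-negative. `IsSubMarkov.integral_nonneg` proves this without a kernel; divided by
`t`, as `t → 0`, it becomes `-(Au, u) ≥ -2 (u, div X) - ‖X‖²` for the field `X = φ∇ψ`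
(`markovian_energy`). Scaling `X` bounds the functional `X ↦ (u, div X)`, so the Riesz theorem
provides a weak gradient (`exists_weakGradient`).

It remains to see that `H¹ = H¹₀`. The component of an element of `H¹` orthogonal to `H¹₀` solves `w
= Δw` weakly. Each Fourier mode solves `(|x|^{-α} a')' = |x|^{-α}(1 + n²|x|^{2α}) a` with finite
energy, and the monotone quantity `|x|^{-α} a a'` forces it to vanish (`eq_zero_of_finite_energy`).
Hence `A ⊆ Δ_F`, and self-adjoint operators have no proper self-adjoint extensions.

Essential self-adjointness leaves only one self-adjoint extension, hence only one Markovian one. For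
`α = -2`, near `x = 0` the functions `1_{x > 0}` and `1/x` are both square integrable solutions of
`Δu = 0`, and after truncation `Δ*` is not symmetric on them (`not_essentiallySelfAdjoint`). -/

noncomputable section

namespace ConicSurface

set_option linter.unusedSectionVars false

section

/-! ### m-dissipative operators and their resolvents -/

section MDissipative

variable {H : Type*} [NormedAddCommGroup H] [InnerProductSpace ℝ H]

/-- The graph `G` of an operator `A` that is dissipative, with `1 - εA` surjective for all
`ε > 0` and dense domain. -/
structure MDissipative (G : Submodule ℝ (H × H)) : Prop where
  dissipative : ∀ p ∈ G, inner ℝ p.2 p.1 ≤ 0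
  surj : ∀ ε : ℝ, 0 < ε → ∀ f : H, ∃ p ∈ G, p.1 - ε • p.2 = f
  dense : Dense {u : H | ∃ v, (u, v) ∈ G}

namespace MDissipative

variable {G : Submodule ℝ (H × H)} (hG : MDissipative G)
include hG

/-- In the expansion of `‖u - εAu‖²` the cross term `-2ε(Au, u)` is non-negative. -/
theorem norm_fst_le {ε : ℝ} (hε : 0 < ε) {p : H × H} (hp : p ∈ G) : ‖p.1‖ ≤ ‖p.1 - ε • p.2‖ := by
  have h1 := hG.dissipative p hp
  have h2 : ‖p.1‖ ^ 2 ≤ ‖p.1 - ε • p.2‖ ^ 2 := by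
    rw [norm_sub_sq_real, inner_smul_right, real_inner_comm]
    nlinarith [sq_nonneg ‖ε • p.2‖]
  exact le_of_sq_le_sq h2 (norm_nonneg _)

theorem unique {ε : ℝ} (hε : 0 < ε) {p q : H × H} (hp : p ∈ G) (hq : q ∈ G)
    (h : p.1 - ε • p.2 = q.1 - ε • q.2) : p = q := by
  have h1 := hG.norm_fst_le hε (G.sub_mem hp hq)
  have h2 : (p - q).1 - ε • (p - q).2 = 0 := by
    have : (p - q).1 - ε • (p - q).2 = (p.1 - ε • p.2) - (q.1 - ε • q.2) := by
      simp only [Prod.fst_sub, Prod.snd_sub, smul_sub]; abel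
    rw [this, h, sub_self]
  rw [h2, norm_zero] at h1
  have h3 : p.1 = q.1 := sub_eq_zero.mp (norm_le_zero_iff.mp h1)
  rw [h3] at h
  have h4 : ε • p.2 = ε • q.2 := sub_right_injective h
  exact Prod.ext h3 (smul_right_injective H hε.ne' h4)

theorem exists_resolvent {ε : ℝ} (hε : 0 < ε) : ∃ J : H →L[ℝ] H, ‖J‖ ≤ 1 ∧
    ∀ f, ∃ v, (J f, v) ∈ G ∧ J f - ε • v = f := by
  choose p hp hpf using hG.surj ε hε
  refine ⟨LinearMap.mkContinuous ⟨⟨fun f => (p f).1, fun f g => ?_⟩, fun c f => ?_⟩ 1 fun f => ?_,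
    LinearMap.mkContinuous_norm_le _ zero_le_one _, fun f => ⟨(p f).2, hp f, hpf f⟩⟩
  · have := hG.unique hε (hp (f + g)) (G.add_mem (hp f) (hp g)) (by
      rw [hpf]
      conv_lhs => rw [← hpf f, ← hpf g]
      simp only [Prod.fst_add, Prod.snd_add, smul_add]; abel)
    exact congrArg Prod.fst this
  · have := hG.unique hε (hp (c • f)) (G.smul_mem c (hp f)) (by
      rw [hpf]
      conv_lhs => rw [← hpf f]
      simp only [Prod.smul_fst, Prod.smul_snd, smul_sub, smul_comm c ε])
    exact congrArg Prod.fst this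
  · have := hG.norm_fst_le hε (hp f)
    rw [hpf] at this
    simpa using this

omit hG in
open Classical in
/-- The resolvent `(1 - εA)⁻¹`. -/
def resolvent (hG : MDissipative G) (ε : ℝ) : H →L[ℝ] H :=
  -- The value `0` for `ε ≤ 0` is a default that is never used.
  if hε : 0 < ε then (hG.exists_resolvent hε).choose else 0

variable {ε : ℝ} (hε : 0 < ε)
include hε

theorem norm_resolvent_le : ‖hG.resolvent ε‖ ≤ 1 := by
  rw [resolvent, dif_pos hε]
  exact (hG.exists_resolvent hε).choose_spec.1

theorem resolvent_spec (f : H) :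
    ∃ v, (hG.resolvent ε f, v) ∈ G ∧ hG.resolvent ε f - ε • v = f := by
  rw [resolvent, dif_pos hε]
  exact (hG.exists_resolvent hε).choose_spec.2 f

theorem norm_resolvent_apply_le (f : H) : ‖hG.resolvent ε f‖ ≤ ‖f‖ :=
  ((hG.resolvent ε).le_of_opNorm_le (hG.norm_resolvent_le hε) f).trans_eq (one_mul _)

theorem resolvent_sub {u v : H} (h : (u, v) ∈ G) : hG.resolvent ε (u - ε • v) = u := by
  obtain ⟨w, hw, hw'⟩ := hG.resolvent_spec hε (u - ε • v)
  exact congrArg Prod.fst (hG.unique hε hw h hw')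

/-- The resolvent `J` commutes with `A`: writing `b = A(Ju)`, the difference of the graph elements
`(Ju, b)` and `(u, v)` is `ε(b, (b - v)/ε)`, so `b` solves `b - εAb = v`, that is `b = Jv`. -/
theorem resolvent_mem {u v : H} (h : (u, v) ∈ G) :
    (hG.resolvent ε u, hG.resolvent ε v) ∈ G ∧
      hG.resolvent ε u - u = ε • hG.resolvent ε v := by
  obtain ⟨b, hb, hb'⟩ := hG.resolvent_spec hε u
  have h1 : hG.resolvent ε u - u = ε • b := by
    rw [sub_eq_iff_eq_add, ← sub_eq_iff_eq_add', hb']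
  have h2 : ε • (b, ε⁻¹ • (b - v)) ∈ G := by
    have : ε • (b, ε⁻¹ • (b - v)) = (hG.resolvent ε u, b) - (u, v) := by
      ext
      · exact h1.symm
      · simp [hε.ne']
    rw [this]
    exact G.sub_mem hb h
  have h3 : (b, ε⁻¹ • (b - v)) ∈ G := (G.smul_mem_iff hε.ne').mp h2
  have h4 : hG.resolvent ε v = b := by
    have := hG.resolvent_sub hε h3
    rwa [smul_inv_smul₀ hε.ne', sub_sub_cancel] at this
  rw [h4]
  exact ⟨hb, h1⟩

theorem resolvent_comm {δ : ℝ} (hδ : 0 < δ) (f : H) :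
    hG.resolvent ε (hG.resolvent δ f) = hG.resolvent δ (hG.resolvent ε f) := by
  obtain ⟨v, hv, hv'⟩ := hG.resolvent_spec hε f
  have h1 := hG.resolvent_sub hε (hG.resolvent_mem hδ hv).1
  rw [← h1, ← map_smul, ← map_sub, hv']

/-- The bounded approximation `ε⁻¹ ((1 - εA)⁻¹ - 1)` of `A`. -/
theorem yosida_apply {u v : H} (h : (u, v) ∈ G) :
    ε⁻¹ • (hG.resolvent ε u - u) = hG.resolvent ε v := by
  rw [(hG.resolvent_mem hε h).2, inv_smul_smul₀ hε.ne']

-- On the domain `‖Jw - w‖ = ε‖JAw‖ ≤ ε‖Aw‖`; density of the domain and contractivity of `J` give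
-- the rest.
omit hε in
theorem tendsto_resolvent (u : H) :
    Tendsto (fun n : ℕ => hG.resolvent ((n : ℝ) + 1)⁻¹ u) atTop (𝓝 u) := by
  rw [Metric.tendsto_atTop]
  intro η hη
  obtain ⟨w, hw, v, hv⟩ := Metric.dense_iff.mp hG.dense u (η / 3) (by positivity)
  rw [Metric.mem_ball, dist_eq_norm] at hw
  obtain ⟨N, hN⟩ := exists_nat_gt (‖v‖ / (η / 3))
  refine ⟨N, fun n hn => ?_⟩
  have hp : (0 : ℝ) < ((n : ℝ) + 1)⁻¹ := by positivity
  set J := hG.resolvent ((n : ℝ) + 1)⁻¹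
  have e : J u - u = J (u - w) + (J w - w) + (w - u) := by rw [map_sub]; abel
  have h1 : ‖J (u - w)‖ < η / 3 := by
    refine (hG.norm_resolvent_apply_le hp _).trans_lt ?_
    rwa [norm_sub_rev]
  have h2 : ‖J w - w‖ < η / 3 := by
    rw [(hG.resolvent_mem hp hv).2, norm_smul, Real.norm_of_nonneg hp.le]
    have h3 := hG.norm_resolvent_apply_le hp v
    have h4 : ‖v‖ < (η / 3) * ((n : ℝ) + 1) := by
      rw [div_lt_iff₀ (by positivity)] at hN
      have : (N : ℝ) ≤ n := Nat.cast_le.mpr hn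
      nlinarith
    calc ((n : ℝ) + 1)⁻¹ * ‖J v‖ ≤ ((n : ℝ) + 1)⁻¹ * ‖v‖ := by gcongr
      _ < η / 3 := by rw [inv_mul_lt_iff₀ (by positivity)]; linarith
  rw [dist_eq_norm, e]
  refine (norm_add_le _ _).trans_lt ?_
  have := norm_add_le (J (u - w)) (J w - w)
  linarith

end MDissipative

end MDissipative

/-! ### Exponentials of `J - 1` for a contraction `J` -/

section ExpContraction

variable {H : Type*} [NormedAddCommGroup H] [NormedSpace ℝ H] [CompleteSpace H]

theorem exp_smul_sub_one (J : H →L[ℝ] H) (s : ℝ) :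
    NormedSpace.exp (s • (J - 1)) = Real.exp (-s) • NormedSpace.exp (s • J) := by
  have h : s • (J - 1) = algebraMap ℝ (H →L[ℝ] H) (-s) + s • J := by
    rw [Algebra.algebraMap_eq_smul_one, smul_sub, neg_smul]; abel
  let +nondep : NormedAlgebra ℚ (H →L[ℝ] H) := .restrictScalars ℚ ℝ _
  rw [h, NormedSpace.exp_add_of_commute (Algebra.commutes _ _), ← NormedSpace.algebraMap_exp_comm,
    ← Real.exp_eq_exp_ℝ, Algebra.algebraMap_eq_smul_one, smul_mul_assoc, one_mul]

theorem hasSum_exp_smul_apply (J : H →L[ℝ] H) (s : ℝ) (u : H) :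
    HasSum (fun n : ℕ => ((n.factorial : ℝ)⁻¹ * s ^ n) • (J ^ n) u)
      (NormedSpace.exp (s • J) u) := by
  have h := NormedSpace.exp_series_hasSum_exp' (𝕂 := ℝ) (s • J)
  have h2 := h.mapL (ContinuousLinearMap.apply ℝ H u)
  convert h2 using 2
  · simp [smul_pow, smul_smul]
  · rfl

/-- The operator `e^{s(J-1)}` is the average of the powers `Jⁿ` with the Poisson weights `e^{-s}
sⁿ/n!`, so it preserves every closed convex set that `J` preserves. The set is taken to contain `0`,
which absorbs the missing mass of the partial sums. -/
theorem exp_smul_sub_one_mem {J : H →L[ℝ] H} {S : Set H} (hc : Convex ℝ S) (hcl : IsClosed S)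
    (h0 : (0 : H) ∈ S) (hJ : ∀ u ∈ S, J u ∈ S) {s : ℝ} (hs : 0 ≤ s) {u : H} (hu : u ∈ S) :
    NormedSpace.exp (s • (J - 1)) u ∈ S := by
  have hpow : ∀ n : ℕ, (J ^ n) u ∈ S := fun n => by
    induction n with
    | zero => simpa using hu
    | succ n ih => rw [pow_succ']; exact hJ _ ih
  rw [exp_smul_sub_one]
  have h1 := (hasSum_exp_smul_apply J s u).const_smul (Real.exp (-s))
  refine hcl.mem_of_tendsto h1.tendsto_sum_nat (Eventually.of_forall fun N => ?_)
  have hw : ∑ n ∈ Finset.range N, Real.exp (-s) * ((n.factorial : ℝ)⁻¹ * s ^ n) ≤ 1 := by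
    rw [← Finset.mul_sum]
    have := Real.sum_le_exp_of_nonneg hs N
    have e : ∑ n ∈ Finset.range N, ((n.factorial : ℝ)⁻¹ * s ^ n) =
        ∑ n ∈ Finset.range N, s ^ n / (n.factorial : ℝ) :=
      Finset.sum_congr rfl fun n _ => by rw [div_eq_inv_mul]
    rw [e]
    calc _ ≤ Real.exp (-s) * Real.exp s := by gcongr
      _ = 1 := by rw [← Real.exp_add]; simp
  -- The extra index `none` carries the remaining weight, placed at the point `0`.
  have h2 := hc.sum_mem (t := Finset.insertNone (Finset.range N))
    (w := fun o : Option ℕ => o.elim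
      (1 - ∑ n ∈ Finset.range N, Real.exp (-s) * ((n.factorial : ℝ)⁻¹ * s ^ n))
      fun n => Real.exp (-s) * ((n.factorial : ℝ)⁻¹ * s ^ n))
    (z := fun o : Option ℕ => o.elim 0 fun n => (J ^ n) u)
    (by rintro (_ | n) _
        · simpa using hw
        · simp only [Option.elim]; positivity)
    (by simp) (by rintro (_ | n) _; exacts [h0, hpow n])
  simpa [smul_smul, mul_assoc] using h2

theorem norm_exp_smul_sub_one_apply_le {J : H →L[ℝ] H} (hJ : ‖J‖ ≤ 1) {s : ℝ} (hs : 0 ≤ s)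
    (u : H) : ‖NormedSpace.exp (s • (J - 1)) u‖ ≤ ‖u‖ := by
  have h := exp_smul_sub_one_mem (J := J) (convex_closedBall (0 : H) ‖u‖)
    Metric.isClosed_closedBall (by simp) (fun v hv => ?_) hs (u := u) (by simp)
  · simpa using h
  · rw [mem_closedBall_zero_iff] at hv ⊢
    exact (J.le_of_opNorm_le hJ v).trans (by simpa using hv)

theorem hasDerivAt_exp_smul_apply (B : H →L[ℝ] H) (t : ℝ) (u : H) :
    HasDerivAt (fun s : ℝ => NormedSpace.exp (s • B) u) (NormedSpace.exp (t • B) (B u)) t :=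
  (ContinuousLinearMap.apply ℝ H u).hasFDerivAt.comp_hasDerivAt t (hasDerivAt_exp_smul_const B t)

theorem exp_add_smul (B : H →L[ℝ] H) (s t : ℝ) :
    NormedSpace.exp ((s + t) • B) = NormedSpace.exp (s • B) * NormedSpace.exp (t • B) := by
  let +nondep : NormedAlgebra ℚ (H →L[ℝ] H) := .restrictScalars ℚ ℝ _
  rw [add_smul, NormedSpace.exp_add_of_commute]
  exact ((Commute.refl B).smul_left s).smul_right t

/-- Interpolate by `s ↦ e^{sB} e^{(t-s)C} u`: since `B` and `C` commute, its derivative is `e^{sB}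
e^{(t-s)C}(Bu - Cu)`, of norm at most `‖Bu - Cu‖`. -/
theorem norm_exp_smul_sub_exp_smul_le {B C : H →L[ℝ] H} (hBC : Commute B C)
    (hB : ∀ t : ℝ, 0 ≤ t → ∀ u, ‖NormedSpace.exp (t • B) u‖ ≤ ‖u‖)
    (hC : ∀ t : ℝ, 0 ≤ t → ∀ u, ‖NormedSpace.exp (t • C) u‖ ≤ ‖u‖) {t : ℝ} (ht : 0 ≤ t) (u : H) :
    ‖NormedSpace.exp (t • B) u - NormedSpace.exp (t • C) u‖ ≤ t * ‖B u - C u‖ := by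
  have hd : ∀ s : ℝ, HasDerivAt
      (fun s : ℝ => (NormedSpace.exp (s • B) * NormedSpace.exp ((t - s) • C)) u)
      ((NormedSpace.exp (s • B) * NormedSpace.exp ((t - s) • C)) (B u - C u)) s := fun s => by
    have h1 := hasDerivAt_exp_smul_const B s
    have h2 : HasDerivAt (fun s : ℝ => NormedSpace.exp ((t - s) • C))
        (-(NormedSpace.exp ((t - s) • C) * C)) s := by
      have := (hasDerivAt_exp_smul_const C (t - s)).scomp s ((hasDerivAt_id s).const_sub t)
      rw [neg_one_smul] at this
      exact this
    have h3 := (ContinuousLinearMap.apply ℝ H u).hasFDerivAt.comp_hasDerivAt s (h1.mul h2)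
    refine h3.congr_deriv ?_
    have hc : NormedSpace.exp ((t - s) • C) * B = B * NormedSpace.exp ((t - s) • C) :=
      ((hBC.symm.smul_left (t - s)).exp_left).eq
    have : NormedSpace.exp (s • B) * B * NormedSpace.exp ((t - s) • C) +
        NormedSpace.exp (s • B) * -(NormedSpace.exp ((t - s) • C) * C) =
        (NormedSpace.exp (s • B) * NormedSpace.exp ((t - s) • C)) * (B - C) := by
      rw [mul_assoc, ← hc]; noncomm_ring
    rw [this]
    rfl
  have h := norm_image_sub_le_of_norm_deriv_le_segment' (a := 0) (b := t) (C := ‖B u - C u‖)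
    (fun s _ => (hd s).hasDerivWithinAt) (fun s hs => ?_) t ⟨ht, le_rfl⟩
  · simpa [mul_comm] using h
  · exact (hB s hs.1 _).trans (hC _ (by linarith [hs.2]) _)

end ExpContraction

end

section

/-! ### Hille–Yosida theorem: the semigroup as a limit of Yosida approximations -/

section HilleYosida

variable {H : Type*} [NormedAddCommGroup H] [InnerProductSpace ℝ H] [CompleteSpace H]
  {G : Submodule ℝ (H × H)}

namespace MDissipative

/-- The Yosida approximation of the semigroup generated by `A`. -/
def yosidaExp (hG : MDissipative G) (n : ℕ) (t : ℝ) : H →L[ℝ] H :=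
  NormedSpace.exp (t • (((n : ℝ) + 1) • (hG.resolvent ((n : ℝ) + 1)⁻¹ - 1)))

variable (hG : MDissipative G)
include hG

theorem yosidaExp_eq (n : ℕ) (t : ℝ) : hG.yosidaExp n t =
    NormedSpace.exp ((t * ((n : ℝ) + 1)) • (hG.resolvent ((n : ℝ) + 1)⁻¹ - 1)) := by
  rw [yosidaExp, smul_smul]

theorem norm_yosidaExp_apply_le (n : ℕ) {t : ℝ} (ht : 0 ≤ t) (u : H) :
    ‖hG.yosidaExp n t u‖ ≤ ‖u‖ := by
  rw [yosidaExp_eq]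
  exact norm_exp_smul_sub_one_apply_le (hG.norm_resolvent_le (by positivity)) (by positivity) u

theorem yosidaExp_mem {S : Set H} (hc : Convex ℝ S) (hcl : IsClosed S) (h0 : (0 : H) ∈ S)
    (hJ : ∀ ε, 0 < ε → ∀ u ∈ S, hG.resolvent ε u ∈ S) (n : ℕ) {t : ℝ} (ht : 0 ≤ t) {u : H}
    (hu : u ∈ S) : hG.yosidaExp n t u ∈ S := by
  rw [yosidaExp_eq]
  exact exp_smul_sub_one_mem hc hcl h0 (hJ _ (by positivity)) (by positivity) hu

theorem yosida_generator_apply (n : ℕ) {u v : H} (h : (u, v) ∈ G) :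
    (((n : ℝ) + 1) • (hG.resolvent ((n : ℝ) + 1)⁻¹ - 1)) u = hG.resolvent ((n : ℝ) + 1)⁻¹ v := by
  have := hG.yosida_apply (ε := ((n : ℝ) + 1)⁻¹) (by positivity) h
  rwa [inv_inv] at this

theorem hasDerivAt_yosidaExp (n : ℕ) {u v : H} (h : (u, v) ∈ G) (t : ℝ) :
    HasDerivAt (fun s => hG.yosidaExp n s u)
      (hG.yosidaExp n t (hG.resolvent ((n : ℝ) + 1)⁻¹ v)) t := by
  have := hasDerivAt_exp_smul_apply (((n : ℝ) + 1) • (hG.resolvent ((n : ℝ) + 1)⁻¹ - 1)) t u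
  rwa [hG.yosida_generator_apply n h] at this

theorem norm_yosidaExp_sub_le (n m : ℕ) {t : ℝ} (ht : 0 ≤ t) {u v : H} (h : (u, v) ∈ G) :
    ‖hG.yosidaExp n t u - hG.yosidaExp m t u‖ ≤
      t * ‖hG.resolvent ((n : ℝ) + 1)⁻¹ v - hG.resolvent ((m : ℝ) + 1)⁻¹ v‖ := by
  have hc : Commute (((n : ℝ) + 1) • (hG.resolvent ((n : ℝ) + 1)⁻¹ - 1))
      (((m : ℝ) + 1) • (hG.resolvent ((m : ℝ) + 1)⁻¹ - 1)) := by
    refine Commute.smul_left (Commute.smul_right ?_ _) _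
    refine Commute.sub_left (Commute.sub_right ?_ (Commute.one_right _)) (Commute.one_left _)
    ext f
    exact hG.resolvent_comm (by positivity) (by positivity) f
  have := norm_exp_smul_sub_exp_smul_le hc (fun s hs => hG.norm_yosidaExp_apply_le n hs)
    (fun s hs => hG.norm_yosidaExp_apply_le m hs) ht u
  rwa [hG.yosida_generator_apply n h, hG.yosida_generator_apply m h] at this

theorem exists_approx {η : ℝ} (hη : 0 < η) (u : H) : ∃ p ∈ G, ‖u - p.1‖ < η := by
  obtain ⟨w, hw, v, hv⟩ := Metric.dense_iff.mp hG.dense u η hη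
  rw [Metric.mem_ball, dist_eq_norm, norm_sub_rev] at hw
  exact ⟨(w, v), hv, hw⟩

theorem cauchySeq_yosidaExp {t : ℝ} (ht : 0 ≤ t) (u : H) :
    CauchySeq fun n => hG.yosidaExp n t u := by
  rw [Metric.cauchySeq_iff]
  intro η hη
  obtain ⟨⟨w, v⟩, hp, hw⟩ := hG.exists_approx (η := η / 4) (by positivity) u
  obtain ⟨N, hN⟩ := Metric.cauchySeq_iff.mp (hG.tendsto_resolvent v).cauchySeq (η / (2 * (t + 1)))
    (by positivity)
  refine ⟨N, fun m hm n hn => ?_⟩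
  have h1 := hN m hm n hn
  rw [dist_eq_norm] at h1 ⊢
  have h2 := hG.norm_yosidaExp_sub_le m n ht hp
  have h3 : t * ‖hG.resolvent ((m : ℝ) + 1)⁻¹ v - hG.resolvent ((n : ℝ) + 1)⁻¹ v‖ ≤ η / 2 := by
    rw [lt_div_iff₀ (by positivity)] at h1
    nlinarith [norm_nonneg (hG.resolvent ((m : ℝ) + 1)⁻¹ v - hG.resolvent ((n : ℝ) + 1)⁻¹ v)]
  have h4 := hG.norm_yosidaExp_apply_le m ht (u - w)
  have h5 := hG.norm_yosidaExp_apply_le n ht (u - w)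
  have e : hG.yosidaExp m t u - hG.yosidaExp n t u = hG.yosidaExp m t (u - w) +
      (hG.yosidaExp m t w - hG.yosidaExp n t w) - hG.yosidaExp n t (u - w) := by
    rw [map_sub, map_sub]; abel
  rw [e]
  have h6 := norm_sub_le (hG.yosidaExp m t (u - w) +
      (hG.yosidaExp m t w - hG.yosidaExp n t w)) (hG.yosidaExp n t (u - w))
  have h7 := norm_add_le (hG.yosidaExp m t (u - w)) (hG.yosidaExp m t w - hG.yosidaExp n t w)
  simp only at hw
  linarith

/-- The orbits of the semigroup generated by `A`. -/
def orbit (t : ℝ≥0) (u : H) : H := (cauchySeq_tendsto_of_complete (hG.cauchySeq_yosidaExp t.2 u)).choose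

theorem tendsto_orbit (t : ℝ≥0) (u : H) :
    Tendsto (fun n => hG.yosidaExp n t u) atTop (𝓝 (hG.orbit t u)) :=
  (cauchySeq_tendsto_of_complete (hG.cauchySeq_yosidaExp t.2 u)).choose_spec

/-- The contraction semigroup generated by `A`. -/
def semigroup (t : ℝ≥0) : H →L[ℝ] H :=
  continuousLinearMapOfTendsto (fun n => hG.yosidaExp n t) (f := hG.orbit t)
    (tendsto_pi_nhds.mpr (hG.tendsto_orbit t))

theorem tendsto_semigroup (t : ℝ≥0) (u : H) :
    Tendsto (fun n => hG.yosidaExp n t u) atTop (𝓝 (hG.semigroup t u)) :=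
  hG.tendsto_orbit t u

theorem norm_semigroup_apply_le (t : ℝ≥0) (u : H) : ‖hG.semigroup t u‖ ≤ ‖u‖ :=
  le_of_tendsto (hG.tendsto_semigroup t u).norm
    (Eventually.of_forall fun n => hG.norm_yosidaExp_apply_le n t.2 u)

theorem semigroup_mem {S : Set H} (hc : Convex ℝ S) (hcl : IsClosed S) (h0 : (0 : H) ∈ S)
    (hJ : ∀ ε, 0 < ε → ∀ u ∈ S, hG.resolvent ε u ∈ S) (t : ℝ≥0) {u : H}
    (hu : u ∈ S) : hG.semigroup t u ∈ S :=
  hcl.mem_of_tendsto (hG.tendsto_semigroup t u)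
    (Eventually.of_forall fun n => hG.yosidaExp_mem hc hcl h0 hJ n t.2 hu)

theorem semigroup_zero : hG.semigroup 0 = ContinuousLinearMap.id ℝ H := by
  ext u
  refine tendsto_nhds_unique (hG.tendsto_semigroup 0 u) ?_
  simp [yosidaExp, NormedSpace.exp_zero]

theorem semigroup_add (s t : ℝ≥0) :
    hG.semigroup (s + t) = (hG.semigroup s).comp (hG.semigroup t) := by
  ext u
  refine tendsto_nhds_unique (hG.tendsto_semigroup (s + t) u) ?_
  have h1 : ∀ n, hG.yosidaExp n ((s + t : ℝ≥0) : ℝ) u =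
      hG.yosidaExp n s (hG.yosidaExp n t u - hG.semigroup t u) +
        hG.yosidaExp n s (hG.semigroup t u) := fun n => by
    rw [← map_add, sub_add_cancel, yosidaExp, NNReal.coe_add, exp_add_smul]
    rfl
  simp_rw [h1]
  have h2 : Tendsto (fun n => hG.yosidaExp n s (hG.yosidaExp n t u - hG.semigroup t u)) atTop
      (𝓝 0) := by
    refine squeeze_zero_norm (fun n => hG.norm_yosidaExp_apply_le n s.2 _) ?_
    exact tendsto_iff_norm_sub_tendsto_zero.mp (hG.tendsto_semigroup t u)
  simpa using h2.add (hG.tendsto_semigroup s (hG.semigroup t u))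

theorem norm_yosidaExp_sub_self_le (n : ℕ) {t : ℝ} (ht : 0 ≤ t) {u v : H} (h : (u, v) ∈ G) :
    ‖hG.yosidaExp n t u - u‖ ≤ t * ‖v‖ := by
  have h1 := norm_image_sub_le_of_norm_deriv_le_segment' (a := 0) (b := t) (C := ‖v‖)
    (fun s _ => (hG.hasDerivAt_yosidaExp n h s).hasDerivWithinAt) (fun s hs =>
      (hG.norm_yosidaExp_apply_le n hs.1 _).trans
        (hG.norm_resolvent_apply_le (by positivity) v)) t ⟨ht, le_rfl⟩
  simpa [yosidaExp, NormedSpace.exp_zero, mul_comm] using h1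

theorem norm_semigroup_sub_self_le (t : ℝ≥0) {u v : H} (h : (u, v) ∈ G) :
    ‖hG.semigroup t u - u‖ ≤ t * ‖v‖ :=
  le_of_tendsto ((hG.tendsto_semigroup t u).sub_const u).norm
    (Eventually.of_forall fun n => hG.norm_yosidaExp_sub_self_le n t.2 h)

theorem norm_semigroup_sub_le {s t : ℝ≥0} (hst : s ≤ t) {u v : H} (h : (u, v) ∈ G) :
    ‖hG.semigroup t u - hG.semigroup s u‖ ≤ (t - s : ℝ) * ‖v‖ := by
  have e : t = s + (t - s) := (add_tsub_cancel_of_le hst).symm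
  have h2 : hG.semigroup t u - hG.semigroup s u =
      hG.semigroup s (hG.semigroup (t - s) u - u) := by
    conv_lhs => rw [e, hG.semigroup_add]
    rw [map_sub]; rfl
  rw [h2]
  refine (hG.norm_semigroup_apply_le s _).trans ((hG.norm_semigroup_sub_self_le _ h).trans_eq ?_)
  rw [NNReal.coe_sub hst]

/-- Orbits of elements of the domain are Lipschitz, and by contractivity every orbit is a uniform
limit of such orbits. -/
theorem continuous_semigroup (u : H) : Continuous fun t => hG.semigroup t u := by
  refine continuous_of_uniform_approx_of_continuous fun U hU => ?_
  obtain ⟨η, hη, hU⟩ := Metric.mem_uniformity_dist.mp hU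
  obtain ⟨⟨w, v⟩, hp, hw⟩ := hG.exists_approx hη u
  refine ⟨fun t => hG.semigroup t w, ?_, fun t => hU ?_⟩
  · refine (LipschitzWith.of_dist_le_mul (K := ‖v‖₊) fun s t => ?_).continuous
    rcases le_total s t with hst | hst
    · rw [dist_comm, dist_comm s, dist_eq_norm, NNReal.dist_eq,
        abs_of_nonneg (sub_nonneg.mpr (NNReal.coe_le_coe.mpr hst)), mul_comm]
      exact hG.norm_semigroup_sub_le hst hp
    · rw [dist_eq_norm, NNReal.dist_eq,
        abs_of_nonneg (sub_nonneg.mpr (NNReal.coe_le_coe.mpr hst)), mul_comm]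
      exact hG.norm_semigroup_sub_le hst hp
  · rw [dist_eq_norm, ← map_sub]
    exact (hG.norm_semigroup_apply_le t _).trans_lt hw

theorem isC0Semigroup : IsC0Semigroup hG.semigroup :=
  ⟨hG.semigroup_zero, hG.semigroup_add, hG.continuous_semigroup⟩

/-- The remainder is the integral of `T_s v - v`. As `v` need not be in the domain, it is compared
with a point `p.1` of the domain near `v`, where `‖T_s p.1 - p.1‖ ≤ s‖p.2‖`. The estimate is carried
out on the Yosida approximations. -/
theorem norm_semigroup_sub_sub_le (t : ℝ≥0) {u v : H} (h : (u, v) ∈ G) {p : H × H} (hp : p ∈ G) :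
    ‖hG.semigroup t u - u - (t : ℝ) • v‖ ≤ t * (2 * ‖v - p.1‖ + t * ‖p.2‖) := by
  have hJ : Tendsto (fun n : ℕ => ‖hG.resolvent ((n : ℝ) + 1)⁻¹ v - v‖) atTop (𝓝 0) :=
    tendsto_iff_norm_sub_tendsto_zero.mp (hG.tendsto_resolvent v)
  have hl : Tendsto (fun n : ℕ => hG.yosidaExp n t u - u -
      (t : ℝ) • hG.resolvent ((n : ℝ) + 1)⁻¹ v) atTop
      (𝓝 (hG.semigroup t u - u - (t : ℝ) • v)) :=
    ((hG.tendsto_semigroup t u).sub_const u).sub ((hG.tendsto_resolvent v).const_smul _)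
  have hr : Tendsto (fun n : ℕ => (t : ℝ) * (2 * ‖hG.resolvent ((n : ℝ) + 1)⁻¹ v - v‖ +
      (2 * ‖v - p.1‖ + t * ‖p.2‖))) atTop (𝓝 (t * (2 * 0 + (2 * ‖v - p.1‖ + t * ‖p.2‖)))) :=
    ((hJ.const_mul 2).add_const _).const_mul _
  rw [mul_zero, zero_add] at hr
  refine le_of_tendsto_of_tendsto hl.norm hr (Eventually.of_forall fun n => ?_)
  set w := hG.resolvent ((n : ℝ) + 1)⁻¹ v
  have hd : ∀ s : ℝ, HasDerivAt (fun s => hG.yosidaExp n s u - s • w)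
      (hG.yosidaExp n s w - w) s := fun s => by
    have := (hG.hasDerivAt_yosidaExp n h s).sub ((hasDerivAt_id s).smul_const w)
    rw [one_smul] at this
    exact this
  have h1 := norm_image_sub_le_of_norm_deriv_le_segment' (a := 0) (b := t)
    (C := 2 * ‖w - v‖ + (2 * ‖v - p.1‖ + t * ‖p.2‖))
    (fun s _ => (hd s).hasDerivWithinAt) (fun s hs => ?_) t ⟨t.2, le_rfl⟩
  · have e : hG.yosidaExp n t u - (t : ℝ) • w - (hG.yosidaExp n 0 u - (0 : ℝ) • w) =
        hG.yosidaExp n t u - u - (t : ℝ) • w := by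
      simp only [yosidaExp, zero_smul, NormedSpace.exp_zero, one_apply_eq_self, sub_zero]
      abel
    rw [e, sub_zero, mul_comm] at h1
    exact h1
  · have e : hG.yosidaExp n s w - w = hG.yosidaExp n s (w - v) + hG.yosidaExp n s (v - p.1) +
        (hG.yosidaExp n s p.1 - p.1) - (w - v) - (v - p.1) := by
      simp only [map_sub]; abel
    have a1 := hG.norm_yosidaExp_apply_le n hs.1 (w - v)
    have a2 := hG.norm_yosidaExp_apply_le n hs.1 (v - p.1)
    have a3 := hG.norm_yosidaExp_sub_self_le n hs.1 (u := p.1) (v := p.2) hp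
    have a4 : s * ‖p.2‖ ≤ t * ‖p.2‖ := by gcongr; exact hs.2.le
    rw [e]
    have b1 := norm_sub_le (hG.yosidaExp n s (w - v) + hG.yosidaExp n s (v - p.1) +
        (hG.yosidaExp n s p.1 - p.1) - (w - v)) (v - p.1)
    have b2 := norm_sub_le (hG.yosidaExp n s (w - v) + hG.yosidaExp n s (v - p.1) +
        (hG.yosidaExp n s p.1 - p.1)) (w - v)
    have b3 := norm_add_le (hG.yosidaExp n s (w - v) + hG.yosidaExp n s (v - p.1))
        (hG.yosidaExp n s p.1 - p.1)
    have b4 := norm_add_le (hG.yosidaExp n s (w - v)) (hG.yosidaExp n s (v - p.1))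
    linarith

theorem tendsto_slope_semigroup {u v : H} (h : (u, v) ∈ G) :
    Tendsto (fun t : ℝ≥0 => (t : ℝ)⁻¹ • (hG.semigroup t u - u)) (𝓝[>] 0) (𝓝 v) := by
  rw [tendsto_iff_norm_sub_tendsto_zero, Metric.tendsto_nhds]
  intro η hη
  obtain ⟨p, hp, hv⟩ := hG.exists_approx (η := η / 4) (by positivity) v
  have h1 : ∀ᶠ t : ℝ≥0 in 𝓝[>] 0, (t : ℝ) * ‖p.2‖ < η / 2 := by
    have : Tendsto (fun t : ℝ≥0 => (t : ℝ) * ‖p.2‖) (𝓝[>] 0) (𝓝 (((0 : ℝ≥0) : ℝ) * ‖p.2‖)) :=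
      ((NNReal.continuous_coe.tendsto 0).mono_left nhdsWithin_le_nhds).mul_const _
    refine this.eventually (gt_mem_nhds ?_)
    simpa using half_pos hη
  filter_upwards [h1, self_mem_nhdsWithin] with t ht ht0
  have ht0' : (0 : ℝ) < t := ht0
  have h2 := hG.norm_semigroup_sub_sub_le t h hp
  have e : (t : ℝ)⁻¹ • (hG.semigroup t u - u) - v =
      (t : ℝ)⁻¹ • (hG.semigroup t u - u - (t : ℝ) • v) := by
    rw [smul_sub _ (hG.semigroup t u - u), inv_smul_smul₀ ht0'.ne']
  rw [Real.dist_0_eq_abs, abs_norm, e, norm_smul, norm_inv, Real.norm_of_nonneg ht0'.le,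
    inv_mul_lt_iff₀ ht0']
  refine h2.trans_lt ?_
  gcongr
  linarith

/-- A dissipative extension of `A` cannot be proper: solve `w - Aw = u - v` in the domain; then `d =
u - w` equals `v - Aw`, the limit of its own slopes, and contractivity gives `(d, d) ≤ 0`. -/
theorem mem_of_tendsto_slope {u v : H}
    (h : Tendsto (fun t : ℝ≥0 => (t : ℝ)⁻¹ • (hG.semigroup t u - u)) (𝓝[>] 0) (𝓝 v)) :
    (u, v) ∈ G := by
  obtain ⟨⟨w, z⟩, hw, hwz⟩ := hG.surj 1 one_pos (u - v)
  have h1 := h.sub (hG.tendsto_slope_semigroup hw)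
  have h2 : Tendsto (fun t : ℝ≥0 => inner ℝ ((t : ℝ)⁻¹ • (hG.semigroup t (u - w) - (u - w))) (u - w))
      (𝓝[>] 0) (𝓝 (inner ℝ (v - z) (u - w))) := by
    refine Tendsto.inner ?_ tendsto_const_nhds
    refine h1.congr fun t => ?_
    rw [← smul_sub, map_sub]; congr 1; abel
  have h3 : inner ℝ (v - z) (u - w) ≤ 0 := by
    have hne : (𝓝[>] (0 : ℝ≥0)).NeBot := inferInstance
    refine le_of_tendsto h2 (Eventually.of_forall fun t => ?_)
    rw [inner_smul_left, inner_sub_left, real_inner_self_eq_norm_sq]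
    have a := real_inner_le_norm (hG.semigroup t (u - w)) (u - w)
    have b := hG.norm_semigroup_apply_le t (u - w)
    refine mul_nonpos_of_nonneg_of_nonpos (by simp) ?_
    nlinarith [norm_nonneg (u - w)]
  have h4 : v - z = u - w := by
    simp only [one_smul] at hwz
    rw [sub_eq_sub_iff_add_eq_add, add_comm v] at *
    rw [← hwz]
  rw [h4, real_inner_self_eq_norm_sq] at h3
  have h5 : u - w = 0 := by
    have := sq_nonneg ‖u - w‖
    exact norm_eq_zero.mp (pow_eq_zero_iff two_ne_zero |>.mp (le_antisymm h3 this))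
  rw [h5] at h4
  rw [sub_eq_zero.mp h5, sub_eq_zero.mp h4]
  exact hw

theorem isGenerator {A : H →ₗ.[ℝ] H} (hA : A.graph = G) : IsGenerator A hG.semigroup := by
  subst hA
  exact fun u v => ⟨hG.tendsto_slope_semigroup, hG.mem_of_tendsto_slope⟩

end MDissipative

end HilleYosida

end

section

/-! ### Self-adjoint operators of closed forms -/

section SelfAdjoint

variable {H : Type*} [NormedAddCommGroup H] [InnerProductSpace ℝ H] [CompleteSpace H]

theorem _root_.IsSelfAdjoint.mem_graph_iff {A : H →ₗ.[ℝ] H} (hA : IsSelfAdjoint A) {u v : H} :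
    (u, v) ∈ A.graph ↔ ∀ a b, (a, b) ∈ A.graph → inner ℝ b u = inner ℝ a v := by
  conv_lhs => rw [← LinearPMap.isSelfAdjoint_def.mp hA,
    LinearPMap.adjoint_graph_eq_graph_adjoint hA.dense_domain]
  simp only [Submodule.mem_adjoint_iff, sub_eq_zero]

/-- Taking adjoints reverses inclusions, so `A ⊆ B` gives `B = B* ⊆ A* = A`. -/
theorem eq_of_le_of_isSelfAdjoint {A B : H →ₗ.[ℝ] H} (hA : IsSelfAdjoint A) (hB : IsSelfAdjoint B)
    (h : A ≤ B) : A = B := by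
  refine le_antisymm h (LinearPMap.le_of_le_graph ?_)
  rintro ⟨u, v⟩ huv
  rw [hA.mem_graph_iff]
  exact fun a b hab => hB.mem_graph_iff.mp huv a b (LinearPMap.le_graph_of_le h hab)

/-- The graph of the self-adjoint operator of the closed form `‖g‖²`, `(u, g) ∈ V`. -/
def formGraph {K : Type*} [NormedAddCommGroup K] [InnerProductSpace ℝ K]
    (V : Submodule ℝ (H × K)) : Submodule ℝ (H × H) where
  carrier := {p | ∃ g, (p.1, g) ∈ V ∧ ∀ q ∈ V, inner ℝ p.2 q.1 = -inner ℝ g q.2}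
  zero_mem' := ⟨0, V.zero_mem, fun q _ => by simp⟩
  add_mem' := by
    rintro p p' ⟨g, hg, hp⟩ ⟨g', hg', hp'⟩
    refine ⟨g + g', V.add_mem hg hg', fun q hq => ?_⟩
    rw [Prod.snd_add, inner_add_left, inner_add_left, hp q hq, hp' q hq, neg_add]
  smul_mem' := by
    rintro c p ⟨g, hg, hp⟩
    refine ⟨c • g, V.smul_mem c hg, fun q hq => ?_⟩
    rw [Prod.smul_snd, inner_smul_left, inner_smul_left, hp q hq, mul_neg]

/-- A closed, densely defined form `u ↦ ‖g‖²`, `(u, g) ∈ V`. -/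
structure IsClosedForm {K : Type*} [NormedAddCommGroup K] [InnerProductSpace ℝ K]
    (V : Submodule ℝ (H × K)) : Prop where
  isClosed : IsClosed (V : Set (H × K))
  eq_zero : ∀ g, ((0 : H), g) ∈ V → g = 0
  dense : Dense {u : H | ∃ g, (u, g) ∈ V}

variable {K : Type*} [NormedAddCommGroup K] [InnerProductSpace ℝ K] [CompleteSpace K]

/-- The norm of `H × K` is the maximum norm, so the projection is taken in the Hilbert space `WithLp
2 (H × K)`, which has the same topology. -/
theorem exists_orthogonal_projection {V : Submodule ℝ (H × K)} (hV : IsClosed (V : Set (H × K)))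
    (f : H) (k : K) : ∃ u g, (u, g) ∈ V ∧
      ∀ q ∈ V, inner ℝ (f - u) q.1 + inner ℝ (k - g) q.2 = 0 := by
  set e := WithLp.prodContinuousLinearEquiv 2 ℝ H K
  set W : Submodule ℝ (WithLp 2 (H × K)) := V.comap e.toLinearMap with hW
  have hWc : IsClosed (W : Set (WithLp 2 (H × K))) := hV.preimage e.continuous
  have : CompleteSpace W := hWc.completeSpace_coe
  set x : WithLp 2 (H × K) := WithLp.toLp 2 (f, k)
  refine ⟨(W.starProjection x).fst, (W.starProjection x).snd, W.starProjection_apply_mem x,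
    fun q hq => ?_⟩
  have h := W.starProjection_inner_eq_zero x (WithLp.toLp 2 q) hq
  rw [WithLp.prod_inner_apply] at h
  exact h

/-- The equation `u - εAu = f` says that `(u, g)` is the projection of `(f, 0)` on `V` for the inner
product with weight `ε` on the second factor. -/
theorem formGraph_mDissipative {V : Submodule ℝ (H × K)} (hV : IsClosedForm V) :
    MDissipative (formGraph V) := by
  have key : ∀ f : H, ∀ c : ℝ, 0 < c → ∃ u g, (u, g) ∈ V ∧
      ∀ q ∈ V, inner ℝ (f - u) q.1 = c * inner ℝ g q.2 := by
    intro f c hc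
    -- Scaling the second factor by `√c` turns the weighted projection into an ordinary one.
    set e : (H × K) ≃L[ℝ] (H × K) := (ContinuousLinearEquiv.refl ℝ H).prodCongr
      (ContinuousLinearEquiv.smulLeft (Units.mk0 (√c) (Real.sqrt_pos.mpr hc).ne'))
    have he : ∀ q, e q = (q.1, √c • q.2) := fun q => rfl
    set W : Submodule ℝ (H × K) := V.comap e.symm.toLinearMap
    have hW : IsClosed (W : Set (H × K)) := hV.isClosed.preimage e.symm.continuous
    obtain ⟨u, g, hug, h⟩ := exists_orthogonal_projection hW f 0
    have h0 : e ((e.symm (u, g)).1, (e.symm (u, g)).2) = (u, g) := e.apply_symm_apply (u, g)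
    rw [he, Prod.mk.injEq] at h0
    refine ⟨u, (e.symm (u, g)).2, ?_, fun q hq => ?_⟩
    · rw [← h0.1]; exact hug
    · have h1 := h (e q) (by change e.symm (e q) ∈ V; rwa [e.symm_apply_apply])
      rw [he, ← h0.2] at h1
      simp only [zero_sub, inner_neg_left, inner_smul_left, inner_smul_right, conj_trivial] at h1
      have h2 := Real.mul_self_sqrt hc.le
      linear_combination h1 + inner ℝ (e.symm (u, g)).2 q.2 * h2
  refine ⟨?_, fun ε hε f => ?_, ?_⟩
  · rintro ⟨u, v⟩ ⟨g, hg, h⟩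
    rw [h _ hg]
    simp
  · obtain ⟨u, g, hug, h⟩ := key f ε hε
    refine ⟨(u, ε⁻¹ • (u - f)), ⟨g, hug, fun q hq => ?_⟩, by simp [hε.ne']⟩
    have := h q hq
    rw [inner_smul_left, ← neg_sub f u, inner_neg_left, this]
    simp [hε.ne']
  · have hs : {u : H | ∃ v, (u, v) ∈ formGraph V} =
        ((formGraph V).map (LinearMap.fst ℝ H H) : Submodule ℝ H) := by
      ext u; simp
    rw [hs, Submodule.dense_iff_topologicalClosure_eq_top, Submodule.topologicalClosure_eq_top_iff,
      Submodule.eq_bot_iff]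
    -- If `f` is orthogonal to the domain and `u = (1 - A)⁻¹ f`, then `0 = (f, u) = ‖u‖² + ‖g‖²`. So
    -- `u` and `g` vanish, and then `f` is orthogonal to the dense form domain.
    intro f hf
    obtain ⟨u, g, hug, h⟩ := key f 1 one_pos
    have hu : u ∈ (formGraph V).map (LinearMap.fst ℝ H H) := by
      refine ⟨(u, u - f), ⟨g, hug, fun q hq => ?_⟩, rfl⟩
      have := h q hq
      rw [← neg_sub f u, inner_neg_left, this, one_mul]
    have h1 := Submodule.mem_orthogonal _ f |>.mp hf u hu
    have h2 := h _ hug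
    simp only [inner_sub_left, one_mul] at h2
    rw [real_inner_comm] at h1
    rw [h1, real_inner_self_eq_norm_sq, real_inner_self_eq_norm_sq] at h2
    have hu0 : u = 0 := by
      rw [← norm_eq_zero, ← pow_eq_zero_iff two_ne_zero]
      nlinarith [sq_nonneg ‖u‖, sq_nonneg ‖g‖]
    subst hu0
    have hg0 := hV.eq_zero g hug
    subst hg0
    refine hV.dense.eq_zero_of_inner_left ℝ fun z hz => ?_
    obtain ⟨k, hk⟩ := hz
    have := h _ hk
    simpa using this

theorem formGraph_unique {V : Submodule ℝ (H × K)} (hV : IsClosedForm V) :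
    ∀ x ∈ formGraph V, x.1 = 0 → x.2 = 0 := by
  rintro ⟨u, v⟩ ⟨g, hg, h⟩ (rfl : u = 0)
  have hg0 := hV.eq_zero g hg
  subst hg0
  refine hV.dense.eq_zero_of_inner_left ℝ ?_
  rintro z ⟨k, hk⟩
  simpa using h _ hk

/-- A symmetric operator for which `1 - A` is surjective is self-adjoint. -/
theorem isSelfAdjoint_of_graph_eq_formGraph {V : Submodule ℝ (H × K)} (hV : IsClosedForm V)
    {A : H →ₗ.[ℝ] H} (hA : A.graph = formGraph V) : IsSelfAdjoint A := by
  have hG := formGraph_mDissipative hV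
  have hd : Dense (A.domain : Set H) := by
    convert hG.dense using 1
    ext u
    simp only [SetLike.mem_coe, mem_ofPred_eq, ← hA, LinearPMap.mem_domain_iff]
  have hs : ∀ p ∈ formGraph V, ∀ q ∈ formGraph V, (inner ℝ p.2 q.1 : ℝ) = inner ℝ p.1 q.2 := by
    rintro p ⟨g, hg, hp⟩ q ⟨k, hk, hq⟩
    rw [hp _ hk, real_inner_comm q.2, hq _ hg, real_inner_comm]
  rw [LinearPMap.isSelfAdjoint_def]
  refine LinearPMap.eq_of_eq_graph ?_
  rw [LinearPMap.adjoint_graph_eq_graph_adjoint hd, hA]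
  ext ⟨y, z⟩
  simp only [Submodule.mem_adjoint_iff, sub_eq_zero]
  refine ⟨fun h => ?_, fun h a b hab => hs _ hab _ h⟩
  -- For `(y, z)` in the adjoint, `u` is the element of the domain with `u - Au = y - z`. Then `y -
  -- u` is orthogonal to the range of `1 - A`; choosing `a - Aa = y - u` gives `‖y - u‖² = 0`.
  obtain ⟨⟨u, v⟩, huv, he⟩ := hG.surj 1 one_pos (y - z)
  simp only [one_smul] at he
  obtain ⟨⟨a, b⟩, hab, hab'⟩ := hG.surj 1 one_pos (y - u)
  simp only [one_smul] at hab'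
  have h1 := h a b hab
  have h2 := hs _ hab _ huv
  simp only at h2
  have h3 : inner ℝ (a - b) (y - u) = (0 : ℝ) := by
    have e : v = u - (y - z) := by rw [← he]; abel
    rw [e] at h2
    simp only [inner_sub_left, inner_sub_right] at h1 h2 ⊢
    linarith
  rw [hab'] at h3
  have h4 : y = u := sub_eq_zero.mp (inner_self_eq_zero.mp h3)
  subst h4
  have h5 : z = v := by simpa using he.symm
  rwa [h5]

/-- `u = (1 - εA)⁻¹ f` minimizes `‖u - f‖² + ε ‖∇u‖²`. -/
theorem resolvent_formGraph_minimizes {V : Submodule ℝ (H × K)} (hV : IsClosedForm V) {ε : ℝ}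
    (hε : 0 < ε) (f : H) : ∃ g, ((formGraph_mDissipative hV).resolvent ε f, g) ∈ V ∧
      ∀ q ∈ V, ‖(formGraph_mDissipative hV).resolvent ε f - f‖ ^ 2 + ε * ‖g‖ ^ 2 +
        ‖q.1 - (formGraph_mDissipative hV).resolvent ε f‖ ^ 2 ≤ ‖q.1 - f‖ ^ 2 + ε * ‖q.2‖ ^ 2 := by
  set hG := formGraph_mDissipative hV
  obtain ⟨v, ⟨g, hg, h⟩, hv⟩ := hG.resolvent_spec hε f
  simp only at hg h
  refine ⟨g, hg, fun q hq => ?_⟩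
  set u := hG.resolvent ε f
  -- The Euler–Lagrange equation in the direction `q - (u, g)`; it makes the first order terms of
  -- the two expansions below cancel.
  have h1 := h _ (V.sub_mem hq hg)
  simp only [Prod.fst_sub, Prod.snd_sub] at h1
  have e1 : u - f = ε • v := by rw [← hv]; abel
  have e2 : q.1 - f = (u - f) + (q.1 - u) := by abel
  have e3 : q.2 = g + (q.2 - g) := by abel
  have h2 : ‖q.1 - f‖ ^ 2 = ‖u - f‖ ^ 2 + 2 * (ε * inner ℝ v (q.1 - u)) + ‖q.1 - u‖ ^ 2 := by
    rw [e2, norm_add_sq_real, e1, inner_smul_left]; simp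
  have h3 : ‖q.2‖ ^ 2 = ‖g‖ ^ 2 + 2 * inner ℝ g (q.2 - g) + ‖q.2 - g‖ ^ 2 := by
    conv_lhs => rw [e3]
    rw [norm_add_sq_real]
  rw [h2, h3, h1]
  nlinarith [mul_nonneg hε.le (sq_nonneg ‖q.2 - g‖)]

end SelfAdjoint

/-! ### Contractivity and symmetry of a semigroup with self-adjoint generator -/

section Generator

variable {H : Type*} [NormedAddCommGroup H] [InnerProductSpace ℝ H]
  {A : H →ₗ.[ℝ] H} {T : ℝ≥0 → H →L[ℝ] H}

theorem generator_commutes (hT : IsC0Semigroup T) (hA : IsGenerator A T) {u v : H}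
    (h : (u, v) ∈ A.graph) (t : ℝ≥0) : (T t u, T t v) ∈ A.graph := by
  rw [hA] at h ⊢
  refine (((T t).continuous.tendsto v).comp h).congr fun s => ?_
  have : T s (T t u) = T t (T s u) := by
    rw [← ContinuousLinearMap.comp_apply, ← hT.map_add, add_comm, hT.map_add]; rfl
  simp [this]

/-- Only right derivatives are used, since these follow at once from the definition of the
generator. -/
theorem tendsto_slope_orbit (hT : IsC0Semigroup T) (hA : IsGenerator A T) {u v : H}
    (h : (u, v) ∈ A.graph) (t : ℝ) (ht : 0 ≤ t) :
    HasDerivWithinAt (fun s : ℝ => T s.toNNReal u) (T t.toNNReal v) (Ici t) t := by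
  rw [hasDerivWithinAt_iff_tendsto_slope, Ici_sdiff_left]
  have h1 := (hA _ _).mp (generator_commutes hT hA h t.toNNReal)
  have h2 : Tendsto (fun s : ℝ => (s - t).toNNReal) (𝓝[>] t) (𝓝[>] 0) := by
    refine tendsto_nhdsWithin_iff.mpr ⟨?_, ?_⟩
    · have : Continuous fun s : ℝ => (s - t).toNNReal := by fun_prop
      simpa using (this.tendsto t).mono_left nhdsWithin_le_nhds
    · filter_upwards [self_mem_nhdsWithin] with s hs
      exact Real.toNNReal_pos.mpr (sub_pos.mpr hs)
  refine (h1.comp h2).congr' ?_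
  filter_upwards [self_mem_nhdsWithin] with s hs
  have hs' : 0 < s - t := sub_pos.mpr hs
  have e : s.toNNReal = (s - t).toNNReal + t.toNNReal := by
    rw [← Real.toNNReal_add hs'.le ht]; simp
  simp only [Function.comp, slope_def_module, Real.coe_toNNReal _ hs'.le]
  rw [e, hT.map_add]
  rfl

theorem continuous_orbit (hT : IsC0Semigroup T) (u : H) :
    Continuous fun s : ℝ => T s.toNNReal u :=
  (hT.continuous u).comp continuous_real_toNNReal

/-- Contractivity is not part of `IsC0Semigroup`. It follows from `d/ds ‖T_s w‖² = 2(A T_s w, T_s w)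
≤ 0` on the dense domain. -/
theorem norm_le_of_generator (hT : IsC0Semigroup T) (hA : IsGenerator A T)
    (hneg : ∀ u : A.domain, inner ℝ (A u) (u : H) ≤ 0) (hd : Dense (A.domain : Set H))
    (t : ℝ≥0) (u : H) : ‖T t u‖ ≤ ‖u‖ := by
  have hc : IsClosed {u : H | ‖T t u‖ ≤ ‖u‖} :=
    isClosed_le (T t).continuous.norm continuous_norm
  refine hd.induction (P := fun u => ‖T t u‖ ≤ ‖u‖) (fun w hw => ?_) hc u
  have hg : (w, A ⟨w, hw⟩) ∈ A.graph := A.mem_graph ⟨w, hw⟩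
  have hder : ∀ s ∈ Ico (0 : ℝ) t, HasDerivWithinAt (fun s : ℝ => ‖T s.toNNReal w‖ ^ 2)
      (2 * inner ℝ (T s.toNNReal w) (T s.toNNReal (A ⟨w, hw⟩))) (Ici s) s := fun s hs =>
    (tendsto_slope_orbit hT hA hg s hs.1).norm_sq
  have h := image_le_of_deriv_right_le_deriv_boundary (a := 0) (b := t)
    (f := fun s : ℝ => ‖T s.toNNReal w‖ ^ 2) (B := fun _ => ‖w‖ ^ 2) (B' := fun _ => 0)
    ((continuous_orbit hT w).norm.pow 2).continuousOn hder
    (by simp [hT.map_zero]) continuousOn_const (fun s _ => hasDerivWithinAt_const _ _ _)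
    (fun s hs => ?_) (x := t) ⟨t.2, le_rfl⟩
  · simp only [Real.toNNReal_coe] at h
    exact le_of_sq_le_sq h (norm_nonneg _)
  · have h2 := generator_commutes hT hA hg s.toNNReal
    obtain ⟨y, hy1, hy2⟩ := (LinearPMap.mem_graph_iff A).mp h2
    have := hneg y
    rw [hy1, hy2] at this
    simp only at this
    rw [real_inner_comm]
    linarith

/-- The function `s ↦ (T_s w, T_{t-s} z)` is constant on `[0, t]`, because its right derivative `(A
T_s w, T_{t-s} z) - (T_s w, A T_{t-s} z)` vanishes. Compare its values at `0` and `t`. -/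
theorem inner_symm_of_generator [CompleteSpace H] (hT : IsC0Semigroup T) (hA : IsGenerator A T)
    (hneg : ∀ u : A.domain, inner ℝ (A u) (u : H) ≤ 0) (hsa : IsSelfAdjoint A)
    (t : ℝ≥0) (u v : H) : (inner ℝ (T t u) v : ℝ) = inner ℝ u (T t v) := by
  have hd := hsa.dense_domain
  have hle := norm_le_of_generator hT hA hneg hd
  refine hd.induction (P := fun u => ∀ v, (inner ℝ (T t u) v : ℝ) = inner ℝ u (T t v))
    (fun w hw v => ?_) ?_ u v
  swap
  · simp only [ofPred_forall]
    refine isClosed_iInter fun v => isClosed_eq ?_ ?_ <;> fun_prop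
  refine hd.induction (P := fun v => (inner ℝ (T t w) v : ℝ) = inner ℝ w (T t v))
    (fun z hz => ?_) ?_ v
  swap
  · refine isClosed_eq ?_ ?_ <;> fun_prop
  have hwg : (w, A ⟨w, hw⟩) ∈ A.graph := A.mem_graph ⟨w, hw⟩
  have hzg : (z, A ⟨z, hz⟩) ∈ A.graph := A.mem_graph ⟨z, hz⟩
  set F : ℝ → ℝ := fun s => inner ℝ (T s.toNNReal w) (T (t - s).toNNReal z)
  have hcont : Continuous F := (continuous_orbit hT w).inner
    ((continuous_orbit hT z).comp (continuous_const.sub continuous_id))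
  have hder : ∀ s ∈ Ico (0 : ℝ) t, HasDerivWithinAt F 0 (Ici s) s := by
    intro s hs
    rw [hasDerivWithinAt_iff_tendsto_slope, Ici_sdiff_left]
    have h1 : Tendsto (fun r => slope (fun s : ℝ => T s.toNNReal w) s r) (𝓝[>] s)
        (𝓝 (T s.toNNReal (A ⟨w, hw⟩))) := by
      have := tendsto_slope_orbit hT hA hwg s hs.1
      rwa [hasDerivWithinAt_iff_tendsto_slope, Ici_sdiff_left] at this
    have h2 : Tendsto (fun r : ℝ => T (t - r).toNNReal z) (𝓝[>] s) (𝓝 (T (t - s).toNNReal z)) :=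
      (((continuous_orbit hT z).comp (continuous_const.sub continuous_id)).tendsto s).mono_left
        nhdsWithin_le_nhds
    have h3 : Tendsto (fun r => slope (fun s : ℝ => T s.toNNReal z) 0 (r - s)) (𝓝[>] s)
        (𝓝 (A ⟨z, hz⟩)) := by
      have := tendsto_slope_orbit hT hA hzg 0 le_rfl
      rw [hasDerivWithinAt_iff_tendsto_slope, Ici_sdiff_left] at this
      simp only [Real.toNNReal_zero, hT.map_zero, ContinuousLinearMap.id_apply] at this
      refine this.comp (tendsto_nhdsWithin_iff.mpr ⟨?_, ?_⟩)
      · have : Continuous fun r : ℝ => r - s := by fun_prop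
        simpa using (this.tendsto s).mono_left nhdsWithin_le_nhds
      · filter_upwards [self_mem_nhdsWithin] with r hr
        exact sub_pos.mpr (mem_Ioi.mp hr)
    -- For `r > s` the increment of `T_{t-s} z` is written with `T_{t-s} = T_{t-r} T_{r-s}`. Since
    -- `T_{t-r}` varies with `r`, contractivity is needed to pass to the limit.
    have h4 : Tendsto (fun r : ℝ => T (t - r).toNNReal (slope (fun s : ℝ => T s.toNNReal z) 0 (r - s)))
        (𝓝[>] s) (𝓝 (T (t - s).toNNReal (A ⟨z, hz⟩))) := by
      have a1 : Tendsto (fun r : ℝ => T (t - r).toNNReal (A ⟨z, hz⟩)) (𝓝[>] s)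
          (𝓝 (T (t - s).toNNReal (A ⟨z, hz⟩))) :=
        (((continuous_orbit hT _).comp (continuous_const.sub continuous_id)).tendsto s).mono_left
          nhdsWithin_le_nhds
      have a2 : Tendsto (fun r : ℝ => T (t - r).toNNReal
          (slope (fun s : ℝ => T s.toNNReal z) 0 (r - s) - A ⟨z, hz⟩)) (𝓝[>] s) (𝓝 0) :=
        squeeze_zero_norm (fun r => hle _ _) (tendsto_iff_norm_sub_tendsto_zero.mp h3)
      simpa using a2.add a1
    have h5 := (h1.inner h2 (𝕜 := ℝ)).sub
      ((tendsto_const_nhds (x := T s.toNNReal w)).inner h4 (𝕜 := ℝ))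
    have h6 : (inner ℝ (T s.toNNReal (A ⟨w, hw⟩)) (T (t - s).toNNReal z) : ℝ) -
        inner ℝ (T s.toNNReal w) (T (t - s).toNNReal (A ⟨z, hz⟩)) = 0 := by
      have b1 := generator_commutes hT hA hwg s.toNNReal
      have b2 := generator_commutes hT hA hzg (t - s).toNNReal
      rw [hsa.mem_graph_iff.mp b2 _ _ b1, sub_self]
    rw [h6] at h5
    refine h5.congr' ?_
    have ht : s < t := hs.2
    filter_upwards [Ioo_mem_nhdsGT ht] with r hr
    have hrs : 0 < r - s := sub_pos.mpr hr.1
    have e : (t - s : ℝ).toNNReal = (t - r : ℝ).toNNReal + (r - s).toNNReal := by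
      rw [← Real.toNNReal_add (sub_nonneg.mpr hr.2.le) hrs.le]; congr 1; ring
    simp only [slope_def_module, F, sub_zero, Real.toNNReal_zero, hT.map_zero, map_smul, map_sub,
      ContinuousLinearMap.id_apply, inner_smul_left, inner_smul_right, inner_sub_left,
      inner_sub_right, smul_eq_mul, conj_trivial]
    rw [e, hT.map_add, ContinuousLinearMap.comp_apply]
    ring
  have h := constant_of_has_deriv_right_zero hcont.continuousOn hder t ⟨t.2, le_rfl⟩
  simpa [F, hT.map_zero] using h

end Generator

end

/-! ### A smooth normal contraction and a criterion for Markovian operators -/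

section

theorem hasDerivAt_expNegInvGlue (x : ℝ) :
    HasDerivAt expNegInvGlue (x⁻¹ ^ 2 * expNegInvGlue x) x := by
  simpa using expNegInvGlue.hasDerivAt_polynomial_eval_inv_mul 1 x

/-- This is the derivative of `e^{-1/x}`. Its bound by `1` is what keeps the derivative of `squash`
in `[0, 1]`. -/
theorem sq_inv_mul_expNegInvGlue_mem (x : ℝ) :
    0 ≤ x⁻¹ ^ 2 * expNegInvGlue x ∧ x⁻¹ ^ 2 * expNegInvGlue x ≤ 1 := by
  refine ⟨mul_nonneg (sq_nonneg _) (expNegInvGlue.nonneg x), ?_⟩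
  rcases le_or_gt x 0 with hx | hx
  · rw [expNegInvGlue.zero_of_nonpos hx]; simp
  · have hy : 0 < x⁻¹ := inv_pos.mpr hx
    -- With `y = 1/x`, from `e^{y/2 - 1} ≥ y/2` and `e ≥ 2`.
    have h1 : x⁻¹ ≤ Real.exp (x⁻¹ / 2) := by
      have h2 := Real.add_one_le_exp (x⁻¹ / 2 - 1)
      have h3 : Real.exp (x⁻¹ / 2) = Real.exp (x⁻¹ / 2 - 1) * Real.exp 1 := by
        rw [← Real.exp_add]; congr 1; ring
      have h4 := Real.add_one_le_exp 1
      rw [h3]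
      nlinarith
    have h5 : expNegInvGlue x = Real.exp (-x⁻¹) := by simp [expNegInvGlue, not_le.mpr hx]
    rw [h5, Real.exp_neg, ← div_eq_mul_inv, div_le_one (Real.exp_pos _)]
    calc x⁻¹ ^ 2 ≤ Real.exp (x⁻¹ / 2) ^ 2 := by gcongr
      _ = Real.exp x⁻¹ := by rw [← Real.exp_nat_mul]; congr 1; push_cast; ring

/-- A smooth normal contraction whose set of fixed points is `[0, 1]`. -/
def squash (s : ℝ) : ℝ := s - expNegInvGlue (s - 1) + expNegInvGlue (-s)

theorem squash_contDiff : ContDiff ℝ ∞ squash :=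
  (contDiff_id.sub (expNegInvGlue.contDiff.comp (contDiff_id.sub contDiff_const))).add
    (expNegInvGlue.contDiff.comp contDiff_neg)

theorem squash_zero : squash 0 = 0 := by
  simp [squash, expNegInvGlue.zero_of_nonpos]

theorem hasDerivAt_squash (s : ℝ) : ∃ d, HasDerivAt squash d s ∧ 0 ≤ d ∧ d ≤ 1 := by
  have h1 := (hasDerivAt_expNegInvGlue (s - 1)).comp s ((hasDerivAt_id s).sub_const 1)
  have h2 := (hasDerivAt_expNegInvGlue (-s)).comp s (hasDerivAt_neg s)
  refine ⟨_, ((hasDerivAt_id s).sub h1).add h2, ?_⟩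
  obtain ⟨a1, a2⟩ := sq_inv_mul_expNegInvGlue_mem (s - 1)
  obtain ⟨b1, b2⟩ := sq_inv_mul_expNegInvGlue_mem (-s)
  rcases le_or_gt s 1 with hs | hs
  · rw [expNegInvGlue.zero_of_nonpos (sub_nonpos.mpr hs)]
    constructor <;> linarith
  · rw [expNegInvGlue.zero_of_nonpos (by linarith : -s ≤ 0)]
    constructor <;> linarith

theorem abs_deriv_squash_le (s : ℝ) : |deriv squash s| ≤ 1 := by
  obtain ⟨d, hd, h0, h1⟩ := hasDerivAt_squash s
  rw [hd.deriv, abs_of_nonneg h0]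
  exact h1

theorem squash_differentiable : Differentiable ℝ squash := squash_contDiff.differentiable (by simp)

theorem squash_lipschitz : LipschitzWith 1 squash :=
  lipschitzWith_of_nnnorm_deriv_le squash_differentiable fun s => abs_deriv_squash_le s

theorem squash_eq_self {s : ℝ} (h0 : 0 ≤ s) (h1 : s ≤ 1) : squash s = s := by
  rw [squash, expNegInvGlue.zero_of_nonpos (by linarith), expNegInvGlue.zero_of_nonpos (by linarith)]
  ring

theorem squash_eq_self_iff {s : ℝ} : squash s = s ↔ 0 ≤ s ∧ s ≤ 1 := by
  refine ⟨fun h => ?_, fun h => squash_eq_self h.1 h.2⟩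
  by_contra hc
  rw [not_and_or, not_le, not_le] at hc
  rcases hc with hc | hc
  · have := expNegInvGlue.pos_of_pos (neg_pos.mpr hc)
    rw [squash, expNegInvGlue.zero_of_nonpos (by linarith)] at h
    linarith
  · have := expNegInvGlue.pos_of_pos (sub_pos.mpr hc)
    rw [squash, expNegInvGlue.zero_of_nonpos (by linarith : -s ≤ 0)] at h
    linarith

theorem abs_squash_sub_le {s f : ℝ} (h0 : 0 ≤ f) (h1 : f ≤ 1) : |squash s - f| ≤ |s - f| := by
  have := squash_lipschitz.dist_le_mul s f
  rwa [squash_eq_self h0 h1, NNReal.coe_one, one_mul, Real.dist_eq, Real.dist_eq] at this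

section Markov

variable {X : Type*} [MeasurableSpace X] {m : Measure X}

/-- The action of `squash` on `L²`. -/
def squashL2 (u : Lp ℝ 2 m) : Lp ℝ 2 m := squash_lipschitz.compLp squash_zero u

/-- The order constraint becomes a fixed point equation for a continuous map of `L²`. This gives
closedness of the order interval and turns the Markov property into uniqueness of a minimizer. -/
theorem squashL2_eq_self_iff {u : Lp ℝ 2 m} :
    squashL2 u = u ↔ ∀ᵐ p ∂m, 0 ≤ u p ∧ u p ≤ 1 := by
  have h := squash_lipschitz.coeFn_compLp squash_zero u
  constructor
  · intro hu
    rw [squashL2] at hu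
    rw [hu] at h
    filter_upwards [h] with p hp
    exact squash_eq_self_iff.mp hp.symm
  · intro hu
    refine Lp.ext ?_
    filter_upwards [h, hu] with p hp hup
    exact hp.trans (squash_eq_self hup.1 hup.2)

theorem continuous_squashL2 : Continuous (squashL2 (m := m)) :=
  squash_lipschitz.continuous_compLp squash_zero

theorem isClosed_unitInterval : IsClosed {u : Lp ℝ 2 m | ∀ᵐ p ∂m, 0 ≤ u p ∧ u p ≤ 1} := by
  simp_rw [← squashL2_eq_self_iff]
  exact isClosed_eq continuous_squashL2 continuous_id

theorem convex_unitInterval : Convex ℝ {u : Lp ℝ 2 m | ∀ᵐ p ∂m, 0 ≤ u p ∧ u p ≤ 1} := by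
  intro u hu v hv a b ha hb hab
  simp only [mem_ofPred_eq] at hu hv ⊢
  filter_upwards [hu, hv, Lp.coeFn_add (a • u) (b • v), Lp.coeFn_smul a u, Lp.coeFn_smul b v]
    with p hup hvp h1 h2 h3
  rw [h1, Pi.add_apply, h2, h3]
  simp only [Pi.smul_apply, smul_eq_mul]
  constructor
  · nlinarith [mul_nonneg ha hup.1, mul_nonneg hb hvp.1]
  · nlinarith

theorem zero_mem_unitInterval : (0 : Lp ℝ 2 m) ∈ {u : Lp ℝ 2 m | ∀ᵐ p ∂m, 0 ≤ u p ∧ u p ≤ 1} := by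
  rw [mem_ofPred_eq]
  filter_upwards [Lp.coeFn_zero ℝ 2 m] with p hp
  rw [hp]
  simp

theorem norm_squashL2_sub_le (w f : Lp ℝ 2 m) (hf : ∀ᵐ p ∂m, 0 ≤ f p ∧ f p ≤ 1) :
    ‖squashL2 w - f‖ ≤ ‖w - f‖ := by
  refine Lp.norm_le_norm_of_ae_le ?_
  filter_upwards [squash_lipschitz.coeFn_compLp squash_zero w, hf, Lp.coeFn_sub w f,
    Lp.coeFn_sub (squashL2 w) f] with p h1 h2 h3 h4
  rw [h3, h4]
  simp only [Pi.sub_apply, squashL2, h1, Function.comp]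
  exact abs_squash_sub_le h2.1 h2.2

variable {K : Type*} [NormedAddCommGroup K] [InnerProductSpace ℝ K] [CompleteSpace K]

/-- The operator of a form that has a core on which normal contractions operate is Markovian. -/
theorem isMarkovianOperator_of_core {V : Submodule ℝ (Lp ℝ 2 m × K)} (hV : IsClosedForm V)
    {s : Set (Lp ℝ 2 m × K)} (hs : (V : Set (Lp ℝ 2 m × K)) ⊆ closure s)
    (hc : ∀ p ∈ s, ∃ k, (squashL2 p.1, k) ∈ V ∧ ‖k‖ ≤ ‖p.2‖)
    {A : Lp ℝ 2 m →ₗ.[ℝ] Lp ℝ 2 m} (hA : A.graph = formGraph V) : IsMarkovianOperator A := by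
  have hG := formGraph_mDissipative hV
  refine ⟨isSelfAdjoint_of_graph_eq_formGraph hV hA, fun u => ?_,
    hG.semigroup, hG.isC0Semigroup, hG.isGenerator hA, fun u hu t _ => ?_⟩
  · have := hG.dissipative (u, A u) (by rw [← hA]; exact A.mem_graph u)
    exact this
  refine hG.semigroup_mem convex_unitInterval isClosed_unitInterval zero_mem_unitInterval
    (fun ε hε f hf => ?_) t hu
  simp only [mem_ofPred_eq] at hf ⊢
  rw [← squashL2_eq_self_iff]
  obtain ⟨g, hg, hmin⟩ := resolvent_formGraph_minimizes hV hε f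
  set w := (formGraph_mDissipative hV).resolvent ε f
  -- The core is only dense in the form domain and `squashL2` is not linear, so the inequality is
  -- proved on the core and passed to the limit. At `(w, g)` the energy terms cancel and leave
  -- `‖squashL2 w - w‖² ≤ 0`.
  have hcl : IsClosed {p : Lp ℝ 2 m × K | ‖w - f‖ ^ 2 + ε * ‖g‖ ^ 2 + ‖squashL2 p.1 - w‖ ^ 2 ≤
      ‖p.1 - f‖ ^ 2 + ε * ‖p.2‖ ^ 2} := by
    have := continuous_squashL2 (m := m)
    exact isClosed_le (by fun_prop) (by fun_prop)
  have h1 := hcl.closure_subset_iff.mpr (fun p hp => ?_) (hs hg)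
  · simp only [mem_ofPred_eq] at h1
    have h2 : ‖squashL2 w - w‖ ^ 2 ≤ 0 := by linarith
    have h3 := pow_eq_zero_iff two_ne_zero |>.mp (le_antisymm h2 (sq_nonneg _))
    exact sub_eq_zero.mp (norm_eq_zero.mp h3)
  · obtain ⟨k, hk, hkp⟩ := hc p hp
    refine (hmin _ hk).trans ?_
    have h4 := norm_squashL2_sub_le p.1 f hf
    simp only
    gcongr

end Markov

end

/-! ### Calculus on `M`: smooth functions, integration by parts, formal adjoints -/

section

/-- Smoothness on `M`. -/
def IsSmooth (f : Cyl → ℝ) : Prop := ∀ q : ℝ × ℝ, q.1 ≠ 0 → ContDiffAt ℝ ∞ (lift f) q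

theorem testFn.isSmooth {f : Cyl → ℝ} (hf : f ∈ testFn) : IsSmooth f :=
  fun _ _ => hf.1.contDiffAt

theorem exists_coe_eq (t : Torus) : ∃ s : ℝ, (s : Torus) = t := QuotientAddGroup.mk_surjective t

theorem eventually_fst_ne {q : ℝ × ℝ} (hq : q.1 ≠ 0) : ∀ᶠ r in 𝓝 q, r.1 ≠ 0 :=
  continuous_fst.continuousAt.eventually_ne hq

namespace IsSmooth

variable {f g : Cyl → ℝ}

theorem hasDerivAt_fst (hf : IsSmooth f) {x : ℝ} (hx : x ≠ 0) (s : ℝ) :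
    HasDerivAt (fun y : ℝ => f (y, (s : Torus))) (fderiv ℝ (lift f) (x, s) (1, 0)) x := by
  have h : HasFDerivAt (lift f) (fderiv ℝ (lift f) (x, s)) (x, s) :=
    ((hf (x, s) hx).differentiableAt (by simp)).hasFDerivAt
  have h2 : HasDerivAt (fun y : ℝ => (y, s)) ((1 : ℝ), (0 : ℝ)) x :=
    (hasDerivAt_id x).prodMk (hasDerivAt_const x s)
  exact h.comp_hasDerivAt x h2

theorem hasDerivAt_snd (hf : IsSmooth f) {x : ℝ} (hx : x ≠ 0) (s : ℝ) :
    HasDerivAt (fun t : ℝ => f (x, (t : Torus))) (fderiv ℝ (lift f) (x, s) (0, 1)) s := by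
  have h : HasFDerivAt (lift f) (fderiv ℝ (lift f) (x, s)) (x, s) :=
    ((hf (x, s) hx).differentiableAt (by simp)).hasFDerivAt
  have h2 : HasDerivAt (fun t : ℝ => (x, t)) ((0 : ℝ), (1 : ℝ)) s :=
    (hasDerivAt_const s x).prodMk (hasDerivAt_id s)
  exact h.comp_hasDerivAt s h2

theorem hasDerivAt_add (hf : IsSmooth f) {x : ℝ} (hx : x ≠ 0) (s : ℝ) :
    HasDerivAt (fun t : ℝ => f (x, (s : Torus) + (t : Torus)))
      (fderiv ℝ (lift f) (x, s) (0, 1)) 0 := by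
  have h := hf.hasDerivAt_snd hx s
  have h2 := HasDerivAt.comp_const_add (x := (0 : ℝ)) s (by simpa using h)
  simpa using h2

theorem hasDerivAt_dx (hf : IsSmooth f) {p : Cyl} (hp : p.1 ≠ 0) :
    HasDerivAt (fun y : ℝ => f (y, p.2)) (dx f p) p.1 := by
  obtain ⟨x, t⟩ := p
  obtain ⟨s, rfl⟩ := exists_coe_eq t
  exact (hf.hasDerivAt_fst hp s).differentiableAt.hasDerivAt

theorem hasDerivAt_dtheta (hf : IsSmooth f) {p : Cyl} (hp : p.1 ≠ 0) :
    HasDerivAt (fun t : ℝ => f (p.1, p.2 + (t : Torus))) (dtheta f p) 0 := by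
  obtain ⟨x, t⟩ := p
  obtain ⟨s, rfl⟩ := exists_coe_eq t
  exact (hf.hasDerivAt_add hp s).differentiableAt.hasDerivAt

theorem hasDerivAt_dtheta_coe (hf : IsSmooth f) {x : ℝ} (hx : x ≠ 0) (s : ℝ) :
    HasDerivAt (fun t : ℝ => f (x, (t : Torus))) (dtheta f (x, s)) s := by
  have h : dtheta f (x, s) = _ := (hf.hasDerivAt_add hx s).deriv
  rw [h]
  exact hf.hasDerivAt_snd hx s

theorem mul (hf : IsSmooth f) (hg : IsSmooth g) : IsSmooth (fun p => f p * g p) :=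
  fun q hq => (hf q hq).mul (hg q hq)

theorem add (hf : IsSmooth f) (hg : IsSmooth g) : IsSmooth (fun p => f p + g p) :=
  fun q hq => (hf q hq).add (hg q hq)

theorem const (c : ℝ) : IsSmooth (fun _ => c) := fun _ _ => contDiffAt_const

theorem of_fst {c : ℝ → ℝ} (hc : ∀ x, x ≠ 0 → ContDiffAt ℝ ∞ c x) : IsSmooth (fun p => c p.1) :=
  fun q hq => (hc q.1 hq).comp q contDiffAt_fst

theorem of_snd {e : Torus → ℝ} (he : ContDiff ℝ ∞ fun s : ℝ => e s) : IsSmooth (fun p => e p.2) :=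
  fun q _ => he.contDiffAt.comp q contDiffAt_snd

theorem abs_rpow (b : ℝ) : IsSmooth (fun p => |p.1| ^ b) := of_fst (contDiffAt_abs_rpow b)

theorem comp {φ : ℝ → ℝ} (hφ : ContDiff ℝ ∞ φ) (hf : IsSmooth f) : IsSmooth (fun p => φ (f p)) :=
  fun q hq => hφ.contDiffAt.comp q (hf q hq)

theorem congr (hf : IsSmooth f) (h : ∀ p : Cyl, p.1 ≠ 0 → g p = f p) : IsSmooth g := fun q hq =>
  (hf q hq).congr_of_eventuallyEq <| by
    filter_upwards [eventually_fst_ne hq] with r hr using h (r.1, r.2) hr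

theorem dx (hf : IsSmooth f) : IsSmooth (dx f) := fun q hq => by
  have h : lift (ConicSurface.dx f) =ᶠ[𝓝 q] fun r => fderiv ℝ (lift f) r (1, 0) := by
    filter_upwards [eventually_fst_ne hq] with r hr
    exact (hf.hasDerivAt_fst hr r.2).deriv
  exact (((hf q hq).fderiv_right (m := ∞) (by simp)).clm_apply contDiffAt_const).congr_of_eventuallyEq h

theorem dtheta (hf : IsSmooth f) : IsSmooth (dtheta f) := fun q hq => by
  have h : lift (ConicSurface.dtheta f) =ᶠ[𝓝 q] fun r => fderiv ℝ (lift f) r (0, 1) := by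
    filter_upwards [eventually_fst_ne hq] with r hr
    exact (hf.hasDerivAt_add hr r.2).deriv
  exact (((hf q hq).fderiv_right (m := ∞) (by simp)).clm_apply contDiffAt_const).congr_of_eventuallyEq h

theorem mul_mem (hf : IsSmooth f) (hg : g ∈ testFn) : (fun p => f p * g p) ∈ testFn := by
  refine testFn.of_support hg ?_ fun p hp => ?_
  · rw [contDiff_iff_contDiffAt]
    intro q
    by_cases hq : ((q.1, (q.2 : Torus)) : Cyl) ∈ tsupport g
    · exact (hf q (hg.2.2 hq)).mul hg.1.contDiffAt
    · have h0 : g =ᶠ[𝓝 (q.1, (q.2 : Torus))] 0 := notMem_tsupport_iff_eventuallyEq.mp hq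
      have hcont : Continuous (fun q : ℝ × ℝ => ((q.1, (q.2 : Torus)) : Cyl)) :=
        continuous_fst.prodMk ((AddCircle.continuous_mk' _).comp continuous_snd)
      have h1 := (hcont.tendsto q).eventually h0
      refine (contDiffAt_const (c := (0 : ℝ))).congr_of_eventuallyEq ?_
      filter_upwards [h1] with r hr
      simp only [Pi.zero_apply] at hr
      simp [lift, hr]
  · simp [image_eq_zero_of_notMem_tsupport hp]

end IsSmooth

section Leibniz

variable {f g : Cyl → ℝ} {p : Cyl}

theorem dx_mul (hf : IsSmooth f) (hg : IsSmooth g) (hp : p.1 ≠ 0) :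
    dx (fun p => f p * g p) p = dx f p * g p + f p * dx g p :=
  ((hf.hasDerivAt_dx hp).mul (hg.hasDerivAt_dx hp)).deriv

theorem dtheta_mul (hf : IsSmooth f) (hg : IsSmooth g) (hp : p.1 ≠ 0) :
    dtheta (fun p => f p * g p) p = dtheta f p * g p + f p * dtheta g p := by
  have := ((hf.hasDerivAt_dtheta hp).mul (hg.hasDerivAt_dtheta hp)).deriv
  rw [AddCircle.coe_zero, add_zero] at this
  exact this

theorem dx_add (hf : IsSmooth f) (hg : IsSmooth g) (hp : p.1 ≠ 0) :
    dx (fun p => f p + g p) p = dx f p + dx g p :=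
  ((hf.hasDerivAt_dx hp).add (hg.hasDerivAt_dx hp)).deriv

theorem dtheta_add (hf : IsSmooth f) (hg : IsSmooth g) (hp : p.1 ≠ 0) :
    dtheta (fun p => f p + g p) p = dtheta f p + dtheta g p :=
  ((hf.hasDerivAt_dtheta hp).add (hg.hasDerivAt_dtheta hp)).deriv

theorem dx_const_mul (c : ℝ) (hf : IsSmooth f) (hp : p.1 ≠ 0) :
    dx (fun p => c * f p) p = c * dx f p :=
  ((hf.hasDerivAt_dx hp).const_mul c).deriv

theorem dtheta_const_mul (c : ℝ) (hf : IsSmooth f) (hp : p.1 ≠ 0) :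
    dtheta (fun p => c * f p) p = c * dtheta f p :=
  ((hf.hasDerivAt_dtheta hp).const_mul c).deriv

theorem dx_comp {φ : ℝ → ℝ} (hφ : Differentiable ℝ φ) (hf : IsSmooth f) (hp : p.1 ≠ 0) :
    dx (fun p => φ (f p)) p = deriv φ (f p) * dx f p :=
  ((hφ (f p)).hasDerivAt.comp p.1 (hf.hasDerivAt_dx hp)).deriv

theorem dtheta_comp {φ : ℝ → ℝ} (hφ : Differentiable ℝ φ) (hf : IsSmooth f) (hp : p.1 ≠ 0) :
    dtheta (fun p => φ (f p)) p = deriv φ (f p) * dtheta f p := by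
  have h := hf.hasDerivAt_dtheta hp
  have h2 : HasDerivAt φ (deriv φ (f p)) (f (p.1, p.2 + ((0 : ℝ) : Torus))) := by
    rw [AddCircle.coe_zero, add_zero]
    exact (hφ (f p)).hasDerivAt
  exact (h2.comp (0 : ℝ) h).deriv

theorem dx_fst (c : ℝ → ℝ) : dx (fun p => c p.1) p = deriv c p.1 := rfl

theorem dtheta_fst (c : ℝ → ℝ) : dtheta (fun p => c p.1) p = 0 := by
  simp [dtheta]

theorem dx_snd (e : Torus → ℝ) : dx (fun p => e p.2) p = 0 := by
  simp [dx]

theorem hasDerivAt_abs_rpow (b : ℝ) {x : ℝ} (hx : x ≠ 0) :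
    HasDerivAt (fun y : ℝ => |y| ^ b) (b / x * |x| ^ b) x := by
  have h := (hasDerivAt_abs hx).rpow_const (p := b) (Or.inl (abs_ne_zero.mpr hx))
  refine h.congr_deriv ?_
  rw [Real.rpow_sub_one (abs_ne_zero.mpr hx)]
  rcases lt_or_gt_of_ne hx with h0 | h0
  · rw [abs_of_neg h0]; simp [h0]; field_simp
  · rw [abs_of_pos h0]; simp [h0]; field_simp

theorem dx_abs_rpow (b : ℝ) (hp : p.1 ≠ 0) :
    dx (fun p => |p.1| ^ b) p = b / p.1 * |p.1| ^ b := (hasDerivAt_abs_rpow b hp).deriv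

end Leibniz

section Integration

theorem testFn.integrable {f : Cyl → ℝ} (hf : f ∈ testFn) : Integrable f :=
  (testFn.continuous hf).integrable_of_hasCompactSupport hf.2.1

theorem testFn.hasCompactSupport_slice {f : Cyl → ℝ} (hf : f ∈ testFn) (t : Torus) :
    HasCompactSupport fun y : ℝ => f (y, t) := by
  refine HasCompactSupport.intro (hf.2.1.image continuous_fst) fun y hy => ?_
  by_contra h
  exact hy ⟨(y, t), subset_tsupport f h, rfl⟩

theorem integral_dx_eq_zero {f : Cyl → ℝ} (hf : f ∈ testFn) : ∫ p, dx f p = 0 := by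
  have hi := testFn.integrable (dx_mem hf)
  rw [Measure.volume_eq_prod] at hi ⊢
  rw [integral_prod_symm _ hi]
  refine integral_eq_zero_of_ae (Eventually.of_forall fun t => ?_)
  obtain ⟨s, rfl⟩ := exists_coe_eq t
  have hd : ∀ x : ℝ, HasDerivAt (fun y : ℝ => f (y, (s : Torus))) (dx f (x, s)) x := fun x =>
    (testFn.hasDerivAt_dx hf x s).differentiableAt.hasDerivAt
  have hc : ∀ {g : Cyl → ℝ}, g ∈ testFn → Integrable fun y : ℝ => g (y, (s : Torus)) := fun hg =>
    ((testFn.continuous hg).comp (Continuous.prodMk_left _)).integrable_of_hasCompactSupport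
      (testFn.hasCompactSupport_slice hg _)
  exact integral_eq_zero_of_hasDerivAt_of_integrable hd (hc (dx_mem hf)) (hc hf)

theorem integral_dtheta_eq_zero {f : Cyl → ℝ} (hf : f ∈ testFn) : ∫ p, dtheta f p = 0 := by
  have hi := testFn.integrable (dtheta_mem hf)
  rw [Measure.volume_eq_prod] at hi ⊢
  rw [integral_prod _ hi]
  refine integral_eq_zero_of_ae ?_
  filter_upwards [Measure.ae_ne volume 0] with x hx
  have hd : ∀ s : ℝ, HasDerivAt (fun t : ℝ => f (x, (t : Torus))) (dtheta f (x, s)) s := fun s =>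
    (testFn.isSmooth hf).hasDerivAt_dtheta_coe hx s
  have hc : Continuous fun s : ℝ => dtheta f (x, (s : Torus)) :=
    (testFn.continuous (dtheta_mem hf)).comp
      (continuous_const.prodMk (AddCircle.continuous_mk' _))
  rw [← AddCircle.intervalIntegral_preimage (2 * Real.pi) 0 fun t => dtheta f (x, t),
    intervalIntegral.integral_eq_sub_of_hasDerivAt (fun s _ => hd s) (hc.intervalIntegrable _ _)]
  simp [AddCircle.coe_period]

theorem ae_fst_ne : ∀ᵐ p : Cyl, p.1 ≠ 0 := by
  rw [Measure.volume_eq_prod]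
  exact Measure.quasiMeasurePreserving_fst.ae (Measure.ae_ne volume 0)

theorem vol_absolutelyContinuous (α : ℝ) : vol α ≪ volume := withDensity_absolutelyContinuous _ _

theorem ae_vol_fst_ne (α : ℝ) : ∀ᵐ p ∂(vol α), p.1 ≠ 0 := (vol_absolutelyContinuous α).ae_le ae_fst_ne

theorem integral_vol (α : ℝ) (f : Cyl → ℝ) : ∫ p, f p ∂(vol α) = ∫ p : Cyl, |p.1| ^ (-α) * f p := by
  rw [vol, integral_withDensity_eq_integral_toReal_smul₀ (by fun_prop) (by simp)]
  refine integral_congr_ae (Eventually.of_forall fun p => ?_)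
  simp only [smul_eq_mul]
  rw [ENNReal.toReal_ofReal (by positivity)]

theorem integrable_vol_iff (α : ℝ) (f : Cyl → ℝ) :
    Integrable f (vol α) ↔ Integrable fun p : Cyl => |p.1| ^ (-α) * f p := by
  rw [vol, integrable_withDensity_iff_integrable_smul₀' (by fun_prop) (by simp)]
  refine integrable_congr (Eventually.of_forall fun p => ?_)
  simp only [smul_eq_mul]
  rw [ENNReal.toReal_ofReal (by positivity)]

theorem testFn.integrable_vol (α : ℝ) {f : Cyl → ℝ} (hf : f ∈ testFn) : Integrable f (vol α) := by
  rw [integrable_vol_iff]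
  exact testFn.integrable ((IsSmooth.abs_rpow (-α)).mul_mem hf)

theorem toL2_coeFn (α : ℝ) (f : testFn) : (toL2 α f : Cyl → ℝ) =ᵐ[vol α] f :=
  (testFn.memLp α f.2).coeFn_toLp

theorem inner_toL2 (α : ℝ) (u : L2 α) (f : testFn) :
    inner ℝ u (toL2 α f) = ∫ p, u p * f.1 p ∂(vol α) := by
  rw [L2.inner_def]
  refine integral_congr_ae ?_
  filter_upwards [toL2_coeFn α f] with p hp
  rw [hp]
  simp [mul_comm]

theorem inner_toL2_toL2 (α : ℝ) (f g : testFn) :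
    inner ℝ (toL2 α f) (toL2 α g) = ∫ p, f.1 p * g.1 p ∂(vol α) := by
  rw [inner_toL2]
  refine integral_congr_ae ?_
  filter_upwards [toL2_coeFn α f] with p hp
  rw [hp]

end Integration

section FormalAdjoints

/-- The formal adjoint of `∂ₓ` in `L²(ω)`. -/
def dxAdj (α : ℝ) : testFn →ₗ[ℝ] testFn :=
  mulL (fun x => α / x) (fun _ hx => contDiffAt_const.div contDiffAt_id hx) - dxL

/-- The angular part `|x|^α ∂_θ` of the gradient. -/
def gradTheta (α : ℝ) : testFn →ₗ[ℝ] testFn :=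
  mulL (fun x => |x| ^ α) (contDiffAt_abs_rpow α) ∘ₗ dthetaL

theorem dxAdj_apply (α : ℝ) (f : testFn) (p : Cyl) :
    (dxAdj α f).1 p = α / p.1 * f.1 p - dx f.1 p := rfl

theorem gradTheta_apply (α : ℝ) (f : testFn) (p : Cyl) :
    (gradTheta α f).1 p = |p.1| ^ α * dtheta f.1 p := rfl

theorem testFn.ext_of_ne {f g : testFn} (h : ∀ p : Cyl, p.1 ≠ 0 → f.1 p = g.1 p) : f = g := by
  refine Subtype.ext (funext fun p => ?_)
  by_cases hp : p.1 = 0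
  · have hz : ∀ k : testFn, k.1 p = 0 := fun k =>
      image_eq_zero_of_notMem_tsupport fun hk => k.2.2.2 hk hp
    rw [hz, hz]
  · exact h p hp

/-- The divergence form of the operator: `|x|^α ∂_θ` is formally skew-adjoint because the weight
does not depend on `θ`, whereas the adjoint of `∂ₓ` picks up the term `α/x`. -/
theorem laplace_eq (α : ℝ) (f : testFn) :
    laplace α f = gradTheta α (gradTheta α f) - dxAdj α (dxL f) := by
  refine testFn.ext_of_ne fun p hp => ?_
  have h1 : dtheta (gradTheta α f).1 p = |p.1| ^ α * dtheta (dtheta f.1) p := by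
    have := dtheta_mul (IsSmooth.abs_rpow α) (testFn.isSmooth (dtheta_mem f.2)) hp
    rw [dtheta_fst (fun x => |x| ^ α), zero_mul, zero_add] at this
    exact this
  change (laplace α f).1 p = (gradTheta α (gradTheta α f)).1 p - (dxAdj α (dxL f)).1 p
  rw [laplace_apply, gradTheta_apply, h1, dxAdj_apply]
  change _ = _ - (α / p.1 * dx f.1 p - dx (dx f.1) p)
  rw [two_mul, Real.rpow_add (abs_pos.mpr hp)]
  ring

/-- Integration by parts in `x`. -/
theorem integral_dx_mul (α : ℝ) {c : Cyl → ℝ} (hc : IsSmooth c) (h : testFn)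
    (hi : Integrable (fun p => dx c p * h.1 p) (vol α)) :
    ∫ p, dx c p * h.1 p ∂(vol α) = ∫ p, c p * (dxAdj α h).1 p ∂(vol α) := by
  -- Only `h` is supported away from `{0} × 𝕋`; this suffices for the boundary terms to vanish, and
  -- `c` may be any smooth function on `M`.
  have hm : (fun p => c p * (|p.1| ^ (-α) * h.1 p)) ∈ testFn :=
    hc.mul_mem ((IsSmooth.abs_rpow _).mul_mem h.2)
  have h0 := integral_dx_eq_zero hm
  have hi2 : Integrable (fun p => c p * (dxAdj α h).1 p) (vol α) :=
    testFn.integrable_vol α (hc.mul_mem (dxAdj α h).2)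
  rw [← sub_eq_zero, ← integral_sub hi hi2, integral_vol, ← h0]
  refine integral_congr_ae ?_
  filter_upwards [ae_fst_ne] with p hp
  rw [dx_mul hc ((IsSmooth.abs_rpow _).mul (testFn.isSmooth h.2)) hp,
    dx_mul (IsSmooth.abs_rpow _) (testFn.isSmooth h.2) hp, dx_abs_rpow _ hp, dxAdj_apply]
  ring

/-- Integration by parts in `θ`. -/
theorem integral_dtheta_mul (α : ℝ) {c : Cyl → ℝ} (hc : IsSmooth c) (h : testFn)
    (hi : Integrable (fun p => |p.1| ^ α * dtheta c p * h.1 p) (vol α)) :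
    ∫ p, |p.1| ^ α * dtheta c p * h.1 p ∂(vol α) = -∫ p, c p * (gradTheta α h).1 p ∂(vol α) := by
  have hm : (fun p => c p * h.1 p) ∈ testFn := hc.mul_mem h.2
  have h0 := integral_dtheta_eq_zero hm
  have hi2 : Integrable (fun p => c p * (gradTheta α h).1 p) (vol α) :=
    testFn.integrable_vol α (hc.mul_mem (gradTheta α h).2)
  rw [eq_neg_iff_add_eq_zero, ← integral_add hi hi2, integral_vol, ← h0]
  refine integral_congr_ae ?_
  filter_upwards [ae_fst_ne] with p hp
  have e : |p.1| ^ (-α) * |p.1| ^ α = 1 := by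
    rw [← Real.rpow_add (abs_pos.mpr hp)]; simp
  rw [dtheta_mul hc (testFn.isSmooth h.2) hp, gradTheta_apply]
  linear_combination (dtheta c p * h.1 p + c p * dtheta h.1 p) * e

end FormalAdjoints

end

/-! ### Fourier series in the angular variable -/

section

/-- The functions `cos (n θ)`, `sin (n θ)` on the circle. -/
def harmonic (n : ℤ) (b : Bool) (t : Torus) : ℝ :=
  if b then (fourier n t : ℂ).re else (fourier n t : ℂ).im

theorem fourier_coe_eq (n : ℤ) (s : ℝ) :
    (fourier n (s : Torus) : ℂ) = Complex.exp (((n : ℝ) * s : ℝ) * Complex.I) := by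
  rw [fourier_coe_apply]
  congr 1
  push_cast
  field_simp

theorem harmonic_true_coe (n : ℤ) (s : ℝ) : harmonic n true (s : Torus) = Real.cos (n * s) := by
  simp only [harmonic, if_true]
  rw [fourier_coe_eq, Complex.exp_ofReal_mul_I_re]

theorem harmonic_false_coe (n : ℤ) (s : ℝ) : harmonic n false (s : Torus) = Real.sin (n * s) := by
  simp only [harmonic, Bool.false_eq_true, if_false]
  rw [fourier_coe_eq, Complex.exp_ofReal_mul_I_im]

theorem contDiff_harmonic (n : ℤ) (b : Bool) : ContDiff ℝ ∞ fun s : ℝ => harmonic n b s := by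
  cases b
  · simp_rw [harmonic_false_coe]; fun_prop
  · simp_rw [harmonic_true_coe]; fun_prop

theorem continuous_harmonic (n : ℤ) (b : Bool) : Continuous (harmonic n b) := by
  cases b
  · exact Complex.continuous_im.comp (fourier n).continuous
  · exact Complex.continuous_re.comp (fourier n).continuous

theorem abs_harmonic_le (n : ℤ) (b : Bool) (t : Torus) : |harmonic n b t| ≤ 1 := by
  obtain ⟨s, rfl⟩ := exists_coe_eq t
  cases b
  · rw [harmonic_false_coe]; exact Real.abs_sin_le_one _
  · rw [harmonic_true_coe]; exact Real.abs_cos_le_one _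

theorem isSmooth_harmonic (n : ℤ) (b : Bool) : IsSmooth fun p => harmonic n b p.2 :=
  IsSmooth.of_snd (contDiff_harmonic n b)

theorem dtheta_harmonic (n : ℤ) (b : Bool) {p : Cyl} (hp : p.1 ≠ 0) :
    dtheta (fun p => harmonic n b p.2) p = (if b then -n else n) * harmonic n (!b) p.2 := by
  obtain ⟨x, t⟩ := p
  obtain ⟨s, rfl⟩ := exists_coe_eq t
  have h := (isSmooth_harmonic n b).hasDerivAt_dtheta_coe hp s
  have h1 : HasDerivAt (fun s : ℝ => (n : ℝ) * s) n s := by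
    simpa using (hasDerivAt_id s).const_mul (n : ℝ)
  cases b
  · simp only [harmonic_false_coe] at h
    rw [h.unique h1.sin]
    simp [harmonic_true_coe]
    ring
  · simp only [harmonic_true_coe] at h
    rw [h.unique h1.cos]
    simp [harmonic_false_coe]
    ring

/-- All complex Fourier coefficients of `g` vanish, and Parseval's identity gives `∫ g² = 0`. -/
theorem ae_eq_zero_of_integral_harmonic {g : Torus → ℝ} (hg : MemLp g 2)
    (h : ∀ n b, ∫ t, g t * harmonic n b t = 0) : g =ᵐ[volume] 0 := by
  have hG : MemLp (fun t => (g t : ℂ)) 2 (volume : Measure Torus) := hg.ofReal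
  have hG' := hG.haarAddCircle
  have hc : ∀ n, fourierCoeff (hG'.toLp _ : Torus → ℂ) n = 0 := by
    intro n
    rw [fourierCoeff_congr_ae hG'.coeFn_toLp, fourierCoeff, AddCircle.integral_haarAddCircle]
    have hi : Integrable (fun t : Torus => (fourier (-n) t : ℂ) • (g t : ℂ)) := by
      have hGi : Integrable (fun t : Torus => (g t : ℂ)) := hG.integrable (by norm_num)
      refine hGi.mono ((fourier (-n)).continuous.aestronglyMeasurable.smul hGi.1)
        (Eventually.of_forall fun t => ?_)
      rw [norm_smul, fourier_apply, Circle.norm_coe, one_mul]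
    have hre := h (-n) true
    have him := h (-n) false
    have e : ∫ t : Torus, (fourier (-n) t : ℂ) • (g t : ℂ) = 0 := by
      refine Complex.ext ?_ ?_
      · rw [Complex.zero_re, ← hre]
        refine (integral_re hi).symm.trans ?_
        refine integral_congr_ae (Eventually.of_forall fun t => ?_)
        simp [harmonic, mul_comm]
      · rw [Complex.zero_im, ← him]
        refine (integral_im hi).symm.trans ?_
        refine integral_congr_ae (Eventually.of_forall fun t => ?_)
        simp [harmonic, mul_comm]
    rw [e, smul_zero]
  have hp := hasSum_sq_fourierCoeff (hG'.toLp _)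
  simp only [hc, norm_zero, ne_eq, OfNat.ofNat_ne_zero, not_false_eq_true, zero_pow] at hp
  have h0 := hp.unique hasSum_zero
  have h1 : ∫ t : Torus, g t ^ 2 = 0 := by
    have e : ∫ t : Torus, ‖(hG'.toLp _ : Torus → ℂ) t‖ ^ 2 ∂AddCircle.haarAddCircle =
        ∫ t : Torus, g t ^ 2 ∂AddCircle.haarAddCircle := by
      refine integral_congr_ae ?_
      filter_upwards [hG'.coeFn_toLp] with t ht
      rw [ht]; simp
    rw [e, AddCircle.integral_haarAddCircle, smul_eq_zero] at h0
    exact h0.resolve_left (inv_ne_zero Real.two_pi_pos.ne')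
  have h2 := (integral_eq_zero_iff_of_nonneg (fun t => sq_nonneg (g t)) hg.integrable_sq).mp h1
  filter_upwards [h2] with t ht
  exact pow_eq_zero_iff two_ne_zero |>.mp ht

section TensorTest

/-- The function `η(x) e(θ)`. -/
theorem tensor_mem {η : ℝ → ℝ} (hη : ContDiff ℝ ∞ η) (hc : HasCompactSupport η)
    (h0 : tsupport η ⊆ {0}ᶜ) {e : Torus → ℝ} (he : ContDiff ℝ ∞ fun s : ℝ => e s) :
    (fun p : Cyl => η p.1 * e p.2) ∈ testFn := by
  have hsub : tsupport (fun p : Cyl => η p.1 * e p.2) ⊆ tsupport η ×ˢ univ := by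
    refine closure_minimal (fun p hp => ⟨?_, trivial⟩) ((isClosed_tsupport η).prod isClosed_univ)
    exact subset_tsupport η (left_ne_zero_of_mul hp)
  refine ⟨?_, ?_, fun p hp => h0 (hsub hp).1⟩
  · exact (hη.comp contDiff_fst).mul (he.comp contDiff_snd)
  · exact (hc.isCompact.prod isCompact_univ).of_isClosed_subset (isClosed_tsupport _) hsub

/-- The test function `η(x) cos (n θ)` or `η(x) sin (n θ)`. -/
def tensor {η : ℝ → ℝ} (hη : ContDiff ℝ ∞ η) (hc : HasCompactSupport η)
    (h0 : tsupport η ⊆ {0}ᶜ) (n : ℤ) (b : Bool) : testFn :=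
  ⟨fun p => η p.1 * harmonic n b p.2, tensor_mem hη hc h0 (contDiff_harmonic n b)⟩

end TensorTest

section Modes

variable {α : ℝ}

theorem L2_integrable_sq (w : L2 α) :
    Integrable (fun p : Cyl => |p.1| ^ (-α) * w p ^ 2) := by
  rw [← integrable_vol_iff α fun p => w p ^ 2]
  exact (Lp.memLp w).integrable_sq

/-- The Fourier coefficient `x ↦ ∫ w(x, θ) e(θ) dθ`. -/
def mode (w : L2 α) (n : ℤ) (b : Bool) (x : ℝ) : ℝ := ∫ t : Torus, w (x, t) * harmonic n b t

theorem stronglyMeasurable_mode (w : L2 α) (n : ℤ) (b : Bool) : StronglyMeasurable (mode w n b) := by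
  refine StronglyMeasurable.integral_prod_right' (f := fun p : Cyl => w p * harmonic n b p.2) ?_
  exact (Lp.stronglyMeasurable w).mul
    ((continuous_harmonic n b).comp continuous_snd).stronglyMeasurable

theorem ae_memLp_slice (w : L2 α) : ∀ᵐ x : ℝ, MemLp (fun t : Torus => w (x, t)) 2 := by
  have h := L2_integrable_sq w
  rw [Measure.volume_eq_prod] at h
  filter_upwards [h.prod_right_ae, Measure.ae_ne volume 0] with x hx hx0
  have hpos : 0 < |x| ^ (-α) := Real.rpow_pos_of_pos (abs_pos.mpr hx0) _
  have hm : AEStronglyMeasurable (fun t : Torus => w (x, t)) volume :=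
    ((Lp.stronglyMeasurable w).comp_measurable measurable_prodMk_left).aestronglyMeasurable
  rw [memLp_two_iff_integrable_sq hm]
  refine (hx.const_mul (|x| ^ (-α))⁻¹).congr (Eventually.of_forall fun t => ?_)
  simp only
  rw [inv_mul_cancel_left₀ hpos.ne']

/-- The Cauchy–Schwarz inequality against `1`, obtained from `∫ (f - c)² ≥ 0` with `c` the mean of
`f`. -/
theorem sq_integral_le {X : Type*} [MeasurableSpace X] {m : Measure X} [IsFiniteMeasure m]
    {f : X → ℝ} (hf : MemLp f 2 m) : (∫ x, f x ∂m) ^ 2 ≤ m.real univ * ∫ x, f x ^ 2 ∂m := by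
  have h1 : Integrable f m := hf.integrable (by norm_num)
  have h2 := hf.integrable_sq
  rcases eq_or_ne m 0 with rfl | hm
  · simp
  have hpos : 0 < m.real univ := by
    rw [measureReal_def, ENNReal.toReal_pos_iff]
    exact ⟨by simpa using hm, measure_lt_top m _⟩
  set c := (∫ x, f x ∂m) / m.real univ with hcdef
  have h3 : 0 ≤ ∫ x, (f x - c) ^ 2 ∂m := integral_nonneg fun x => sq_nonneg _
  have h4 : ∫ x, (f x - c) ^ 2 ∂m = ∫ x, f x ^ 2 ∂m - 2 * c * ∫ x, f x ∂m + m.real univ * c ^ 2 := by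
    have e : ∀ x, (f x - c) ^ 2 = f x ^ 2 - 2 * c * f x + c ^ 2 := fun x => by ring
    simp_rw [e]
    have i1 : Integrable (fun x => 2 * c * f x) m := h1.const_mul _
    have i2 : Integrable (fun x => f x ^ 2 - 2 * c * f x) m := h2.sub i1
    rw [integral_add i2 (integrable_const _), integral_sub h2 i1, integral_const_mul,
      integral_const, smul_eq_mul]
  have h5 : ∫ x, f x ∂m = c * m.real univ := by rw [hcdef]; field_simp
  rw [h4, h5] at h3
  rw [h5]
  nlinarith

/-- The Cauchy–Schwarz inequality on almost every circle bounds the square of the mode by `2π ∫ w(x,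
θ)² dθ`, which is integrable in `x` with the weight. -/
theorem mode_sq_integrable (w : L2 α) (n : ℤ) (b : Bool) :
    Integrable fun x => |x| ^ (-α) * mode w n b x ^ 2 := by
  have h := L2_integrable_sq w
  rw [Measure.volume_eq_prod] at h
  refine (h.integral_prod_left.const_mul ((volume : Measure Torus).real univ)).mono'
    ((by fun_prop : Measurable fun x : ℝ => |x| ^ (-α)).aestronglyMeasurable.mul
      ((stronglyMeasurable_mode w n b).pow 2).aestronglyMeasurable) ?_
  filter_upwards [ae_memLp_slice w] with x hx
  rw [Real.norm_of_nonneg (by positivity), integral_const_mul]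
  have h1 : MemLp (fun t : Torus => w (x, t) * harmonic n b t) 2 :=
    hx.of_le (hx.1.mul (continuous_harmonic n b).aestronglyMeasurable)
      (Eventually.of_forall fun t => by
        rw [norm_mul]
        exact mul_le_of_le_one_right (norm_nonneg _) (abs_harmonic_le n b t))
  have h2 := sq_integral_le h1
  have h3 : ∫ t : Torus, (w (x, t) * harmonic n b t) ^ 2 ≤ ∫ t : Torus, w (x, t) ^ 2 := by
    refine integral_mono h1.integrable_sq hx.integrable_sq fun t => ?_
    rw [mul_pow]
    have := sq_le_one_iff_abs_le_one _ |>.mpr (abs_harmonic_le n b t)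
    nlinarith [sq_nonneg (w (x, t))]
  calc |x| ^ (-α) * mode w n b x ^ 2 ≤ |x| ^ (-α) * ((volume : Measure Torus).real univ *
      ∫ t : Torus, w (x, t) ^ 2) := by
        refine mul_le_mul_of_nonneg_left (h2.trans ?_) (by positivity)
        gcongr
    _ = _ := by ring

theorem integral_vol_tensor (w : L2 α) (c : ℝ → ℝ) (n : ℤ) (b : Bool)
    (hi : Integrable (fun p => w p * (c p.1 * harmonic n b p.2)) (vol α)) :
    ∫ p, w p * (c p.1 * harmonic n b p.2) ∂(vol α) = ∫ x, |x| ^ (-α) * (c x * mode w n b x) := by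
  rw [integrable_vol_iff, Measure.volume_eq_prod] at hi
  rw [integral_vol, Measure.volume_eq_prod, integral_prod _ hi]
  refine integral_congr_ae (Eventually.of_forall fun x => ?_)
  simp only [mode]
  rw [← integral_const_mul, ← integral_const_mul]
  refine integral_congr_ae (Eventually.of_forall fun t => ?_)
  simp only
  ring

theorem integrable_mul_test (w : L2 α) {f : Cyl → ℝ} (hf : f ∈ testFn) :
    Integrable (fun p => w p * f p) (vol α) :=
  (Lp.memLp w).integrable_mul (testFn.memLp α hf)

theorem inner_tensor (w : L2 α) {η : ℝ → ℝ} (hη : ContDiff ℝ ∞ η) (hc : HasCompactSupport η)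
    (h0 : tsupport η ⊆ {0}ᶜ) (n : ℤ) (b : Bool) :
    inner ℝ w (toL2 α (tensor hη hc h0 n b)) = ∫ x, |x| ^ (-α) * (η x * mode w n b x) := by
  rw [inner_toL2]
  exact integral_vol_tensor w η n b (integrable_mul_test w (tensor hη hc h0 n b).2)

/-- A function on `ℝ \ {0}` that is square integrable with a weight is locally integrable. -/
theorem locallyIntegrableOn_of_weighted_sq {a : ℝ → ℝ} (hm : StronglyMeasurable a)
    (ha : Integrable fun x => |x| ^ (-α) * a x ^ 2) : LocallyIntegrableOn a {0}ᶜ := by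
  have h1 : LocallyIntegrableOn (fun x => |x| ^ α * (|x| ^ (-α) * a x ^ 2)) ({0}ᶜ : Set ℝ) := by
    refine ha.integrableOn.locallyIntegrableOn.continuousOn_mul
      (fun x hx => ?_) (isOpen_compl_singleton.isLocallyClosed)
    exact (continuous_abs.continuousAt.rpow_const
      (Or.inl (abs_ne_zero.mpr hx))).continuousWithinAt
  have h2 : LocallyIntegrableOn (fun _ : ℝ => (1 : ℝ)) ({0}ᶜ : Set ℝ) :=
    (continuous_const.locallyIntegrable).locallyIntegrableOn _
  have h3 := h1.add h2
  rw [locallyIntegrableOn_iff isOpen_compl_singleton.isLocallyClosed] at h3 ⊢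
  intro k hk hkc
  refine (h3 k hk hkc).mono' hm.aestronglyMeasurable ?_
  refine (ae_restrict_mem hkc.measurableSet).mono fun x hx => ?_
  have hx0 : x ≠ 0 := hk hx
  have e : |x| ^ α * (|x| ^ (-α) * a x ^ 2) = a x ^ 2 := by
    rw [← mul_assoc, ← Real.rpow_add (abs_pos.mpr hx0)]; simp
  simp only [Pi.add_apply, e, Real.norm_eq_abs]
  rw [← sq_abs (a x)]
  nlinarith [sq_nonneg (|a x| - 1), abs_nonneg (a x)]

/-- The test functions `η(x) cos (n θ)`, `η(x) sin (n θ)` span a dense subspace of `L²`. -/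
theorem eq_zero_of_mode_eq_zero {w : L2 α} (h : ∀ n b, mode w n b =ᵐ[volume] 0) : w = 0 := by
  have h1 : ∀ᵐ x : ℝ, ∀ n b, mode w n b x = 0 := by
    rw [ae_all_iff]
    intro n
    rw [ae_all_iff]
    exact fun b => h n b
  have h2 : ∀ᵐ p : Cyl, w p = 0 := by
    rw [Measure.volume_eq_prod, Measure.ae_prod_iff_ae_ae]
    · filter_upwards [h1, ae_memLp_slice w] with x hx hx'
      exact ae_eq_zero_of_integral_harmonic hx' hx
    · exact (Lp.stronglyMeasurable w).measurable (measurableSet_singleton 0)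
  refine Lp.ext ?_
  filter_upwards [(vol_absolutelyContinuous α).ae_le h2, Lp.coeFn_zero ℝ 2 (vol α)] with p hp hp0
  rw [hp, hp0]
  rfl

theorem eq_zero_of_inner_tensor {w : L2 α} (h : ∀ {η : ℝ → ℝ} (hη : ContDiff ℝ ∞ η)
    (hc : HasCompactSupport η) (h0 : tsupport η ⊆ {0}ᶜ) (n : ℤ) (b : Bool),
    inner ℝ w (toL2 α (tensor hη hc h0 n b)) = (0 : ℝ)) : w = 0 := by
  refine eq_zero_of_mode_eq_zero fun n b => ?_
  have hl : LocallyIntegrableOn (fun x => |x| ^ (-α) * mode w n b x) ({0}ᶜ : Set ℝ) := by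
    refine (locallyIntegrableOn_of_weighted_sq (stronglyMeasurable_mode w n b)
      (mode_sq_integrable w n b)).continuousOn_mul (fun x hx => ?_)
      (isOpen_compl_singleton.isLocallyClosed)
    exact (continuous_abs.continuousAt.rpow_const
      (Or.inl (abs_ne_zero.mpr hx))).continuousWithinAt
  have h1 := isOpen_compl_singleton.ae_eq_zero_of_integral_contDiff_smul_eq_zero hl
    fun η hη hc h0 => by
      have := h hη hc h0 n b
      rw [inner_tensor] at this
      rw [← this]
      refine integral_congr_ae (Eventually.of_forall fun x => ?_)
      simp only [smul_eq_mul]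
      ring
  filter_upwards [h1, Measure.ae_ne volume 0] with x hx hx0
  have hpos : 0 < |x| ^ (-α) := Real.rpow_pos_of_pos (abs_pos.mpr hx0) _
  exact (mul_eq_zero.mp (hx hx0)).resolve_left hpos.ne'

theorem eq_zero_of_inner_toL2 {w : L2 α} (h : ∀ f : testFn, inner ℝ w (toL2 α f) = (0 : ℝ)) : w = 0 :=
  eq_zero_of_inner_tensor fun _ _ _ _ _ => h _

theorem dense_range_toL2 (α : ℝ) : Dense (LinearMap.range (toL2 α) : Set (L2 α)) := by
  rw [Submodule.dense_iff_topologicalClosure_eq_top, Submodule.topologicalClosure_eq_top_iff,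
    Submodule.eq_bot_iff]
  intro w hw
  refine eq_zero_of_inner_toL2 fun f => ?_
  rw [real_inner_comm]
  exact Submodule.mem_orthogonal _ w |>.mp hw _ (LinearMap.mem_range_self _ f)

end Modes

end

/-! ### Weak gradients, form cores, the Friedrichs extension and essential self-adjointness -/

section

variable {α : ℝ}

/-- Square integrable vector fields on `M`, in the orthonormal frame `∂ₓ`, `|x|^α ∂_θ`. -/
abbrev Grad (α : ℝ) : Type := WithLp 2 (L2 α × L2 α)

/-- The pairs of a function and its weak gradient, both square integrable: the graph of the gradient
on `H¹(M, dω)`. -/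
def weakGradGraph (α : ℝ) : Submodule ℝ (L2 α × Grad α) where
  carrier := {p | ∀ h : testFn,
    (inner ℝ p.2.fst (toL2 α h) : ℝ) = inner ℝ p.1 (toL2 α (dxAdj α h)) ∧
    (inner ℝ p.2.snd (toL2 α h) : ℝ) = -inner ℝ p.1 (toL2 α (gradTheta α h))}
  zero_mem' := fun h => by simp
  add_mem' := by
    intro p q hp hq h
    simp only [Prod.snd_add, Prod.fst_add, WithLp.add_fst, WithLp.add_snd, inner_add_left,
      (hp h).1, (hq h).1, (hp h).2, (hq h).2, true_and]
    ring
  smul_mem' := by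
    intro c p hp h
    simp only [Prod.smul_snd, Prod.smul_fst, WithLp.smul_fst, WithLp.smul_snd, inner_smul_left,
      (hp h).1, (hp h).2, true_and]
    ring

theorem isClosed_weakGradGraph : IsClosed (weakGradGraph α : Set (L2 α × Grad α)) := by
  have h1 : Continuous fun p : L2 α × Grad α => p.2.fst :=
    (WithLp.fstL 2 ℝ (L2 α) (L2 α)).continuous.comp continuous_snd
  have h2 : Continuous fun p : L2 α × Grad α => p.2.snd :=
    (WithLp.sndL 2 ℝ (L2 α) (L2 α)).continuous.comp continuous_snd
  have e : (weakGradGraph α : Set (L2 α × Grad α)) = ⋂ h : testFn,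
      ({p | (inner ℝ p.2.fst (toL2 α h) : ℝ) = inner ℝ p.1 (toL2 α (dxAdj α h))} ∩
      {p | (inner ℝ p.2.snd (toL2 α h) : ℝ) = -inner ℝ p.1 (toL2 α (gradTheta α h))}) := by
    ext p; simp [weakGradGraph]
  rw [e]
  refine isClosed_iInter fun h => IsClosed.inter ?_ ?_
  · exact isClosed_eq (h1.inner continuous_const) (continuous_fst.inner continuous_const)
  · exact isClosed_eq (h2.inner continuous_const) (continuous_fst.inner continuous_const).neg

theorem weakGradGraph_eq_zero {g : Grad α} (h : ((0 : L2 α), g) ∈ weakGradGraph α) : g = 0 := by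
  have h1 : g.fst = 0 := eq_zero_of_inner_toL2 fun f => by rw [(h f).1]; simp
  have h2 : g.snd = 0 := eq_zero_of_inner_toL2 fun f => by rw [(h f).2]; simp
  exact (WithLp.ofLp_injective 2) (Prod.ext h1 h2)

theorem weakGradGraph_unique {u : L2 α} {g g' : Grad α} (h : (u, g) ∈ weakGradGraph α)
    (h' : (u, g') ∈ weakGradGraph α) : g = g' := by
  have := (weakGradGraph α).sub_mem h h'
  rw [Prod.mk_sub_mk, sub_self] at this
  exact sub_eq_zero.mp (weakGradGraph_eq_zero this)

/-- The Laplacian of a function whose gradient has components `f₁`, `f₂` in `C_c^∞(M)`. -/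
theorem inner_divergence {p : L2 α × Grad α} (hp : p ∈ weakGradGraph α) (f₁ f₂ : testFn) :
    (inner ℝ p.1 (toL2 α (gradTheta α f₂ - dxAdj α f₁)) : ℝ) =
      -inner ℝ (WithLp.toLp 2 (toL2 α f₁, toL2 α f₂) : Grad α) p.2 := by
  have h1 := (hp f₁).1
  have h2 := (hp f₂).2
  rw [WithLp.prod_inner_apply, map_sub, inner_sub_right]
  change _ = -((inner ℝ (toL2 α f₁) p.2.fst : ℝ) + inner ℝ (toL2 α f₂) p.2.snd)
  rw [real_inner_comm _ (toL2 α f₁), real_inner_comm _ (toL2 α f₂)]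
  linarith

/-- A space of functions that is the core of a Dirichlet form `∫ |∇f|² dω`. -/
structure IsFormCore (α : ℝ) (C : Submodule ℝ (Cyl → ℝ)) : Prop where
  test_le : testFn ≤ C
  smooth : ∀ f ∈ C, IsSmooth f
  memLp : ∀ f ∈ C, MemLp f 2 (vol α)
  dx_mem : ∀ f ∈ C, dx f ∈ testFn
  dtheta_mem : ∀ f ∈ C, dtheta f ∈ testFn
  squash_mem : ∀ f ∈ C, (fun p => squash (f p)) ∈ C

/-- The graph of the gradient on a core. -/
def coreGraph (α : ℝ) (C : Submodule ℝ (Cyl → ℝ)) : Submodule ℝ (L2 α × Grad α) where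
  carrier := {p | ∃ f ∈ C, IsSmooth f ∧ p.1 =ᵐ[vol α] f ∧ p.2.fst =ᵐ[vol α] dx f ∧
    p.2.snd =ᵐ[vol α] fun q => |q.1| ^ α * dtheta f q}
  zero_mem' := by
    refine ⟨0, C.zero_mem, IsSmooth.const 0, Lp.coeFn_zero ℝ 2 _, ?_, ?_⟩
    · filter_upwards [Lp.coeFn_zero ℝ 2 (vol α)] with p hp
      exact hp.trans (by simp [dx])
    · filter_upwards [Lp.coeFn_zero ℝ 2 (vol α)] with p hp
      exact hp.trans (by simp [dtheta])
  add_mem' := by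
    rintro p q ⟨f, hf, hfs, h1, h2, h3⟩ ⟨g, hg, hgs, k1, k2, k3⟩
    refine ⟨f + g, C.add_mem hf hg, hfs.add hgs, (Lp.coeFn_add _ _).trans (h1.add k1), ?_, ?_⟩
    · filter_upwards [Lp.coeFn_add p.2.fst q.2.fst, h2, k2, ae_vol_fst_ne α] with r hr a b h0
      exact hr.trans ((congrArg₂ (· + ·) a b).trans (dx_add hfs hgs h0).symm)
    · filter_upwards [Lp.coeFn_add p.2.snd q.2.snd, h3, k3, ae_vol_fst_ne α] with r hr a b h0
      refine hr.trans ((congrArg₂ (· + ·) a b).trans ?_)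
      exact (mul_add _ _ _).symm.trans (congrArg _ (dtheta_add hfs hgs h0).symm)
  smul_mem' := by
    rintro c p ⟨f, hf, hfs, h1, h2, h3⟩
    refine ⟨c • f, C.smul_mem c hf, (IsSmooth.const c).mul hfs,
      (Lp.coeFn_smul _ _).trans (h1.const_smul c), ?_, ?_⟩
    · filter_upwards [Lp.coeFn_smul c p.2.fst, h2, ae_vol_fst_ne α] with r hr a h0
      exact hr.trans ((congrArg (c * ·) a).trans (dx_const_mul c hfs h0).symm)
    · filter_upwards [Lp.coeFn_smul c p.2.snd, h3, ae_vol_fst_ne α] with r hr a h0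
      refine hr.trans ((congrArg (c * ·) a).trans ?_)
      exact (mul_left_comm _ _ _).trans (congrArg _ (dtheta_const_mul c hfs h0).symm)

/-- The closure of the gradient on a core. -/
def formSpace (α : ℝ) (C : Submodule ℝ (Cyl → ℝ)) : Submodule ℝ (L2 α × Grad α) :=
  (coreGraph α C).topologicalClosure

namespace IsFormCore

variable {C : Submodule ℝ (Cyl → ℝ)} (hC : IsFormCore α C)
include hC

theorem weighted_dtheta_mem {f : Cyl → ℝ} (hf : f ∈ C) :
    (fun q : Cyl => |q.1| ^ α * dtheta f q) ∈ testFn :=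
  (IsSmooth.abs_rpow α).mul_mem (hC.dtheta_mem f hf)

theorem mem_coreGraph {f : Cyl → ℝ} (hf : f ∈ C) :
    ((hC.memLp f hf).toLp f, (WithLp.toLp 2 (toL2 α ⟨dx f, hC.dx_mem f hf⟩,
      toL2 α ⟨_, hC.weighted_dtheta_mem hf⟩) : Grad α)) ∈ coreGraph α C :=
  ⟨f, hf, hC.smooth f hf, (hC.memLp f hf).coeFn_toLp, toL2_coeFn α _, toL2_coeFn α _⟩

theorem exists_of_mem_coreGraph {p : L2 α × Grad α} (hp : p ∈ coreGraph α C) :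
    ∃ (f : Cyl → ℝ) (hf : f ∈ C), p = ((hC.memLp f hf).toLp f,
      (WithLp.toLp 2 (toL2 α ⟨dx f, hC.dx_mem f hf⟩,
        toL2 α ⟨_, hC.weighted_dtheta_mem hf⟩) : Grad α)) := by
  obtain ⟨f, hf, hfs, h1, h2, h3⟩ := hp
  refine ⟨f, hf, Prod.ext (Lp.ext (h1.trans (hC.memLp f hf).coeFn_toLp.symm))
    (WithLp.ofLp_injective 2 (Prod.ext (Lp.ext ?_) (Lp.ext ?_)))⟩
  · exact h2.trans (toL2_coeFn α ⟨dx f, hC.dx_mem f hf⟩).symm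
  · exact h3.trans (toL2_coeFn α ⟨_, hC.weighted_dtheta_mem hf⟩).symm

theorem coreGraph_le_weakGradGraph : coreGraph α C ≤ weakGradGraph α := by
  intro p hp h
  obtain ⟨f, hf, rfl⟩ := hC.exists_of_mem_coreGraph hp
  have e : ∀ k : testFn, (inner ℝ ((hC.memLp f hf).toLp f) (toL2 α k) : ℝ) =
      ∫ q, f q * k.1 q ∂(vol α) := fun k => by
    rw [inner_toL2]
    refine integral_congr_ae ?_
    filter_upwards [(hC.memLp f hf).coeFn_toLp] with q hq
    rw [hq]
  constructor
  · rw [e]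
    refine (inner_toL2_toL2 α _ _).trans (integral_dx_mul α (hC.smooth f hf) h ?_)
    exact testFn.integrable_vol α ((testFn.isSmooth (hC.dx_mem f hf)).mul_mem h.2)
  · rw [e]
    refine (inner_toL2_toL2 α _ _).trans (integral_dtheta_mul α (hC.smooth f hf) h ?_)
    exact testFn.integrable_vol α ((testFn.isSmooth (hC.weighted_dtheta_mem hf)).mul_mem h.2)

theorem formSpace_le_weakGradGraph : formSpace α C ≤ weakGradGraph α :=
  Submodule.topologicalClosure_minimal _ hC.coreGraph_le_weakGradGraph isClosed_weakGradGraph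

theorem isClosedForm : IsClosedForm (formSpace α C) := by
  refine ⟨Submodule.isClosed_topologicalClosure _, fun g hg =>
    weakGradGraph_eq_zero (hC.formSpace_le_weakGradGraph hg), ?_⟩
  refine (dense_range_toL2 α).mono ?_
  rintro _ ⟨f, rfl⟩
  exact ⟨_, Submodule.le_topologicalClosure _ (hC.mem_coreGraph (hC.test_le f.2))⟩

/-- By the chain rule both components of the gradient are multiplied by `squash'(f)`, of absolute
value at most `1`. -/
theorem squashL2_mem {p : L2 α × Grad α} (hp : p ∈ coreGraph α C) :
    ∃ k, (squashL2 p.1, k) ∈ formSpace α C ∧ ‖k‖ ≤ ‖p.2‖ := by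
  obtain ⟨f, hf, rfl⟩ := hC.exists_of_mem_coreGraph hp
  have hs := hC.squash_mem f hf
  have h := hC.mem_coreGraph hs
  have e : squashL2 ((hC.memLp f hf).toLp f) = (hC.memLp _ hs).toLp _ := by
    refine Lp.ext ?_
    filter_upwards [squash_lipschitz.coeFn_compLp squash_zero ((hC.memLp f hf).toLp f),
      (hC.memLp f hf).coeFn_toLp, (hC.memLp _ hs).coeFn_toLp] with q h1 h2 h3
    rw [h3, squashL2, h1, Function.comp, h2]
  refine ⟨_, by rw [e]; exact Submodule.le_topologicalClosure _ h, ?_⟩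
  have key : ∀ {k g : testFn}, (∀ q : Cyl, q.1 ≠ 0 → |k.1 q| ≤ |g.1 q|) →
      ‖toL2 α k‖ ≤ ‖toL2 α g‖ := fun {k g} hkg => by
    refine Lp.norm_le_norm_of_ae_le ?_
    filter_upwards [toL2_coeFn α k, toL2_coeFn α g, ae_vol_fst_ne α] with q h1 h2 h3
    rw [h1, h2]
    exact hkg q h3
  refine le_of_sq_le_sq ?_ (norm_nonneg _)
  rw [WithLp.prod_norm_sq_eq_of_L2, WithLp.prod_norm_sq_eq_of_L2]
  refine add_le_add (pow_le_pow_left₀ (norm_nonneg _) (key fun q hq => ?_) 2)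
    (pow_le_pow_left₀ (norm_nonneg _) (key fun q hq => ?_) 2)
  · simp only
    rw [dx_comp squash_differentiable (hC.smooth f hf) hq, abs_mul]
    exact mul_le_of_le_one_left (abs_nonneg _) (abs_deriv_squash_le _)
  · simp only
    rw [dtheta_comp squash_differentiable (hC.smooth f hf) hq, abs_mul, abs_mul, abs_mul]
    exact mul_le_mul_of_nonneg_left
      (mul_le_of_le_one_left (abs_nonneg _) (abs_deriv_squash_le _)) (abs_nonneg _)

theorem isMarkovianOperator {A : L2 α →ₗ.[ℝ] L2 α}
    (hA : A.graph = formGraph (formSpace α C)) : IsMarkovianOperator A :=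
  isMarkovianOperator_of_core hC.isClosedForm
    (s := (coreGraph α C : Set (L2 α × Grad α))) (by exact subset_rfl)
    (fun _ hp => hC.squashL2_mem hp) hA

/-- The gradient of a core function has components in `C_c^∞(M)`, so its divergence is again a test
function and pairs with weak gradients without boundary terms. Thus the whole core lies in the
domain of the operator. -/
theorem core_mem_formGraph {f : Cyl → ℝ} (hf : f ∈ C) :
    ((hC.memLp f hf).toLp f, toL2 α (gradTheta α ⟨_, hC.weighted_dtheta_mem hf⟩ -
      dxAdj α ⟨dx f, hC.dx_mem f hf⟩)) ∈ formGraph (formSpace α C) := by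
  refine ⟨_, Submodule.le_topologicalClosure _ (hC.mem_coreGraph hf), fun q hq => ?_⟩
  rw [real_inner_comm]
  exact inner_divergence (hC.formSpace_le_weakGradGraph hq) _ _

theorem test_mem_formGraph (f : testFn) :
    (toL2 α f, toL2 α (laplace α f)) ∈ formGraph (formSpace α C) := by
  rw [laplace_eq]
  exact hC.core_mem_formGraph (hC.test_le f.2)

end IsFormCore

theorem mem_laplacian_graph_iff {u v : L2 α} : (u, v) ∈ (laplacian α).graph ↔
    ∃ f : testFn, toL2 α f = u ∧ toL2 α (laplace α f) = v := by
  rw [LinearPMap.mem_graph_iff]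
  constructor
  · rintro ⟨⟨_, f, rfl⟩, rfl, h⟩
    exact ⟨f, rfl, (laplacian_apply α f).symm.trans h⟩
  · rintro ⟨f, rfl, rfl⟩
    exact ⟨⟨toL2 α f, LinearMap.mem_range_self _ f⟩, rfl, laplacian_apply α f⟩

theorem laplacian_le_iff {A : L2 α →ₗ.[ℝ] L2 α} :
    laplacian α ≤ A ↔ ∀ f : testFn, (toL2 α f, toL2 α (laplace α f)) ∈ A.graph := by
  constructor
  · exact fun h f => LinearPMap.le_graph_of_le h (mem_laplacian_graph_iff.mpr ⟨f, rfl, rfl⟩)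
  · refine fun h => LinearPMap.le_of_le_graph ?_
    rintro ⟨u, v⟩ huv
    obtain ⟨f, rfl, rfl⟩ := mem_laplacian_graph_iff.mp huv
    exact h f

theorem mem_adjoint_graph_iff {u v : L2 α} : (u, v) ∈ (laplacian α).adjoint.graph ↔
    ∀ f : testFn, (inner ℝ u (toL2 α (laplace α f)) : ℝ) = inner ℝ v (toL2 α f) := by
  rw [LinearPMap.adjoint_graph_eq_graph_adjoint (dense_range_toL2 α)]
  simp only [Submodule.mem_adjoint_iff, sub_eq_zero]
  constructor
  · intro h f
    have := h _ _ (mem_laplacian_graph_iff.mpr ⟨f, rfl, rfl⟩)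
    rw [real_inner_comm, this, real_inner_comm]
  · intro h a b hab
    obtain ⟨f, rfl, rfl⟩ := mem_laplacian_graph_iff.mp hab
    rw [real_inner_comm, h f, real_inner_comm]

theorem isFormCore_testFn (α : ℝ) : IsFormCore α testFn where
  test_le := le_rfl
  smooth _ := testFn.isSmooth
  memLp _ := testFn.memLp α
  dx_mem _ := dx_mem
  dtheta_mem _ := dtheta_mem
  squash_mem f hf := by
    refine testFn.of_support hf (squash_contDiff.comp hf.1) fun p hp => ?_
    rw [image_eq_zero_of_notMem_tsupport hp, squash_zero]

theorem mem_H10_iff {u : L2 α} : u ∈ H10 α ↔ ∃ g, (u, g) ∈ formSpace α testFn := by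
  set e : (L2 α × L2 α × L2 α) ≃L[ℝ] (L2 α × Grad α) :=
    (ContinuousLinearEquiv.refl ℝ (L2 α)).prodCongr
      (WithLp.prodContinuousLinearEquiv 2 ℝ (L2 α) (L2 α)).symm
  set R := LinearMap.range ((toL2 α).prod ((toL2 α ∘ₗ dxL).prod
    (toL2 α ∘ₗ mulL (fun x => |x| ^ α) (contDiffAt_abs_rpow α) ∘ₗ dthetaL))) with hR
  have hC := isFormCore_testFn α
  have h1 : e '' (R : Set _) = (coreGraph α testFn : Set (L2 α × Grad α)) := by
    ext p
    constructor
    · rintro ⟨_, ⟨f, rfl⟩, rfl⟩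
      exact hC.mem_coreGraph f.2
    · intro hp
      obtain ⟨f, hf, rfl⟩ := hC.exists_of_mem_coreGraph hp
      exact ⟨_, ⟨⟨f, hf⟩, rfl⟩, rfl⟩
  have h2 : e '' (closure (R : Set _)) = (formSpace α testFn : Set (L2 α × Grad α)) := by
    rw [e.image_closure, h1]; rfl
  rw [H10, Submodule.mem_map]
  constructor
  · rintro ⟨p, hp, rfl⟩
    have : e p ∈ (formSpace α testFn : Set (L2 α × Grad α)) := by
      rw [← h2]; exact mem_image_of_mem _ hp
    exact ⟨_, this⟩
  · rintro ⟨g, hg⟩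
    have : (u, g) ∈ e '' (closure (R : Set _)) := by rw [h2]; exact hg
    obtain ⟨p, hp, hpe⟩ := this
    exact ⟨p, hp, congrArg Prod.fst hpe⟩

theorem mem_friedrichs_graph_iff {u v : L2 α} : (u, v) ∈ (friedrichs α).graph ↔
    u ∈ H10 α ∧ (u, v) ∈ (laplacian α).adjoint.graph := by
  rw [LinearPMap.mem_graph_iff, LinearPMap.mem_graph_iff]
  constructor
  · rintro ⟨⟨w, hw⟩, rfl, h⟩
    exact ⟨hw.1, ⟨w, hw.2⟩, rfl, h⟩
  · rintro ⟨hu, ⟨w, hw⟩, rfl, h⟩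
    exact ⟨⟨w, hu, hw⟩, rfl, h⟩

/-- For `u ∈ H¹₀`, integration by parts turns `(u, Δf) = (v, f)` into `(v, f) = -(∇u, ∇f)` for test
functions `f`. Both sides are continuous for the form norm, so it holds for all `f ∈ H¹₀`. -/
theorem friedrichs_graph_eq : (friedrichs α).graph = formGraph (formSpace α testFn) := by
  have hC := isFormCore_testFn α
  ext ⟨u, v⟩
  rw [mem_friedrichs_graph_iff, mem_H10_iff, mem_adjoint_graph_iff]
  constructor
  · rintro ⟨⟨g, hg⟩, h⟩
    refine ⟨g, hg, ?_⟩
    have hcl : IsClosed {q : L2 α × Grad α | (inner ℝ v q.1 : ℝ) = -inner ℝ g q.2} :=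
      isClosed_eq (continuous_const.inner continuous_fst) (continuous_const.inner continuous_snd).neg
    refine fun q hq => hcl.closure_subset_iff.mpr (fun q hq => ?_) hq
    obtain ⟨f, hf, rfl⟩ := hC.exists_of_mem_coreGraph hq
    have h1 := h ⟨f, hf⟩
    have h2 := inner_divergence (hC.formSpace_le_weakGradGraph hg) (dxL ⟨f, hf⟩)
      (gradTheta α ⟨f, hf⟩)
    rw [← laplace_eq] at h2
    exact h1.symm.trans (h2.trans (congrArg Neg.neg (real_inner_comm g _)))
  · rintro ⟨g, hg, h⟩
    refine ⟨⟨g, hg⟩, fun f => ?_⟩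
    have h1 := h _ (Submodule.le_topologicalClosure _ (hC.mem_coreGraph f.2))
    have h2 := inner_divergence (hC.formSpace_le_weakGradGraph hg) (dxL f) (gradTheta α f)
    rw [← laplace_eq] at h2
    exact h2.trans ((congrArg Neg.neg (real_inner_comm g _)).trans h1.symm)

theorem friedrichs_mem_markovianExtensions (α : ℝ) : friedrichs α ∈ markovianExtensions α := by
  refine ⟨laplacian_le_iff.mpr fun f => ?_, (isFormCore_testFn α).isMarkovianOperator
    friedrichs_graph_eq⟩
  rw [friedrichs_graph_eq]
  exact (isFormCore_testFn α).test_mem_formGraph f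

/-- An element of `Δ*` pairs symmetrically with the graph of `Δ`, hence with its closure, and the
closure is self-adjoint. Closability comes from the closed extension `Δ_F`. -/
theorem adjoint_graph_le_closure_graph (h : EssentiallySelfAdjoint α) :
    (laplacian α).adjoint.graph ≤ (laplacian α).closure.graph := by
  have hF := friedrichs_mem_markovianExtensions α
  have hcl : (laplacian α).IsClosable :=
    (hF.2.selfAdjoint.isClosed.isClosable).leIsClosable hF.1
  rintro ⟨u, v⟩ huv
  rw [IsSelfAdjoint.mem_graph_iff h]
  intro a b hab
  have hcl' : IsClosed {q : L2 α × L2 α | (inner ℝ q.2 u : ℝ) = inner ℝ q.1 v} :=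
    isClosed_eq (continuous_snd.inner continuous_const) (continuous_fst.inner continuous_const)
  rw [← hcl.graph_closure_eq_closure_graph] at hab
  refine hcl'.closure_subset_iff.mpr (fun q hq => ?_) hab
  obtain ⟨f, h1, h2⟩ := mem_laplacian_graph_iff.mp (show (q.1, q.2) ∈ _ from hq)
  have := mem_adjoint_graph_iff.mp huv f
  rw [h1, h2] at this
  simp only [mem_ofPred_eq]
  rw [real_inner_comm, this, real_inner_comm]

theorem graph_le_adjoint_graph {A : L2 α →ₗ.[ℝ] L2 α} (hA : IsSelfAdjoint A)
    (h : laplacian α ≤ A) : A.graph ≤ (laplacian α).adjoint.graph := by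
  rintro ⟨u, v⟩ huv
  rw [mem_adjoint_graph_iff]
  intro f
  have := hA.mem_graph_iff.mp huv _ _ (laplacian_le_iff.mp h f)
  rw [real_inner_comm, this, real_inner_comm]

/-- Every self-adjoint extension lies below `Δ*`, hence below the closure of `Δ`, and by maximality
equals it. -/
theorem EssentiallySelfAdjoint.markovUnique (h : EssentiallySelfAdjoint α) : MarkovUnique α := by
  have key : ∀ A ∈ markovianExtensions α, A = (laplacian α).closure := fun A hA =>
    eq_of_le_of_isSelfAdjoint hA.2.selfAdjoint h (LinearPMap.le_of_le_graph
      ((graph_le_adjoint_graph hA.2.selfAdjoint hA.1).trans (adjoint_graph_le_closure_graph h)))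
  have hF := friedrichs_mem_markovianExtensions α
  refine Subset.antisymm (fun A hA => ?_) (singleton_subset_iff.mpr hF)
  exact (key A hA).trans (key _ hF).symm

/-- Two elements of the domain of `Δ*` on which `Δ*` is not symmetric exclude essential
self-adjointness. -/
theorem EssentiallySelfAdjoint.inner_eq (h : EssentiallySelfAdjoint α) {u u' v v' : L2 α}
    (hu : (u, u') ∈ (laplacian α).adjoint.graph) (hv : (v, v') ∈ (laplacian α).adjoint.graph) :
    (inner ℝ u' v : ℝ) = inner ℝ u v' :=
  (IsSelfAdjoint.mem_graph_iff h).mp (adjoint_graph_le_closure_graph h hv) _ _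
    (adjoint_graph_le_closure_graph h hu)

end

/-! ### Cutoff functions and radial functions -/

section

variable {α : ℝ}

theorem testFn.of_bounds {g : Cyl → ℝ} (hs : IsSmooth g) {ε R : ℝ} (hε : 0 < ε)
    (h1 : ∀ p : Cyl, |p.1| < ε → g p = 0) (h2 : ∀ p : Cyl, R < |p.1| → g p = 0) : g ∈ testFn := by
  have hK : IsClosed {p : Cyl | ε ≤ |p.1| ∧ |p.1| ≤ R} :=
    (isClosed_le continuous_const continuous_fst.abs).inter
      (isClosed_le continuous_fst.abs continuous_const)
  have hsub : tsupport g ⊆ {p : Cyl | ε ≤ |p.1| ∧ |p.1| ≤ R} := by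
    refine closure_minimal (fun p hp => ⟨?_, ?_⟩) hK
    · by_contra hc
      exact hp (h1 p (not_le.mp hc))
    · by_contra hc
      exact hp (h2 p (not_le.mp hc))
  refine ⟨?_, ?_, fun p hp => ?_⟩
  · rw [contDiff_iff_contDiffAt]
    intro q
    by_cases hq : q.1 = 0
    · refine (contDiffAt_const (c := (0 : ℝ))).congr_of_eventuallyEq ?_
      have : ∀ᶠ r : ℝ × ℝ in 𝓝 q, |r.1| < ε := by
        refine continuous_fst.abs.continuousAt.eventually_lt continuousAt_const ?_
        rw [hq, abs_zero]
        exact hε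
      filter_upwards [this] with r hr using h1 (r.1, r.2) hr
    · exact hs q hq
  · refine (isCompact_Icc (a := -R) (b := R)).prod isCompact_univ |>.of_isClosed_subset
      (isClosed_tsupport g) fun p hp => ⟨abs_le.mp (hsub hp).2, trivial⟩
  · have := (hsub hp).1
    exact abs_pos.mp (hε.trans_le this)

theorem testFn.exists_bounds {g : Cyl → ℝ} (hg : g ∈ testFn) :
    (∃ ε > 0, ∀ p : Cyl, |p.1| < ε → g p = 0) ∧ ∃ R, ∀ p : Cyl, R < |p.1| → g p = 0 := by
  have hK : IsCompact (Prod.fst '' tsupport g) := hg.2.1.isCompact.image continuous_fst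
  constructor
  · have h0 : (0 : ℝ) ∉ Prod.fst '' tsupport g := by
      rintro ⟨p, hp, hp0⟩
      exact hg.2.2 hp hp0
    obtain ⟨ε, hε, hb⟩ := Metric.mem_nhds_iff.mp (hK.isClosed.isOpen_compl.mem_nhds h0)
    refine ⟨ε, hε, fun p hp => ?_⟩
    by_contra hc
    exact hb (by simpa using hp : p.1 ∈ Metric.ball 0 ε) ⟨p, subset_tsupport g hc, rfl⟩
  · obtain ⟨R, hR⟩ := hK.isBounded.exists_norm_le
    refine ⟨R, fun p hp => ?_⟩
    by_contra hc
    exact absurd (hR p.1 ⟨p, subset_tsupport g hc, rfl⟩) (not_le.mpr hp)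

section Cutoff

/-- A smooth even bump function, equal to `1` on `[-1, 1]` and to `0` off `(-2, 2)`. -/
def cutoff : ℝ → ℝ := (⟨1, 2, one_pos, one_lt_two⟩ : ContDiffBump (0 : ℝ))

theorem contDiff_cutoff : ContDiff ℝ ∞ cutoff := ContDiffBump.contDiff _

theorem cutoff_eq_one {x : ℝ} (hx : |x| ≤ 1) : cutoff x = 1 :=
  ContDiffBump.one_of_mem_closedBall _ (by simpa using hx)

theorem cutoff_eq_zero {x : ℝ} (hx : 2 ≤ |x|) : cutoff x = 0 :=
  ContDiffBump.zero_of_le_dist _ (by simpa using hx)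

theorem abs_cutoff_le (x : ℝ) : |cutoff x| ≤ 1 := by
  have h : 0 ≤ cutoff x := ContDiffBump.nonneg _
  rw [abs_of_nonneg h]
  exact ContDiffBump.le_one _

theorem contDiff_deriv_cutoff : ContDiff ℝ ∞ (deriv cutoff) :=
  (contDiff_infty_iff_deriv.mp contDiff_cutoff).2

theorem hasDerivAt_cutoff (x : ℝ) : HasDerivAt cutoff (deriv cutoff x) x :=
  (contDiff_cutoff.differentiable (by simp) x).hasDerivAt

theorem hasDerivAt_deriv_cutoff (x : ℝ) : HasDerivAt (deriv cutoff) (deriv (deriv cutoff) x) x :=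
  (contDiff_deriv_cutoff.differentiable (by simp) x).hasDerivAt

theorem deriv_cutoff_eq_zero {x : ℝ} (hx : |x| < 1) : deriv cutoff x = 0 := by
  have : cutoff =ᶠ[𝓝 x] fun _ => 1 := by
    filter_upwards [continuous_abs.continuousAt.eventually_lt continuousAt_const hx] with y hy
    exact cutoff_eq_one hy.le
  rw [this.deriv_eq, deriv_const]

theorem deriv_cutoff_eq_zero' {x : ℝ} (hx : 2 < |x|) : deriv cutoff x = 0 := by
  have : cutoff =ᶠ[𝓝 x] fun _ => 0 := by
    filter_upwards [continuousAt_const.eventually_lt continuous_abs.continuousAt hx] with y hy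
    exact cutoff_eq_zero hy.le
  rw [this.deriv_eq, deriv_const]

theorem deriv_deriv_cutoff_eq_zero {x : ℝ} (hx : |x| < 1) : deriv (deriv cutoff) x = 0 := by
  have : deriv cutoff =ᶠ[𝓝 x] fun _ => 0 := by
    filter_upwards [continuous_abs.continuousAt.eventually_lt continuousAt_const hx] with y hy
    exact deriv_cutoff_eq_zero hy
  rw [this.deriv_eq, deriv_const]

theorem deriv_deriv_cutoff_eq_zero' {x : ℝ} (hx : 2 < |x|) : deriv (deriv cutoff) x = 0 := by
  have : deriv cutoff =ᶠ[𝓝 x] fun _ => 0 := by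
    filter_upwards [continuousAt_const.eventually_lt continuous_abs.continuousAt hx] with y hy
    exact deriv_cutoff_eq_zero' hy
  rw [this.deriv_eq, deriv_const]

/-- The indicator function of `(0, ∞)`. -/
def step (x : ℝ) : ℝ := (Ioi (0 : ℝ)).indicator 1 x

theorem measurable_step : Measurable step := measurable_one.indicator measurableSet_Ioi

theorem abs_step_le (x : ℝ) : |step x| ≤ 1 := by
  by_cases hx : x ∈ Ioi (0 : ℝ) <;> simp [step, hx]

theorem step_mul_self (x : ℝ) : step x * step x = step x := by
  by_cases hx : x ∈ Ioi (0 : ℝ) <;> simp [step, hx]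

theorem step_eventuallyEq {x : ℝ} (hx : x ≠ 0) : step =ᶠ[𝓝 x] fun _ => step x := by
  rcases lt_or_gt_of_ne hx with h | h
  · filter_upwards [gt_mem_nhds h] with y hy
    simp [step, not_lt.mpr hy.le, not_lt.mpr h.le]
  · filter_upwards [lt_mem_nhds h] with y hy
    simp [step, hy, h]

theorem contDiffAt_step {x : ℝ} (hx : x ≠ 0) : ContDiffAt ℝ ∞ step x :=
  contDiffAt_const.congr_of_eventuallyEq (step_eventuallyEq hx)

theorem hasDerivAt_step {x : ℝ} (hx : x ≠ 0) : HasDerivAt step 0 x :=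
  (hasDerivAt_const x (step x)).congr_of_eventuallyEq (step_eventuallyEq hx)

theorem isSmooth_step : IsSmooth fun p => step p.1 := IsSmooth.of_fst fun _ => contDiffAt_step

theorem isSmooth_cutoff : IsSmooth fun p => cutoff p.1 :=
  IsSmooth.of_fst fun _ _ => contDiff_cutoff.contDiffAt

theorem isSmooth_deriv_cutoff : IsSmooth fun p => deriv cutoff p.1 :=
  IsSmooth.of_fst fun _ _ => contDiff_deriv_cutoff.contDiffAt

/-- The value is `-cutoff(0)²/2`. Its being nonzero is what both counterexamples rest on; the factor
`step` matters, since over the whole line the integral vanishes. -/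
theorem integral_step_cutoff : ∫ x, step x * (cutoff x * deriv cutoff x) = -(1 / 2) := by
  have e : ∀ x, step x * (cutoff x * deriv cutoff x) =
      (Ioi (0 : ℝ)).indicator (fun x => cutoff x * deriv cutoff x) x := fun x => by
    by_cases hx : x ∈ Ioi (0 : ℝ) <;> simp [step, hx]
  simp_rw [e]
  rw [integral_indicator measurableSet_Ioi]
  have hd : ∀ x ∈ Ici (0 : ℝ), HasDerivAt (fun x => cutoff x ^ 2 / 2) (cutoff x * deriv cutoff x) x :=
    fun x _ => by
      refine (((hasDerivAt_cutoff x).pow 2).div_const 2).congr_deriv ?_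
      push_cast
      ring
  have hcs : HasCompactSupport fun x => cutoff x * deriv cutoff x := by
    refine HasCompactSupport.intro (isCompact_Icc (a := (-2 : ℝ)) (b := 2)) fun x hx => ?_
    have : 2 ≤ |x| := by
      by_contra hc
      exact hx (abs_le.mp (not_le.mp hc).le)
    rw [cutoff_eq_zero this, zero_mul]
  have hi : Integrable fun x => cutoff x * deriv cutoff x :=
    (contDiff_cutoff.continuous.mul contDiff_deriv_cutoff.continuous).integrable_of_hasCompactSupport hcs
  have ht : Tendsto (fun x => cutoff x ^ 2 / 2) atTop (𝓝 0) := by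
    refine tendsto_const_nhds.congr' ?_
    filter_upwards [eventually_ge_atTop 2] with x hx
    rw [cutoff_eq_zero (hx.trans (le_abs_self x))]
    simp
  rw [integral_Ioi_of_hasDerivAt_of_tendsto' hd hi.integrableOn ht, cutoff_eq_one (by simp)]
  norm_num

theorem integral_cyl_fst (F : ℝ → ℝ) : ∫ p : Cyl, F p.1 = (2 * Real.pi) * ∫ x, F x := by
  rw [Measure.volume_eq_prod, integral_fun_fst]
  simp [measureReal_def, AddCircle.measure_univ, Real.pi_pos.le]

end Cutoff

section RadialIntegrability

theorem integrableOn_abs_rpow {β : ℝ} (hβ : -1 < β) (R : ℝ) :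
    IntegrableOn (fun x : ℝ => |x| ^ β) (Icc (-R) R) := by
  rcases lt_or_ge R 0 with hR | hR
  · rw [Icc_eq_empty (by linarith)]; exact integrableOn_empty
  have h1 : IntervalIntegrable (fun x : ℝ => |x| ^ β) volume 0 R := by
    refine (intervalIntegral.intervalIntegrable_rpow' hβ (a := 0) (b := R)).congr ?_
    intro x hx
    rw [uIoc_of_le hR] at hx
    simp only [abs_of_pos hx.1]
  have h2 : IntervalIntegrable (fun x : ℝ => |x| ^ β) volume (-R) 0 := by
    rw [IntervalIntegrable.iff_comp_neg]
    simpa using h1.symm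
  have h3 := h2.trans h1
  rwa [intervalIntegrable_iff_integrableOn_Icc_of_le (by linarith)] at h3

theorem integrable_abs_rpow_mul {β : ℝ} (hβ : -1 < β) {g : ℝ → ℝ} (hm : Measurable g) {C R : ℝ}
    (hC : ∀ x, |g x| ≤ C) (hR : ∀ x, R < |x| → g x = 0) : Integrable fun x => |x| ^ β * g x := by
  have h := ((integrableOn_abs_rpow hβ R).integrable_indicator measurableSet_Icc).const_mul C
  refine h.mono' (by fun_prop) (Eventually.of_forall fun x => ?_)
  by_cases hx : x ∈ Icc (-R) R
  · rw [indicator_of_mem hx, norm_mul, Real.norm_of_nonneg (by positivity), mul_comm]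
    gcongr
    exact hC x
  · have : R < |x| := by
      by_contra hc
      exact hx (abs_le.mp (not_lt.mp hc))
    rw [hR x this, indicator_of_notMem hx]
    simp

theorem memLp_fst {u : ℝ → ℝ} (hm : Measurable u)
    (hi : Integrable fun x => |x| ^ (-α) * u x ^ 2) : MemLp (fun p : Cyl => u p.1) 2 (vol α) := by
  have hm' : AEStronglyMeasurable (fun p : Cyl => u p.1) (vol α) :=
    (hm.comp measurable_fst).aestronglyMeasurable
  rw [memLp_two_iff_integrable_sq hm', integrable_vol_iff,
    Measure.volume_eq_prod]
  exact hi.comp_fst _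

theorem memLp_fst_of_bounded (hα : α < 1) {u : ℝ → ℝ} (hm : Measurable u) {C R : ℝ}
    (hC : ∀ x, |u x| ≤ C) (hR : ∀ x, R < |x| → u x = 0) :
    MemLp (fun p : Cyl => u p.1) 2 (vol α) := by
  refine memLp_fst hm (integrable_abs_rpow_mul (by linarith) (hm.pow_const 2) (C := C ^ 2) (R := R)
    (fun x => ?_) fun x hx => by rw [hR x hx]; simp)
  rw [abs_pow]
  have := hC x
  gcongr

end RadialIntegrability

/-! ### A second Markovian extension for `-1 < α < 1` -/

section LocallyConstantCore

/-- The functions that are smooth on `M`, constant near `{0} × 𝕋`, and vanish for large `|x|`. -/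
def coreFn : Submodule ℝ (Cyl → ℝ) where
  carrier := {f | IsSmooth f ∧ (∃ ε > 0, ∃ c, ∀ p : Cyl, |p.1| < ε → f p = c) ∧
    ∃ R, ∀ p : Cyl, R < |p.1| → f p = 0}
  zero_mem' := ⟨IsSmooth.const 0, ⟨1, one_pos, 0, fun _ _ => rfl⟩, 0, fun _ _ => rfl⟩
  add_mem' := by
    rintro f g ⟨hf, ⟨ε, hε, c, hc⟩, R, hR⟩ ⟨hg, ⟨δ, hδ, d, hd⟩, S, hS⟩
    refine ⟨hf.add hg, ⟨min ε δ, lt_min hε hδ, c + d, fun p hp => ?_⟩, max R S, fun p hp => ?_⟩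
    · rw [lt_min_iff] at hp
      exact congrArg₂ (· + ·) (hc p hp.1) (hd p hp.2)
    · rw [max_lt_iff] at hp
      exact (congrArg₂ (· + ·) (hR p hp.1) (hS p hp.2)).trans (add_zero 0)
  smul_mem' := by
    rintro r f ⟨hf, ⟨ε, hε, c, hc⟩, R, hR⟩
    refine ⟨(IsSmooth.const r).mul hf, ⟨ε, hε, r * c, fun p hp => ?_⟩, R, fun p hp => ?_⟩
    · exact congrArg (r * ·) (hc p hp)
    · exact (congrArg (r * ·) (hR p hp)).trans (mul_zero r)

theorem cutoff_mem_coreFn : (fun p : Cyl => cutoff p.1) ∈ coreFn :=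
  ⟨isSmooth_cutoff, ⟨1, one_pos, 1, fun _ hp => cutoff_eq_one hp.le⟩,
    2, fun _ hp => cutoff_eq_zero hp.le⟩

theorem eventually_abs_fst_lt {p : Cyl} {ε : ℝ} (h : |p.1| < ε) :
    (∀ᶠ s : ℝ in 𝓝 p.1, |s| < ε) :=
  continuous_abs.continuousAt.eventually_lt continuousAt_const h

theorem coreFn_memLp (hα : α < 1) {f : Cyl → ℝ} (h : f ∈ coreFn) : MemLp f 2 (vol α) := by
  obtain ⟨hf, ⟨ε, hε, c, hc⟩, R, hR⟩ := h
  -- The function `cutoff(3x/ε)` is `1` for `|x| ≤ ε/3` and `0` for `|x| ≥ 2ε/3`. Subtracting `c`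
  -- times it from `f` leaves a test function, so only this bounded radial function has to be square
  -- integrable, and this uses `α < 1`.
  have hsm : ContDiff ℝ ∞ fun x : ℝ => cutoff (3 / ε * x) :=
    contDiff_cutoff.comp (contDiff_const.mul contDiff_id)
  have e3 : ∀ x : ℝ, |3 / ε * x| = 3 / ε * |x| := fun x => by
    rw [abs_mul, abs_of_pos (by positivity : 0 < 3 / ε)]
  have h0 : ∀ x : ℝ, ε < |x| → cutoff (3 / ε * x) = 0 := fun x hx => by
    refine cutoff_eq_zero ?_
    rw [e3, div_mul_eq_mul_div, le_div_iff₀ hε]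
    linarith
  have h1 : MemLp (fun p : Cyl => cutoff (3 / ε * p.1)) 2 (vol α) :=
    memLp_fst_of_bounded (u := fun x => cutoff (3 / ε * x)) (C := 1) (R := ε) hα
      hsm.continuous.measurable (fun x => abs_cutoff_le _) h0
  have hs : IsSmooth fun p => cutoff (3 / ε * p.1) :=
    IsSmooth.of_fst (c := fun x => cutoff (3 / ε * x)) fun _ _ => hsm.contDiffAt
  have h2 : (fun p : Cyl => f p + -c * cutoff (3 / ε * p.1)) ∈ testFn := by
    refine testFn.of_bounds (ε := ε / 3) (R := max R ε) (hf.add ((IsSmooth.const (-c)).mul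
      hs)) (by positivity) (fun p hp => ?_) fun p hp => ?_
    · rw [hc p (by linarith), cutoff_eq_one]
      · ring
      · rw [e3, div_mul_eq_mul_div, div_le_one hε]
        linarith
    · rw [max_lt_iff] at hp
      rw [hR p hp.1, h0 _ hp.2]
      ring
  have e : f = (fun p : Cyl => f p + -c * cutoff (3 / ε * p.1)) +
      fun p => c * cutoff (3 / ε * p.1) := funext fun p => by
    rw [Pi.add_apply]; ring
  rw [e]
  exact (testFn.memLp α h2).add (h1.const_mul c)

theorem coreFn_dx_mem {f : Cyl → ℝ} (h : f ∈ coreFn) : dx f ∈ testFn := by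
  obtain ⟨hf, ⟨ε, hε, c, hc⟩, R, hR⟩ := h
  refine testFn.of_bounds hf.dx hε (R := R) (fun p hp => ?_) fun p hp => ?_
  · have : (fun s : ℝ => f (s, p.2)) =ᶠ[𝓝 p.1] fun _ => c := by
      filter_upwards [eventually_abs_fst_lt hp] with s hs using hc _ hs
    rw [dx, this.deriv_eq, deriv_const]
  · have : (fun s : ℝ => f (s, p.2)) =ᶠ[𝓝 p.1] fun _ => 0 := by
      filter_upwards [continuousAt_const.eventually_lt continuous_abs.continuousAt hp] with s hs
      exact hR _ hs
    rw [dx, this.deriv_eq, deriv_const]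

theorem coreFn_dtheta_mem {f : Cyl → ℝ} (h : f ∈ coreFn) : dtheta f ∈ testFn := by
  obtain ⟨hf, ⟨ε, hε, c, hc⟩, R, hR⟩ := h
  refine testFn.of_bounds hf.dtheta hε (R := R) (fun p hp => ?_) fun p hp => ?_
  · have : (fun t : ℝ => f (p.1, p.2 + (t : Torus))) = fun _ => c := funext fun t => hc _ hp
    rw [dtheta, this, deriv_const]
  · have : (fun t : ℝ => f (p.1, p.2 + (t : Torus))) = fun _ => 0 := funext fun t => hR _ hp
    rw [dtheta, this, deriv_const]

theorem coreFn_squash_mem {f : Cyl → ℝ} (h : f ∈ coreFn) : (fun p => squash (f p)) ∈ coreFn := by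
  obtain ⟨hf, ⟨ε, hε, c, hc⟩, R, hR⟩ := h
  refine ⟨hf.comp squash_contDiff, ⟨ε, hε, squash c, fun p hp => ?_⟩, R, fun p hp => ?_⟩
  · simp only [hc p hp]
  · simp only [hR p hp, squash_zero]


theorem testFn_le_coreFn : testFn ≤ coreFn := fun f hf => by
  obtain ⟨⟨ε, hε, h1⟩, R, h2⟩ := testFn.exists_bounds hf
  exact ⟨testFn.isSmooth hf, ⟨ε, hε, 0, h1⟩, R, h2⟩

theorem isFormCore_coreFn (hα : α < 1) : IsFormCore α coreFn where
  test_le := testFn_le_coreFn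
  smooth _ hf := hf.1
  memLp _ hf := coreFn_memLp hα hf
  dx_mem _ hf := coreFn_dx_mem hf
  dtheta_mem _ hf := coreFn_dtheta_mem hf
  squash_mem _ hf := coreFn_squash_mem hf

/-- For `α > -1`, every `u ∈ H¹₀` has trace zero at `x = 0⁺`. -/
theorem inner_trace (hα : -1 < α) : ∃ (k : L2 α) (m : testFn),
    k =ᵐ[vol α] (fun p => step p.1 * |p.1| ^ α * cutoff p.1) ∧
    (m.1 = fun p => -(step p.1 * |p.1| ^ α * deriv cutoff p.1)) ∧
    ∀ p ∈ formSpace α testFn, (inner ℝ p.2.fst k : ℝ) = inner ℝ p.1 (toL2 α m) := by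
  have hmeas : Measurable fun x : ℝ => step x * |x| ^ α * cutoff x :=
    (measurable_step.mul (by fun_prop)).mul contDiff_cutoff.continuous.measurable
  -- The square of this function times the density `|x|^{-α}` is `|x|^α cutoff²` on `x > 0`,
  -- integrable because `α > -1`.
  have hk : MemLp (fun p : Cyl => step p.1 * |p.1| ^ α * cutoff p.1) 2 (vol α) := by
    refine memLp_fst hmeas ?_
    have h := integrable_abs_rpow_mul hα (g := fun x => step x * cutoff x ^ 2) (C := 1) (R := 2)
      (measurable_step.mul (contDiff_cutoff.continuous.measurable.pow_const 2)) (fun x => by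
        rw [abs_mul, abs_pow]
        have h1 := abs_step_le x
        have h2 := abs_cutoff_le x
        exact mul_le_one₀ h1 (by positivity) (pow_le_one₀ (abs_nonneg _) h2))
      (fun x hx => by rw [cutoff_eq_zero hx.le]; simp)
    refine h.congr ?_
    filter_upwards [Measure.ae_ne volume 0] with x hx
    have e : |x| ^ (-α) * |x| ^ α = 1 := by
      rw [← Real.rpow_add (abs_pos.mpr hx)]; simp
    linear_combination (-(|x| ^ α * step x * cutoff x ^ 2)) * e +
      (-(|x| ^ (-α) * (|x| ^ α) ^ 2 * cutoff x ^ 2)) * step_mul_self x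
  have hm : (fun p : Cyl => -(step p.1 * |p.1| ^ α * deriv cutoff p.1)) ∈ testFn := by
    refine testFn.of_bounds (ε := 1) (R := 2) ?_ one_pos (fun p hp => ?_) fun p hp => ?_
    · exact ((IsSmooth.const (-1)).mul ((isSmooth_step.mul (IsSmooth.abs_rpow α)).mul
        isSmooth_deriv_cutoff)).congr fun p _ => by ring
    · rw [deriv_cutoff_eq_zero hp]; simp
    · rw [deriv_cutoff_eq_zero' hp]; simp
  refine ⟨hk.toLp _, ⟨_, hm⟩, hk.coeFn_toLp, rfl, ?_⟩
  have hcl : IsClosed {p : L2 α × Grad α |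
      (inner ℝ p.2.fst (hk.toLp _) : ℝ) = inner ℝ p.1 (toL2 α ⟨_, hm⟩)} :=
    isClosed_eq (((WithLp.fstL 2 ℝ (L2 α) (L2 α)).continuous.comp continuous_snd).inner
      continuous_const) (continuous_fst.inner continuous_const)
  refine fun p hp => hcl.closure_subset_iff.mpr (fun q hq => ?_) hp
  obtain ⟨f, hf, rfl⟩ := (isFormCore_testFn α).exists_of_mem_coreGraph hq
  -- Integrating `∂ₓ(step · cutoff · f)` gives the identity for test functions `f`: no boundary term
  -- at `0⁺`. Both sides are `L²` pairings, so it persists in the closure.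
  have h0 := integral_dx_eq_zero ((isSmooth_step.mul isSmooth_cutoff).mul_mem hf)
  have hi : Integrable (fun p => dx f p * (step p.1 * |p.1| ^ α * cutoff p.1)) (vol α) :=
    (testFn.memLp α (dx_mem hf)).integrable_mul hk
  have hi2 : Integrable (fun p => f p * -(step p.1 * |p.1| ^ α * deriv cutoff p.1)) (vol α) :=
    (testFn.memLp α hf).integrable_mul (testFn.memLp α hm)
  have e1 : (inner ℝ (toL2 α ⟨dx f, dx_mem hf⟩) (hk.toLp _) : ℝ) =
      ∫ p, dx f p * (step p.1 * |p.1| ^ α * cutoff p.1) ∂(vol α) := by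
    rw [L2.inner_def]
    refine integral_congr_ae ?_
    filter_upwards [toL2_coeFn α ⟨dx f, dx_mem hf⟩, hk.coeFn_toLp] with p h1 h2
    rw [h1, h2]
    simp [mul_comm]
  have e2 : (inner ℝ (toL2 α ⟨f, hf⟩) (toL2 α ⟨_, hm⟩) : ℝ) = _ := inner_toL2_toL2 α ⟨f, hf⟩ ⟨_, hm⟩
  refine e1.trans (Eq.trans ?_ e2.symm)
  rw [← sub_eq_zero, ← integral_sub hi hi2, integral_vol, ← h0]
  refine integral_congr_ae ?_
  filter_upwards [ae_fst_ne] with p hp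
  have e : |p.1| ^ (-α) * |p.1| ^ α = 1 := by
    rw [← Real.rpow_add (abs_pos.mpr hp)]; simp
  have ds : dx (fun q : Cyl => step q.1) p = 0 := (hasDerivAt_step hp).deriv
  have dc : dx (fun q : Cyl => cutoff q.1) p = deriv cutoff p.1 := rfl
  rw [dx_mul (isSmooth_step.mul isSmooth_cutoff) (testFn.isSmooth hf) hp,
    dx_mul isSmooth_step isSmooth_cutoff hp, ds, dc]
  linear_combination (step p.1 * (cutoff p.1 * dx f p + deriv cutoff p.1 * f p)) * e

/-- The cutoff has trace `1` at `0⁺`. If it were in `H¹₀`, the trace identity applied to it would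
give `I = -I` for `I = ∫ step · cutoff · cutoff' dx dθ = -π`. -/
theorem cutoff_notMem_H10 (h1 : -1 < α) (h2 : α < 1) :
    ((isFormCore_coreFn h2).memLp _ cutoff_mem_coreFn).toLp _ ∉ H10 α := by
  intro h
  have hC := isFormCore_coreFn h2
  obtain ⟨g, hg⟩ := mem_H10_iff.mp h
  have hcore := hC.mem_coreGraph cutoff_mem_coreFn
  have hgeq := weakGradGraph_unique ((isFormCore_testFn α).formSpace_le_weakGradGraph hg)
    (hC.coreGraph_le_weakGradGraph hcore)
  obtain ⟨k, m, hk, hm, hkm⟩ := inner_trace h1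
  have h3 := hkm _ hg
  rw [hgeq] at h3
  have e1 : (inner ℝ (toL2 α ⟨dx (fun p : Cyl => cutoff p.1), hC.dx_mem _ cutoff_mem_coreFn⟩) k : ℝ) =
      ∫ p : Cyl, step p.1 * (cutoff p.1 * deriv cutoff p.1) := by
    rw [real_inner_comm, inner_toL2, integral_vol]
    refine (integral_congr_ae ?_)
    have hk' : ∀ᵐ p : Cyl, p.1 ≠ 0 → k p = step p.1 * |p.1| ^ α * cutoff p.1 := by
      have hmeas : Measurable fun p : Cyl => ENNReal.ofReal (|p.1| ^ (-α)) := by fun_prop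
      filter_upwards [(ae_withDensity_iff hmeas).mp hk] with p hp h0
      exact hp (ENNReal.ofReal_pos.mpr (Real.rpow_pos_of_pos (abs_pos.mpr h0) _)).ne'
    filter_upwards [hk', ae_fst_ne] with p hp h0
    have e : |p.1| ^ (-α) * |p.1| ^ α = 1 := by
      rw [← Real.rpow_add (abs_pos.mpr h0)]; simp
    have dc : dx (fun q : Cyl => cutoff q.1) p = deriv cutoff p.1 := rfl
    rw [hp h0]
    simp only [dc]
    linear_combination (step p.1 * (cutoff p.1 * deriv cutoff p.1)) * e
  have e2 : (inner ℝ ((hC.memLp _ cutoff_mem_coreFn).toLp _) (toL2 α m) : ℝ) =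
      -∫ p : Cyl, step p.1 * (cutoff p.1 * deriv cutoff p.1) := by
    rw [inner_toL2]
    have : ∫ p, ((hC.memLp _ cutoff_mem_coreFn).toLp _ : Cyl → ℝ) p * m.1 p ∂(vol α) =
        ∫ p : Cyl, cutoff p.1 * m.1 p ∂(vol α) := by
      refine integral_congr_ae ?_
      filter_upwards [(hC.memLp _ cutoff_mem_coreFn).coeFn_toLp] with p hp
      rw [hp]
    rw [this, integral_vol, ← integral_neg]
    refine (integral_congr_ae ?_)
    filter_upwards [ae_fst_ne] with p h0
    have e : |p.1| ^ (-α) * |p.1| ^ α = 1 := by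
      rw [← Real.rpow_add (abs_pos.mpr h0)]; simp
    rw [hm]
    linear_combination (-(step p.1 * (cutoff p.1 * deriv cutoff p.1))) * e
  have h4 : (∫ p : Cyl, step p.1 * (cutoff p.1 * deriv cutoff p.1)) =
      -∫ p : Cyl, step p.1 * (cutoff p.1 * deriv cutoff p.1) := e1.symm.trans (h3.trans e2)
  rw [integral_cyl_fst (fun x => step x * (cutoff x * deriv cutoff x)), integral_step_cutoff] at h4
  have := Real.pi_pos
  linarith

/-- The operator of the closed form on functions constant near `{0} × 𝕋` is Markovian and has the
cutoff in its domain. It allows passage between the two halves of `M`. -/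
theorem not_markovUnique (h1 : -1 < α) (h2 : α < 1) : ¬ MarkovUnique α := by
  intro h
  have hC := isFormCore_coreFn h2
  have hgr := Submodule.toLinearPMap_graph_eq _ (formGraph_unique hC.isClosedForm)
  set N := (formGraph (formSpace α coreFn)).toLinearPMap
  have hN : N ∈ markovianExtensions α := by
    refine ⟨laplacian_le_iff.mpr fun f => ?_, hC.isMarkovianOperator hgr⟩
    rw [hgr]
    exact hC.test_mem_formGraph f
  rw [h, mem_singleton_iff] at hN
  have hmem := hC.core_mem_formGraph cutoff_mem_coreFn
  rw [← hgr, hN] at hmem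
  exact cutoff_notMem_H10 h1 h2 (mem_friedrichs_graph_iff.mp hmem).1

end LocallyConstantCore

/-! ### Failure of essential self-adjointness at `α = -2` -/

section NotEssentiallySelfAdjoint

/-- A radial function on which the differential expression `Δ` is square integrable is in the domain
of `Δ*`. -/
theorem radial_mem_adjoint_graph {u : ℝ → ℝ} (hu : ∀ x, x ≠ 0 → ContDiffAt ℝ ∞ u x)
    (hL : MemLp (fun p : Cyl => u p.1) 2 (vol α)) (l : testFn)
    (hl : ∀ p : Cyl, p.1 ≠ 0 → deriv (deriv u) p.1 - α / p.1 * deriv u p.1 = l.1 p) :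
    (hL.toLp _, toL2 α l) ∈ (laplacian α).adjoint.graph := by
  rw [mem_adjoint_graph_iff]
  intro h
  have hs : IsSmooth fun p => u p.1 := IsSmooth.of_fst hu
  have hds : IsSmooth fun p => deriv u p.1 := hs.dx
  have e0 : (inner ℝ (hL.toLp _) (toL2 α (laplace α h)) : ℝ) =
      ∫ p : Cyl, u p.1 * (laplace α h).1 p ∂(vol α) := by
    rw [inner_toL2]
    refine integral_congr_ae ?_
    filter_upwards [hL.coeFn_toLp] with p hp
    rw [hp]
  have e1 := integral_dtheta_mul α hs (gradTheta α h) (by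
    simp only [dtheta_fst u]; simp)
  simp only [dtheta_fst u, mul_zero, zero_mul, integral_zero] at e1
  have e2 := integral_dx_mul α hs (dxL h) (testFn.integrable_vol α (hs.dx.mul_mem (dxL h).2))
  have e3 := integral_dx_mul α hds h (testFn.integrable_vol α (hds.dx.mul_mem h.2))
  have i1 : Integrable (fun p : Cyl => u p.1 * (gradTheta α (gradTheta α h)).1 p) (vol α) :=
    testFn.integrable_vol α (hs.mul_mem (gradTheta α (gradTheta α h)).2)
  have i2 : Integrable (fun p : Cyl => u p.1 * (dxAdj α (dxL h)).1 p) (vol α) :=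
    testFn.integrable_vol α (hs.mul_mem (dxAdj α (dxL h)).2)
  have e4 : ∫ p : Cyl, u p.1 * (laplace α h).1 p ∂(vol α) =
      ∫ p : Cyl, u p.1 * (gradTheta α (gradTheta α h)).1 p ∂(vol α) -
        ∫ p : Cyl, u p.1 * (dxAdj α (dxL h)).1 p ∂(vol α) := by
    rw [← integral_sub i1 i2, laplace_eq]
    refine integral_congr_ae (Eventually.of_forall fun p => ?_)
    exact mul_sub _ _ _
  have i3 : Integrable (fun p : Cyl => deriv u p.1 * (dxAdj α h).1 p) (vol α) :=
    testFn.integrable_vol α (hds.mul_mem (dxAdj α h).2)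
  have i4 : Integrable (fun p : Cyl => deriv u p.1 * (dxL h).1 p) (vol α) :=
    testFn.integrable_vol α (hds.mul_mem (dxL h).2)
  have i5 : Integrable (fun p : Cyl => dx (fun q : Cyl => deriv u q.1) p * h.1 p) (vol α) :=
    testFn.integrable_vol α (hds.dx.mul_mem h.2)
  rw [e0, e4, inner_toL2_toL2, ← sub_eq_zero, ← sub_eq_zero.mpr e3, ← e2]
  have e5 : ∫ p, l.1 p * h.1 p ∂(vol α) =
      ∫ p : Cyl, dx (fun q : Cyl => deriv u q.1) p * h.1 p ∂(vol α) -
      (∫ p : Cyl, deriv u p.1 * (dxAdj α h).1 p ∂(vol α) +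
        ∫ p : Cyl, deriv u p.1 * (dxL h).1 p ∂(vol α)) := by
    have i34 : Integrable (fun p : Cyl => deriv u p.1 * (dxAdj α h).1 p +
        deriv u p.1 * (dxL h).1 p) (vol α) := i3.add i4
    rw [← integral_add i3 i4, ← integral_sub i5 i34]
    refine integral_congr_ae ?_
    filter_upwards [ae_vol_fst_ne α] with p hp
    have hd : dx (fun q : Cyl => deriv u q.1) p = deriv (deriv u) p.1 := rfl
    have hd2 : (dxL h).1 p = dx h.1 p := rfl
    rw [← hl p hp, hd, hd2, dxAdj_apply]
    ring
  have e6 : ∫ p : Cyl, dx (fun q : Cyl => u q.1) p * (dxL h).1 p ∂(vol α) =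
      ∫ p : Cyl, deriv u p.1 * (dxL h).1 p ∂(vol α) := rfl
  rw [e5, e6]
  linarith

/-- For `α = -2` the radial part of `Δ` is `∂ₓ² + (2/x)∂ₓ`, with solutions `1` and `1/x`, both
square integrable near `0` for `x² dx`. Truncated by the cutoff `χ`, and the first also to `x > 0`,
they lie in `dom Δ*`. The defect of symmetry on this pair is `2 ∫ step χ χ' dx dθ = -2π ≠ 0`. -/
theorem not_essentiallySelfAdjoint : ¬ EssentiallySelfAdjoint (-2) := by
  intro h
  have hcut : ∀ x : ℝ, ContDiffAt ℝ ∞ cutoff x := fun x => contDiff_cutoff.contDiffAt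
  -- The two radial functions `1_{x > 0} χ` and `χ / x`.
  have hu : ∀ x : ℝ, x ≠ 0 → ContDiffAt ℝ ∞ (fun x => step x * cutoff x) x :=
    fun x hx => (contDiffAt_step hx).mul (hcut x)
  have hv : ∀ x : ℝ, x ≠ 0 → ContDiffAt ℝ ∞ (fun x => cutoff x * x⁻¹) x :=
    fun x hx => (hcut x).mul (contDiffAt_id.inv hx)
  have hu1 : ∀ x : ℝ, x ≠ 0 → HasDerivAt (fun x => step x * cutoff x) (step x * deriv cutoff x) x :=
    fun x hx => ((hasDerivAt_step hx).mul (hasDerivAt_cutoff x)).congr_deriv (by ring)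
  have hu2 : ∀ x : ℝ, x ≠ 0 → deriv (deriv fun x => step x * cutoff x) x =
      step x * deriv (deriv cutoff) x := fun x hx => by
    have e : deriv (fun x => step x * cutoff x) =ᶠ[𝓝 x] fun x => step x * deriv cutoff x := by
      filter_upwards [isOpen_ne.mem_nhds hx] with y hy using (hu1 y hy).deriv
    rw [e.deriv_eq]
    exact (((hasDerivAt_step hx).mul (hasDerivAt_deriv_cutoff x)).congr_deriv (by ring)).deriv
  have hv1 : ∀ x : ℝ, x ≠ 0 → HasDerivAt (fun x => cutoff x * x⁻¹)
      (deriv cutoff x * x⁻¹ - cutoff x * (x⁻¹) ^ 2) x := fun x hx =>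
    ((hasDerivAt_cutoff x).mul (hasDerivAt_inv hx)).congr_deriv (by rw [inv_pow]; ring)
  have hv2 : ∀ x : ℝ, x ≠ 0 → deriv (deriv fun x => cutoff x * x⁻¹) x =
      deriv (deriv cutoff) x * x⁻¹ - 2 * deriv cutoff x * (x⁻¹) ^ 2 + 2 * cutoff x * (x⁻¹) ^ 3 :=
    fun x hx => by
    have e : deriv (fun x => cutoff x * x⁻¹) =ᶠ[𝓝 x]
        fun x => deriv cutoff x * x⁻¹ - cutoff x * (x⁻¹) ^ 2 := by
      filter_upwards [isOpen_ne.mem_nhds hx] with y hy using (hv1 y hy).deriv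
    rw [e.deriv_eq]
    have d1 := (hasDerivAt_deriv_cutoff x).mul (hasDerivAt_inv hx)
    have d2 := (hasDerivAt_cutoff x).mul ((hasDerivAt_inv hx).pow 2)
    refine (d1.sub d2).deriv.trans ?_
    simp only [Pi.pow_apply]
    push_cast
    rw [← inv_pow]
    ring
  have hLu : MemLp (fun p : Cyl => step p.1 * cutoff p.1) 2 (vol (-2)) := by
    refine memLp_fst_of_bounded (by norm_num) (u := fun x => step x * cutoff x) (C := 1) (R := 2)
      (measurable_step.mul contDiff_cutoff.continuous.measurable) (fun x => ?_) fun x hx => ?_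
    · rw [abs_mul]
      exact mul_le_one₀ (abs_step_le x) (abs_nonneg _) (abs_cutoff_le x)
    · rw [cutoff_eq_zero hx.le, mul_zero]
  have hLv : MemLp (fun p : Cyl => cutoff p.1 * p.1⁻¹) 2 (vol (-2)) := by
    refine memLp_fst (u := fun x => cutoff x * x⁻¹)
      (contDiff_cutoff.continuous.measurable.mul measurable_inv) ?_
    have := integrable_abs_rpow_mul (β := 0) (by norm_num) (g := fun x => cutoff x ^ 2) (C := 1)
      (R := 2) (contDiff_cutoff.continuous.measurable.pow_const 2)
      (fun x => by rw [abs_pow]; exact pow_le_one₀ (abs_nonneg _) (abs_cutoff_le x))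
      (fun x hx => by rw [cutoff_eq_zero hx.le]; simp)
    refine this.congr ?_
    filter_upwards [Measure.ae_ne volume 0] with x hx
    rw [neg_neg, Real.rpow_zero, Real.rpow_two, sq_abs]
    field_simp
  have hlu : (fun p : Cyl => step p.1 * deriv (deriv cutoff) p.1 +
      2 / p.1 * (step p.1 * deriv cutoff p.1)) ∈ testFn := by
    refine testFn.of_bounds (ε := 1) (R := 2) ?_ one_pos (fun p hp => ?_) fun p hp => ?_
    · refine (isSmooth_step.mul isSmooth_deriv_cutoff.dx).add (IsSmooth.mul
        (IsSmooth.of_fst fun _ hx => contDiffAt_const.div contDiffAt_id hx)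
        (isSmooth_step.mul isSmooth_deriv_cutoff))
    · rw [deriv_cutoff_eq_zero hp, deriv_deriv_cutoff_eq_zero hp]; simp
    · rw [deriv_cutoff_eq_zero' hp, deriv_deriv_cutoff_eq_zero' hp]; simp
  have hlv : (fun p : Cyl => deriv (deriv cutoff) p.1 * p.1⁻¹) ∈ testFn := by
    refine testFn.of_bounds (ε := 1) (R := 2) ?_ one_pos (fun p hp => ?_) fun p hp => ?_
    · exact isSmooth_deriv_cutoff.dx.mul (IsSmooth.of_fst fun _ hx => contDiffAt_id.inv hx)
    · rw [deriv_deriv_cutoff_eq_zero hp]; simp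
    · rw [deriv_deriv_cutoff_eq_zero' hp]; simp
  have a1 := radial_mem_adjoint_graph hu hLu ⟨_, hlu⟩ fun p hp => by
    rw [hu2 _ hp, (hu1 _ hp).deriv]; ring
  have a2 := radial_mem_adjoint_graph hv hLv ⟨_, hlv⟩ fun p hp => by
    rw [hv2 _ hp, (hv1 _ hp).deriv]; simp only; field_simp; ring
  have h1 := h.inner_eq a1 a2
  rw [real_inner_comm, inner_toL2, inner_toL2] at h1
  have b1 : ∫ p, (hLv.toLp _ : Cyl → ℝ) p * (step p.1 * deriv (deriv cutoff) p.1 +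
      2 / p.1 * (step p.1 * deriv cutoff p.1)) ∂(vol (-2)) =
      ∫ p : Cyl, cutoff p.1 * p.1⁻¹ * (step p.1 * deriv (deriv cutoff) p.1 +
      2 / p.1 * (step p.1 * deriv cutoff p.1)) ∂(vol (-2)) := by
    refine integral_congr_ae ?_
    filter_upwards [hLv.coeFn_toLp] with p hp
    rw [hp]
  have b2 : ∫ p, (hLu.toLp _ : Cyl → ℝ) p * (deriv (deriv cutoff) p.1 * p.1⁻¹) ∂(vol (-2)) =
      ∫ p : Cyl, step p.1 * cutoff p.1 * (deriv (deriv cutoff) p.1 * p.1⁻¹) ∂(vol (-2)) := by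
    refine integral_congr_ae ?_
    filter_upwards [hLu.coeFn_toLp] with p hp
    rw [hp]
  have h2 := b1.symm.trans (h1.trans b2)
  have i1 : Integrable (fun p : Cyl => cutoff p.1 * p.1⁻¹ * (step p.1 * deriv (deriv cutoff) p.1 +
      2 / p.1 * (step p.1 * deriv cutoff p.1))) (vol (-2)) :=
    hLv.integrable_mul (testFn.memLp (-2) hlu)
  have i2 : Integrable (fun p : Cyl => step p.1 * cutoff p.1 * (deriv (deriv cutoff) p.1 * p.1⁻¹))
      (vol (-2)) := hLu.integrable_mul (testFn.memLp (-2) hlv)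
  rw [← sub_eq_zero, ← integral_sub i1 i2, integral_vol] at h2
  have h3 : ∫ p : Cyl, 2 * (step p.1 * (cutoff p.1 * deriv cutoff p.1)) = 0 := by
    rw [← h2]
    refine integral_congr_ae ?_
    filter_upwards [ae_fst_ne] with p hp
    rw [neg_neg, Real.rpow_two, sq_abs]
    field_simp
    ring
  rw [integral_const_mul, integral_cyl_fst (fun x => step x * (cutoff x * deriv cutoff x)),
    integral_step_cutoff] at h3
  have := Real.pi_pos
  linarith

end NotEssentiallySelfAdjoint

end

/-! ### Sub-Markovian operators and a substitute for the heat kernel -/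

section

section SubMarkov

variable {X : Type*} [MeasurableSpace X] {m : Measure X} {T : Lp ℝ 2 m →L[ℝ] Lp ℝ 2 m}

/-- `0 ≤ u ≤ 1` a.e. implies `0 ≤ T u ≤ 1` a.e. -/
def IsSubMarkov (T : Lp ℝ 2 m →L[ℝ] Lp ℝ 2 m) : Prop :=
  ∀ u : Lp ℝ 2 m, (∀ᵐ p ∂m, 0 ≤ u p ∧ u p ≤ 1) → ∀ᵐ p ∂m, 0 ≤ T u p ∧ T u p ≤ 1

theorem IsSubMarkov.le_of_nonneg (hT : IsSubMarkov T) {u : Lp ℝ 2 m} {d : ℝ} (hd : 0 < d)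
    (h : ∀ᵐ p ∂m, 0 ≤ u p ∧ u p ≤ d) : ∀ᵐ p ∂m, 0 ≤ T u p ∧ T u p ≤ d := by
  have h1 : ∀ᵐ p ∂m, 0 ≤ (d⁻¹ • u : Lp ℝ 2 m) p ∧ (d⁻¹ • u : Lp ℝ 2 m) p ≤ 1 := by
    filter_upwards [h, Lp.coeFn_smul d⁻¹ u] with p hp h2
    rw [h2, Pi.smul_apply, smul_eq_mul]
    exact ⟨mul_nonneg (by positivity) hp.1, by rw [inv_mul_le_iff₀ hd, mul_one]; exact hp.2⟩
  have h2 := hT _ h1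
  rw [map_smul] at h2
  filter_upwards [h2, Lp.coeFn_smul d⁻¹ (T u)] with p hp h3
  rw [h3, Pi.smul_apply, smul_eq_mul, inv_mul_le_iff₀ hd, mul_one] at hp
  exact ⟨nonneg_of_mul_nonneg_right hp.1 (by positivity), hp.2⟩

/-- Split `u = u⁺ - u⁻`: then `Tu⁺ ≤ d` and `Tu⁻ ≥ 0`. The bound `C` is there because positivity of
`T` is only available, by scaling, for bounded functions. -/
theorem IsSubMarkov.le_of_pos (hT : IsSubMarkov T) {u : Lp ℝ 2 m} {C d : ℝ}
    (hC : ∀ᵐ p ∂m, |u p| ≤ C) (hd : 0 < d) (h : ∀ᵐ p ∂m, u p ≤ d) : ∀ᵐ p ∂m, T u p ≤ d := by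
  have e : u = Lp.posPart u - Lp.negPart u := by
    refine Lp.ext ?_
    filter_upwards [Lp.coeFn_posPart u, Lp.coeFn_negPart u,
      Lp.coeFn_sub (Lp.posPart u) (Lp.negPart u)] with p h1 h2 h3
    rw [h3, Pi.sub_apply, h1, h2, sub_neg_eq_add, max_add_min, add_zero]
  have h1 := hT.le_of_nonneg (u := Lp.posPart u) hd (by
    filter_upwards [Lp.coeFn_posPart u, h] with p h1 h2
    rw [h1]
    exact ⟨le_max_right _ _, max_le h2 hd.le⟩)
  have h2 := hT.le_of_nonneg (u := Lp.negPart u) (d := max C 1) (by positivity) (by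
    filter_upwards [Lp.coeFn_negPart_eq_max u, hC] with p h1 h2
    rw [h1]
    exact ⟨le_max_right _ _, max_le ((neg_le_abs _).trans (h2.trans (le_max_left _ _)))
      (by positivity)⟩)
  rw [e, map_sub]
  filter_upwards [h1, h2, Lp.coeFn_sub (T (Lp.posPart u)) (T (Lp.negPart u))] with p h3 h4 h5
  rw [h5, Pi.sub_apply]
  linarith [h3.2, h4.1]

theorem IsSubMarkov.le (hT : IsSubMarkov T) {u : Lp ℝ 2 m} {C d : ℝ}
    (hC : ∀ᵐ p ∂m, |u p| ≤ C) (hd : 0 ≤ d) (h : ∀ᵐ p ∂m, u p ≤ d) : ∀ᵐ p ∂m, T u p ≤ d := by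
  have h1 : ∀ n : ℕ, ∀ᵐ p ∂m, T u p ≤ d + 1 / ((n : ℝ) + 1) := fun n =>
    hT.le_of_pos hC (by positivity) (h.mono fun p hp => hp.trans (by simp; positivity))
  filter_upwards [ae_all_iff.mpr h1] with p hp
  have := (tendsto_one_div_add_atTop_nhds_zero_nat (𝕜 := ℝ)).const_add d
  rw [add_zero] at this
  exact ge_of_tendsto' this hp

/-- By symmetry the left side is `(T 1_K, v)`, and `T 1_K ≤ 1`. This replaces the extension of `T`
to a contraction of `L¹`. -/
theorem IsSubMarkov.setIntegral_le (hT : IsSubMarkov T) (hs : ∀ u v, (inner ℝ (T u) v : ℝ) = inner ℝ u (T v))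
    {v : Lp ℝ 2 m} (hv : 0 ≤ᵐ[m] v) (hvi : Integrable v m) {K : Set X} (hK : MeasurableSet K)
    (hKf : m K ≠ ⊤) : ∫ p in K, T v p ∂m ≤ ∫ p, v p ∂m := by
  rw [← L2.inner_indicatorConstLp_one (𝕜 := ℝ) hK hKf, ← hs, L2.inner_def]
  have h1 := hT (indicatorConstLp 2 hK hKf 1) (by
    filter_upwards [indicatorConstLp_coeFn (p := 2) (hs := hK) (hμs := hKf) (c := (1 : ℝ))] with p hp
    rw [hp]
    by_cases h : p ∈ K <;> simp [h])
  refine integral_mono_ae (L2.integrable_inner (𝕜 := ℝ) _ _) hvi ?_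
  filter_upwards [h1, hv] with p h2 h3
  simp only [RCLike.inner_apply, conj_trivial]
  exact mul_le_of_le_one_right h3 h2.2

end SubMarkov

section TestAlgebra

variable {α : ℝ}

instance : Mul testFn := ⟨fun f g => ⟨fun p => f.1 p * g.1 p, (testFn.isSmooth f.2).mul_mem g.2⟩⟩

theorem testFn.mul_apply (f g : testFn) (p : Cyl) : (f * g).1 p = f.1 p * g.1 p := rfl

theorem testFn.abs_toL2_le (f : testFn) : ∃ C, ∀ᵐ p ∂(vol α), |toL2 α f p| ≤ C := by
  obtain ⟨C, hC⟩ := f.2.2.1.exists_bound_of_continuous (testFn.continuous f.2)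
  refine ⟨C, ?_⟩
  filter_upwards [toL2_coeFn α f] with p hp
  rw [hp]
  exact hC p

theorem testFn.memLp_top (α : ℝ) (f : testFn) : MemLp f.1 ⊤ (vol α) := by
  obtain ⟨C, hC⟩ := f.2.2.1.exists_bound_of_continuous (testFn.continuous f.2)
  exact memLp_top_of_bound (testFn.continuous f.2).aestronglyMeasurable C (Eventually.of_forall hC)

/-- Multiplication by a test function on `L²`. -/
def mulCLM (α : ℝ) (f : testFn) : L2 α →L[ℝ] L2 α :=
  (ContinuousLinearMap.mul ℝ ℝ).holderL (vol α) ⊤ 2 2 ((testFn.memLp_top α f).toLp f.1)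

theorem mulCLM_coeFn (f : testFn) (u : L2 α) : mulCLM α f u =ᵐ[vol α] fun p => f.1 p * u p := by
  have h := ContinuousLinearMap.coeFn_holder (r := 2) (ContinuousLinearMap.mul ℝ ℝ)
    ((testFn.memLp_top α f).toLp f.1) u
  filter_upwards [h, (testFn.memLp_top α f).coeFn_toLp] with p h1 h2
  refine h1.trans ?_
  rw [h2]
  rfl

theorem inner_mulCLM (f g : testFn) (u : L2 α) :
    (inner ℝ (mulCLM α f u) (toL2 α g) : ℝ) = inner ℝ u (toL2 α (f * g)) := by
  rw [inner_toL2, inner_toL2]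
  refine integral_congr_ae ?_
  filter_upwards [mulCLM_coeFn f u] with p hp
  rw [hp, testFn.mul_apply]
  ring

theorem inner_toL2_congr {f g f' g' : testFn} (h : ∀ p, f.1 p * g.1 p = f'.1 p * g'.1 p) :
    (inner ℝ (toL2 α f) (toL2 α g) : ℝ) = inner ℝ (toL2 α f') (toL2 α g') := by
  simp only [inner_toL2_toL2, h]

theorem mulCLM_toL2 (f g : testFn) : mulCLM α f (toL2 α g) = toL2 α (f * g) := by
  refine Lp.ext ?_
  filter_upwards [mulCLM_coeFn f (toL2 α g), toL2_coeFn α g, toL2_coeFn α (f * g)] with p h1 h2 h3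
  rw [h1, h2, h3, testFn.mul_apply]

end TestAlgebra

section CarreDuChamp

variable {α : ℝ} {T : L2 α →L[ℝ] L2 α}

/-- With `w = u - rψ`, the inequality `2cw - w² ≤ c²` is a constant upper bound, hence is preserved
by `T`. The null set must not depend on `r` and `c`, which later become functions of the point. -/
theorem IsSubMarkov.ae_quadratic (hT : IsSubMarkov T) (u ψ : testFn) :
    ∀ᵐ p ∂(vol α), ∀ r c : ℝ, 2 * c * (T (toL2 α u) p - r * T (toL2 α ψ) p) -
      (T (toL2 α (u * u)) p - 2 * r * T (toL2 α (u * ψ)) p + r ^ 2 * T (toL2 α (ψ * ψ)) p) ≤ c ^ 2 := by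
  have key : ∀ r c : ℝ, ∀ᵐ p ∂(vol α), 2 * c * (T (toL2 α u) p - r * T (toL2 α ψ) p) -
      (T (toL2 α (u * u)) p - 2 * r * T (toL2 α (u * ψ)) p + r ^ 2 * T (toL2 α (ψ * ψ)) p) ≤
        c ^ 2 := by
    intro r c
    set w : testFn := (2 * c) • u - (2 * c * r) • ψ - u * u + (2 * r) • (u * ψ) - (r ^ 2) • (ψ * ψ)
      with hw
    obtain ⟨C, hC⟩ := testFn.abs_toL2_le (α := α) w
    have h1 := hT.le hC (sq_nonneg c) (by
      filter_upwards [toL2_coeFn α w] with p hp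
      have e : w.1 p = 2 * c * u.1 p - 2 * c * r * ψ.1 p - u.1 p * u.1 p +
        2 * r * (u.1 p * ψ.1 p) - r ^ 2 * (ψ.1 p * ψ.1 p) := rfl
      rw [hp, e]
      nlinarith [sq_nonneg (c - (u.1 p - r * ψ.1 p))])
    have e : T (toL2 α w) = (2 * c) • T (toL2 α u) - (2 * c * r) • T (toL2 α ψ) -
        T (toL2 α (u * u)) + (2 * r) • T (toL2 α (u * ψ)) - (r ^ 2) • T (toL2 α (ψ * ψ)) := by
      simp only [hw, map_sub, map_add, map_smul]
    rw [e] at h1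
    filter_upwards [h1,
      Lp.coeFn_sub ((2 * c) • T (toL2 α u) - (2 * c * r) • T (toL2 α ψ) - T (toL2 α (u * u)) +
        (2 * r) • T (toL2 α (u * ψ))) ((r ^ 2) • T (toL2 α (ψ * ψ))),
      Lp.coeFn_add ((2 * c) • T (toL2 α u) - (2 * c * r) • T (toL2 α ψ) - T (toL2 α (u * u)))
        ((2 * r) • T (toL2 α (u * ψ))),
      Lp.coeFn_sub ((2 * c) • T (toL2 α u) - (2 * c * r) • T (toL2 α ψ)) (T (toL2 α (u * u))),
      Lp.coeFn_sub ((2 * c) • T (toL2 α u)) ((2 * c * r) • T (toL2 α ψ)),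
      Lp.coeFn_smul (2 * c) (T (toL2 α u)), Lp.coeFn_smul (2 * c * r) (T (toL2 α ψ)),
      Lp.coeFn_smul (2 * r) (T (toL2 α (u * ψ))), Lp.coeFn_smul (r ^ 2) (T (toL2 α (ψ * ψ)))]
      with p h1 h2 h3 h4 h5 h6 h7 h8 h9
    rw [h2, Pi.sub_apply, h3, Pi.add_apply, h4, Pi.sub_apply, h5, Pi.sub_apply, h6, h7, h8, h9] at h1
    simp only [Pi.smul_apply, smul_eq_mul] at h1
    linarith
  -- A single null set serves all rational `r`, `c`; the real ones follow by continuity.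
  have h2 : ∀ᵐ p ∂(vol α), ∀ q : ℚ × ℚ, 2 * (q.2 : ℝ) * (T (toL2 α u) p - q.1 * T (toL2 α ψ) p) -
      (T (toL2 α (u * u)) p - 2 * q.1 * T (toL2 α (u * ψ)) p +
        (q.1 : ℝ) ^ 2 * T (toL2 α (ψ * ψ)) p) ≤ (q.2 : ℝ) ^ 2 :=
    ae_all_iff.mpr fun q => key q.1 q.2
  filter_upwards [h2] with p hp r c
  have hd : DenseRange (Prod.map ((↑) : ℚ → ℝ) ((↑) : ℚ → ℝ)) :=
    Rat.denseRange_cast.prodMap Rat.denseRange_cast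
  refine hd.induction_on (p := fun q : ℝ × ℝ => 2 * q.2 * (T (toL2 α u) p - q.1 * T (toL2 α ψ) p) -
      (T (toL2 α (u * u)) p - 2 * q.1 * T (toL2 α (u * ψ)) p +
        q.1 ^ 2 * T (toL2 α (ψ * ψ)) p) ≤ q.2 ^ 2) (r, c) ?_ hp
  exact isClosed_le (by fun_prop) (by fun_prop)

instance sigmaFinite_vol (α : ℝ) : SigmaFinite (vol α) := by
  unfold vol
  exact SigmaFinite.withDensity_ofReal _

/-- Insert `r = φ(p)` and `c = u(p) - φ(p)ψ(p)` in the pointwise inequality and integrate, with `∫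
T(u²) ≤ ∫ u²`. If `T` had a kernel, this would express non-negativity of the double integral of
`((u(p) - u(q)) - φ(p)(ψ(p) - ψ(q)))²` plus a killing term. -/
theorem IsSubMarkov.integral_nonneg (hT : IsSubMarkov T)
    (hs : ∀ u v, (inner ℝ (T u) v : ℝ) = inner ℝ u (T v)) (u φ ψ : testFn) :
    0 ≤ (inner ℝ (toL2 α (u - φ * ψ)) (toL2 α (u - φ * ψ)) : ℝ)
      - 2 * inner ℝ (T (toL2 α u)) (toL2 α (u - φ * ψ))
      + 2 * inner ℝ (T (toL2 α ψ)) (toL2 α ((u - φ * ψ) * φ))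
      - 2 * inner ℝ (T (toL2 α (u * ψ))) (toL2 α φ)
      + inner ℝ (T (toL2 α (ψ * ψ))) (toL2 α (φ * φ)) + inner ℝ (toL2 α u) (toL2 α u) := by
  set c : testFn := u - φ * ψ with hc
  set F : Cyl → ℝ := fun p => c.1 p * c.1 p - 2 * (T (toL2 α u) p * c.1 p) +
    2 * (T (toL2 α ψ) p * (c * φ).1 p) - 2 * (T (toL2 α (u * ψ)) p * φ.1 p) +
    T (toL2 α (ψ * ψ)) p * (φ * φ).1 p with hF
  have i1 : Integrable (fun p => c.1 p * c.1 p) (vol α) := testFn.integrable_vol α (c * c).2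
  have i2 := (integrable_mul_test (T (toL2 α u)) c.2).const_mul 2
  have i3 := (integrable_mul_test (T (toL2 α ψ)) (c * φ).2).const_mul 2
  have i4 := (integrable_mul_test (T (toL2 α (u * ψ))) φ.2).const_mul 2
  have i5 := integrable_mul_test (T (toL2 α (ψ * ψ))) (φ * φ).2
  have iF : Integrable F (vol α) := (((i1.sub i2).add i3).sub i4).add i5
  have eF : ∫ p, F p ∂(vol α) = (inner ℝ (toL2 α c) (toL2 α c) : ℝ)
      - 2 * inner ℝ (T (toL2 α u)) (toL2 α c) + 2 * inner ℝ (T (toL2 α ψ)) (toL2 α (c * φ))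
      - 2 * inner ℝ (T (toL2 α (u * ψ))) (toL2 α φ)
      + inner ℝ (T (toL2 α (ψ * ψ))) (toL2 α (φ * φ)) := by
    rw [inner_toL2_toL2, inner_toL2, inner_toL2, inner_toL2, inner_toL2, ← integral_const_mul,
      ← integral_const_mul, ← integral_const_mul]
    refine (integral_add (((i1.sub i2).add i3).sub i4) i5).trans (congrArg (· + _) ?_)
    refine (integral_sub ((i1.sub i2).add i3) i4).trans (congrArg (· - _) ?_)
    exact (integral_add (i1.sub i2) i3).trans (congrArg (· + _) (integral_sub i1 i2))
  have hnn : ∀ᵐ p ∂(vol α), 0 ≤ F p + T (toL2 α (u * u)) p := by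
    filter_upwards [hT.ae_quadratic u ψ] with p hp
    have h1 := hp (φ.1 p) (c.1 p)
    simp only [hF, testFn.mul_apply]
    linarith
  have e : ∀ᵐ p ∂(vol α), toL2 α (u * u) p = u.1 p * u.1 p := toL2_coeFn α (u * u)
  have hu : ∫ p, toL2 α (u * u) p ∂(vol α) = inner ℝ (toL2 α u) (toL2 α u) := by
    rw [inner_toL2_toL2]
    exact integral_congr_ae e
  -- `T(u²)` is known only to be in `L²`, so integration is over sets of finite measure that exhaust
  -- the space.
  have hK : ∀ n, -(inner ℝ (toL2 α u) (toL2 α u) : ℝ) ≤ ∫ p in spanningSets (vol α) n, F p ∂(vol α) := by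
    intro n
    have hKf : vol α (spanningSets (vol α) n) ≠ ⊤ := (measure_spanningSets_lt_top _ n).ne
    have h1 := hT.setIntegral_le hs (v := toL2 α (u * u))
      (by filter_upwards [e] with p hp; rw [hp]; exact mul_self_nonneg _)
      ((testFn.integrable_vol α (u * u).2).congr (toL2_coeFn α (u * u)).symm)
      (measurableSet_spanningSets _ n) hKf
    have h2 : 0 ≤ ∫ p in spanningSets (vol α) n, (F p + T (toL2 α (u * u)) p) ∂(vol α) :=
      setIntegral_nonneg_of_ae (hnn.mono fun p hp => hp)
    rw [integral_add iF.integrableOn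
      (integrableOn_Lp_of_measure_ne_top _ fact_one_le_two_ennreal.elim hKf)] at h2
    linarith
  have ht := tendsto_setIntegral_of_monotone (μ := vol α) (f := F)
    (measurableSet_spanningSets (vol α)) (monotone_spanningSets (vol α))
    (iF.integrableOn)
  rw [iUnion_spanningSets, setIntegral_univ] at ht
  have := ge_of_tendsto' ht hK
  linarith

/-- The main inequality for Markovian operators. -/
theorem IsSubMarkov.inner_nonneg (hT : IsSubMarkov T)
    (hs : ∀ u v, (inner ℝ (T u) v : ℝ) = inner ℝ u (T v)) (φ ψ : testFn) (u : L2 α) :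
    0 ≤ -2 * (inner ℝ (T u - u) u : ℝ) + 2 * inner ℝ (T u - u) (toL2 α (φ * ψ))
      + 2 * inner ℝ (mulCLM α φ (T (toL2 α ψ) - toL2 α ψ)) u
      - 2 * inner ℝ (T (toL2 α ψ) - toL2 α ψ) (toL2 α (φ * (φ * ψ)))
      - 2 * inner ℝ (mulCLM α ψ (T (toL2 α φ) - toL2 α φ)) u
      + inner ℝ (T (toL2 α (ψ * ψ)) - toL2 α (ψ * ψ)) (toL2 α (φ * φ)) := by
  -- The terms quadratic in `u` other than `(Tu - u, u)` have disappeared and products with `u` are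
  -- written through `mulCLM`, so everything is continuous in `u ∈ L²` and test functions suffice.
  refine (dense_range_toL2 α).induction (P := fun u => 0 ≤ -2 * (inner ℝ (T u - u) u : ℝ) +
      2 * inner ℝ (T u - u) (toL2 α (φ * ψ))
      + 2 * inner ℝ (mulCLM α φ (T (toL2 α ψ) - toL2 α ψ)) u
      - 2 * inner ℝ (T (toL2 α ψ) - toL2 α ψ) (toL2 α (φ * (φ * ψ)))
      - 2 * inner ℝ (mulCLM α ψ (T (toL2 α φ) - toL2 α φ)) u
      + inner ℝ (T (toL2 α (ψ * ψ)) - toL2 α (ψ * ψ)) (toL2 α (φ * φ))) ?_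
    (isClosed_le (by fun_prop) (by fun_prop)) u
  rintro _ ⟨u, rfl⟩
  -- This expression vanishes when `T` is the identity, so it can be rewritten through `T - 1`,
  -- which is what allows division by `t` later.
  have h := hT.integral_nonneg hs u φ ψ
  have m1 : (u - φ * ψ) * φ = φ * u - φ * (φ * ψ) :=
    Subtype.ext (funext fun p => show (u.1 p - φ.1 p * ψ.1 p) * φ.1 p =
      φ.1 p * u.1 p - φ.1 p * (φ.1 p * ψ.1 p) by ring)
  have m2 : u * ψ = ψ * u := Subtype.ext (funext fun p => mul_comm _ _)
  have e1 : (inner ℝ (T (toL2 α (ψ * u))) (toL2 α φ) : ℝ) = inner ℝ (T (toL2 α φ)) (toL2 α (ψ * u)) := by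
    rw [hs, real_inner_comm]
  have a1 : (inner ℝ (toL2 α (φ * ψ)) (toL2 α u) : ℝ) = inner ℝ (toL2 α u) (toL2 α (φ * ψ)) :=
    real_inner_comm _ _
  have a2 : (inner ℝ (toL2 α ψ) (toL2 α (φ * u)) : ℝ) = inner ℝ (toL2 α u) (toL2 α (φ * ψ)) :=
    inner_toL2_congr fun p => by simp only [testFn.mul_apply]; ring
  have a3 : (inner ℝ (toL2 α ψ) (toL2 α (φ * (φ * ψ))) : ℝ) =
      inner ℝ (toL2 α (φ * ψ)) (toL2 α (φ * ψ)) :=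
    inner_toL2_congr fun p => by simp only [testFn.mul_apply]; ring
  have a4 : (inner ℝ (toL2 α φ) (toL2 α (ψ * u)) : ℝ) = inner ℝ (toL2 α u) (toL2 α (φ * ψ)) :=
    inner_toL2_congr fun p => by simp only [testFn.mul_apply]; ring
  have a5 : (inner ℝ (toL2 α (ψ * ψ)) (toL2 α (φ * φ)) : ℝ) =
      inner ℝ (toL2 α (φ * ψ)) (toL2 α (φ * ψ)) :=
    inner_toL2_congr fun p => by simp only [testFn.mul_apply]; ring
  rw [m1, m2, e1] at h
  simp only [map_sub, inner_sub_left, inner_sub_right, inner_mulCLM] at h ⊢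
  rw [a1] at h
  rw [a2, a3, a4, a5]
  linarith

end CarreDuChamp

end

/-! ### The energy inequality of a Markovian extension -/

section

variable {α : ℝ}

section EnergyInequality

theorem laplace_mul (α : ℝ) (f g : testFn) {p : Cyl} (hp : p.1 ≠ 0) :
    (laplace α (f * g)).1 p = f.1 p * (laplace α g).1 p + g.1 p * (laplace α f).1 p +
      2 * (dx f.1 p * dx g.1 p + |p.1| ^ (2 * α) * (dtheta f.1 p * dtheta g.1 p)) := by
  have hf := testFn.isSmooth f.2
  have hg := testFn.isSmooth g.2
  have e1 : dxL (f * g) = dxL f * g + f * dxL g := testFn.ext_of_ne fun p hp => dx_mul hf hg hp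
  have e2 : dthetaL (f * g) = dthetaL f * g + f * dthetaL g :=
    testFn.ext_of_ne fun p hp => dtheta_mul hf hg hp
  have a1 : dx (f * g).1 p = dx f.1 p * g.1 p + f.1 p * dx g.1 p := dx_mul hf hg hp
  have a2 : dx (dx (f * g).1) p = f.1 p * dx (dx g.1) p + dx f.1 p * dx g.1 p +
      (dx f.1 p * dx g.1 p + dx (dx f.1) p * g.1 p) := by
    have : dx (f * g).1 = fun p => dx f.1 p * g.1 p + f.1 p * dx g.1 p := congrArg Subtype.val e1
    rw [this, dx_add (hf.dx.mul hg) (hf.mul hg.dx) hp, dx_mul hf hg.dx hp, dx_mul hf.dx hg hp]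
    ring
  have a3 : dtheta (dtheta (f * g).1) p = f.1 p * dtheta (dtheta g.1) p +
      dtheta f.1 p * dtheta g.1 p + (dtheta f.1 p * dtheta g.1 p + dtheta (dtheta f.1) p * g.1 p) := by
    have : dtheta (f * g).1 = fun p => dtheta f.1 p * g.1 p + f.1 p * dtheta g.1 p :=
      congrArg Subtype.val e2
    rw [this, dtheta_add (hf.dtheta.mul hg) (hf.mul hg.dtheta) hp, dtheta_mul hf hg.dtheta hp,
      dtheta_mul hf.dtheta hg hp]
    ring
  rw [laplace_apply, laplace_apply, laplace_apply, a1, a2, a3]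
  ring

/-- Divide the inequality for `T_t` by `t` and let `t → 0`. The functions `φ`, `ψ`, `ψ²` are test
functions, on which `A` is `Δ`. -/
theorem markovian_inner_nonneg {A : L2 α →ₗ.[ℝ] L2 α} (hA : A ∈ markovianExtensions α) {u v : L2 α}
    (h : (u, v) ∈ A.graph) (φ ψ : testFn) :
    0 ≤ -2 * (inner ℝ v u : ℝ) + 2 * inner ℝ v (toL2 α (φ * ψ))
      + 2 * inner ℝ (mulCLM α φ (toL2 α (laplace α ψ))) u
      - 2 * inner ℝ (toL2 α (laplace α ψ)) (toL2 α (φ * (φ * ψ)))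
      - 2 * inner ℝ (mulCLM α ψ (toL2 α (laplace α φ))) u
      + inner ℝ (toL2 α (laplace α (ψ * ψ))) (toL2 α (φ * φ)) := by
  obtain ⟨hext, hsa, hneg, T, hT, hgen, hM⟩ := hA
  have hs := inner_symm_of_generator hT hgen hneg hsa
  have hlap := laplacian_le_iff.mp hext
  have t1 := (hgen _ _).mp h
  have t2 := (hgen _ _).mp (hlap ψ)
  have t3 := (hgen _ _).mp (hlap φ)
  have t4 := (hgen _ _).mp (hlap (ψ * ψ))
  have t5 := (((mulCLM α φ).continuous.tendsto _).comp t2).inner (𝕜 := ℝ) (tendsto_const_nhds (x := u))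
  have t6 := (((mulCLM α ψ).continuous.tendsto _).comp t3).inner (𝕜 := ℝ) (tendsto_const_nhds (x := u))
  have t7 := t1.inner (𝕜 := ℝ) (tendsto_const_nhds (x := u))
  have t8 := t1.inner (𝕜 := ℝ) (tendsto_const_nhds (x := toL2 α (φ * ψ)))
  have t9 := t2.inner (𝕜 := ℝ) (tendsto_const_nhds (x := toL2 α (φ * (φ * ψ))))
  have t10 := t4.inner (𝕜 := ℝ) (tendsto_const_nhds (x := toL2 α (φ * φ)))
  refine ge_of_tendsto ((((((t7.const_mul (-2)).add (t8.const_mul 2)).add (t5.const_mul 2)).sub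
    (t9.const_mul 2)).sub (t6.const_mul 2)).add t10) ?_
  filter_upwards [self_mem_nhdsWithin] with t ht
  have ht' : 0 < (t : ℝ) := ht
  have hsub : IsSubMarkov (T t) := fun w hw => hM w hw t ht
  have h1 := mul_nonneg (inv_nonneg.mpr ht'.le) (hsub.inner_nonneg (hs t) φ ψ u)
  simp only [Function.comp, map_smul, real_inner_smul_left]
  linarith

/-- The energy inequality of a Markovian extension. -/
theorem markovian_energy {A : L2 α →ₗ.[ℝ] L2 α} (hA : A ∈ markovianExtensions α) {u v : L2 α}
    (h : (u, v) ∈ A.graph) (φ ψ k e : testFn)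
    (hk : ∀ p : Cyl, p.1 ≠ 0 → k.1 p = φ.1 p * (laplace α ψ).1 p +
      (dx φ.1 p * dx ψ.1 p + |p.1| ^ (2 * α) * (dtheta φ.1 p * dtheta ψ.1 p)))
    (he : ∀ p : Cyl, p.1 ≠ 0 → e.1 p * e.1 p = φ.1 p * φ.1 p *
      (dx ψ.1 p * dx ψ.1 p + |p.1| ^ (2 * α) * (dtheta ψ.1 p * dtheta ψ.1 p))) :
    0 ≤ -(inner ℝ v u : ℝ) + 2 * inner ℝ u (toL2 α k) + ‖toL2 α e‖ ^ 2 := by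
  have h1 := markovian_inner_nonneg hA h φ ψ
  have hadj := mem_adjoint_graph_iff.mp (graph_le_adjoint_graph hA.2.selfAdjoint hA.1 h) (φ * ψ)
  -- Here `k = div(φ∇ψ)`, and `2 div(φ∇ψ) = Δ(φψ) + φΔψ - ψΔφ`. The term in `Δ(φψ)` is moved onto
  -- `v` by `A ⊆ Δ*`.
  have e1 : (2 : ℝ) • k = laplace α (φ * ψ) + φ * laplace α ψ - ψ * laplace α φ := by
    refine testFn.ext_of_ne fun p hp => ?_
    change 2 * k.1 p = (laplace α (φ * ψ)).1 p + φ.1 p * (laplace α ψ).1 p - ψ.1 p * (laplace α φ).1 p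
    rw [laplace_mul α φ ψ hp, hk p hp]
    ring
  have e2 : 2 * (inner ℝ u (toL2 α k) : ℝ) = inner ℝ v (toL2 α (φ * ψ)) +
      inner ℝ (mulCLM α φ (toL2 α (laplace α ψ))) u - inner ℝ (mulCLM α ψ (toL2 α (laplace α φ))) u := by
    rw [← real_inner_smul_right, ← map_smul, e1, map_sub, map_add, inner_sub_right, inner_add_right,
      hadj, mulCLM_toL2, mulCLM_toL2, real_inner_comm u, real_inner_comm u]
  -- Here `e² = φ²|∇ψ|²`, and `2|∇ψ|² = Δ(ψ²) - 2ψΔψ`.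
  have e3 : 2 * ‖toL2 α e‖ ^ 2 = inner ℝ (toL2 α (laplace α (ψ * ψ))) (toL2 α (φ * φ)) -
      2 * (inner ℝ (toL2 α (laplace α ψ)) (toL2 α (φ * (φ * ψ))) : ℝ) := by
    rw [← real_inner_self_eq_norm_sq, ← real_inner_smul_left, ← map_smul, ← real_inner_smul_left,
      ← map_smul, inner_toL2_toL2, inner_toL2_toL2, inner_toL2_toL2]
    refine Eq.trans (integral_congr_ae ?_)
      (integral_sub (testFn.integrable_vol α (laplace α (ψ * ψ) * (φ * φ)).2)
        (testFn.integrable_vol α (((2 : ℝ) • laplace α ψ) * (φ * (φ * ψ))).2))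
    filter_upwards [ae_vol_fst_ne α] with p hp
    have c1 : ((2 : ℝ) • e).1 p = 2 * e.1 p := rfl
    have c2 : ((2 : ℝ) • laplace α ψ).1 p = 2 * (laplace α ψ).1 p := rfl
    simp only [testFn.mul_apply]
    rw [laplace_mul α ψ ψ hp, c1, c2]
    linear_combination 2 * he p hp
  linarith

end EnergyInequality

end

/-! ### Markovian extensions have square integrable weak gradients -/

section

variable {α : ℝ}

section Localization

theorem dx_congr {f g : Cyl → ℝ} {p : Cyl} (h : f =ᶠ[𝓝 p] g) : dx f p = dx g p := by
  have hc : Tendsto (fun s : ℝ => (s, p.2)) (𝓝 p.1) (𝓝 p) := (Continuous.prodMk_left p.2).tendsto p.1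
  have e : (fun s : ℝ => f (s, p.2)) =ᶠ[𝓝 p.1] fun s => g (s, p.2) := hc.eventually h
  exact e.deriv_eq

theorem dtheta_congr {f g : Cyl → ℝ} {p : Cyl} (h : f =ᶠ[𝓝 p] g) : dtheta f p = dtheta g p := by
  have hc : Tendsto (fun t : ℝ => (p.1, p.2 + (t : Torus))) (𝓝 0) (𝓝 p) := by
    have : Continuous (fun t : ℝ => (p.1, p.2 + (t : Torus))) :=
      continuous_const.prodMk (continuous_const.add (AddCircle.continuous_mk' _))
    simpa using this.tendsto 0
  have e : (fun t : ℝ => f (p.1, p.2 + (t : Torus))) =ᶠ[𝓝 0]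
    fun t => g (p.1, p.2 + (t : Torus)) := hc.eventually h
  exact e.deriv_eq

theorem dx_dx_congr {f g : Cyl → ℝ} {p : Cyl} (h : f =ᶠ[𝓝 p] g) : dx (dx f) p = dx (dx g) p :=
  dx_congr (h.eventuallyEq_nhds.mono fun _ => dx_congr)

theorem dtheta_dtheta_congr {f g : Cyl → ℝ} {p : Cyl} (h : f =ᶠ[𝓝 p] g) :
    dtheta (dtheta f) p = dtheta (dtheta g) p :=
  dtheta_congr (h.eventuallyEq_nhds.mono fun _ => dtheta_congr)

/-- A smooth function on `M` agrees near the support of a test function with a test function. -/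
theorem exists_localization (h : testFn) {F : Cyl → ℝ} (hF : IsSmooth F) :
    ∃ ψ : testFn, ∀ p, ψ.1 =ᶠ[𝓝 p] F ∨ h.1 =ᶠ[𝓝 p] fun _ => 0 := by
  obtain ⟨⟨ε, hε, h1⟩, R, h2⟩ := testFn.exists_bounds h.2
  set S : ℝ := max R 0 + 1 with hS
  have hS0 : 0 < S := by positivity
  have hRS : R < S := by rw [hS]; linarith [le_max_left R 0]
  -- The first factor is `1` for `|x| ≤ S`, the second is `1` for `|x| ≥ ε/2` and `0` for `|x| ≤
  -- ε/4`. So `χ = 1` on a neighbourhood of the support of `h`.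
  set χ : ℝ → ℝ := fun x => cutoff (x / S) * (1 - cutoff (4 * x / ε)) with hχ
  have hχs : ContDiff ℝ ∞ χ := (contDiff_cutoff.comp (contDiff_id.div_const S)).mul
    (contDiff_const.sub (contDiff_cutoff.comp ((contDiff_const.mul contDiff_id).div_const ε)))
  have e1 : ∀ x : ℝ, |x / S| = |x| / S := fun x => by rw [abs_div, abs_of_pos hS0]
  have e2 : ∀ x : ℝ, |4 * x / ε| = 4 * |x| / ε := fun x => by
    rw [abs_div, abs_of_pos hε, abs_mul]; norm_num
  have hmem : (fun p : Cyl => χ p.1 * F p) ∈ testFn := by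
    refine testFn.of_bounds (ε := ε / 4) (R := 2 * S) ((IsSmooth.of_fst fun _ _ =>
      hχs.contDiffAt).mul hF) (by positivity) (fun p hp => ?_) fun p hp => ?_
    · have : cutoff (4 * p.1 / ε) = 1 := cutoff_eq_one (by
        rw [e2, div_le_one hε]; linarith)
      simp [hχ, this]
    · have : cutoff (p.1 / S) = 0 := cutoff_eq_zero (by
        rw [e1, le_div_iff₀ hS0]; linarith)
      simp [hχ, this]
  refine ⟨⟨_, hmem⟩, fun p => ?_⟩
  by_cases hp : ε / 2 < |p.1| ∧ |p.1| < S
  · left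
    have a1 : ∀ᶠ q : Cyl in 𝓝 p, ε / 2 < |q.1| :=
      continuousAt_const.eventually_lt continuous_fst.abs.continuousAt hp.1
    have a2 : ∀ᶠ q : Cyl in 𝓝 p, |q.1| < S :=
      continuous_fst.abs.continuousAt.eventually_lt continuousAt_const hp.2
    filter_upwards [a1, a2] with q b1 b2
    have c1 : cutoff (4 * q.1 / ε) = 0 := cutoff_eq_zero (by
      rw [e2, le_div_iff₀ hε]; linarith)
    have c2 : cutoff (q.1 / S) = 1 := cutoff_eq_one (by
      rw [e1, div_le_one hS0]; linarith)
    simp [hχ, c1, c2]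
  · right
    rw [not_and_or, not_lt, not_lt] at hp
    rcases hp with hp | hp
    · have a1 : ∀ᶠ q : Cyl in 𝓝 p, |q.1| < ε :=
        continuous_fst.abs.continuousAt.eventually_lt continuousAt_const (by linarith)
      filter_upwards [a1] with q hq using h1 q hq
    · have a1 : ∀ᶠ q : Cyl in 𝓝 p, R < |q.1| :=
        continuousAt_const.eventually_lt continuous_fst.abs.continuousAt (by linarith)
      filter_upwards [a1] with q hq using h2 q hq

end Localization

section WeakGradient

/-- The energy inequality for the field `f∂ₓ = φ∇ψ`, with `φ = f` and `ψ = x` near the support of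
`f`; its divergence is `∂ₓf - (α/x) f`. -/
theorem markovian_energy_dx {A : L2 α →ₗ.[ℝ] L2 α} (hA : A ∈ markovianExtensions α) {u v : L2 α}
    (h : (u, v) ∈ A.graph) (f : testFn) :
    0 ≤ -(inner ℝ v u : ℝ) + 2 * inner ℝ u (toL2 α (-dxAdj α f)) + ‖toL2 α f‖ ^ 2 := by
  obtain ⟨ψ, hψ⟩ := exists_localization f (F := fun p => p.1) (IsSmooth.of_fst fun _ _ => contDiffAt_id)
  have d1 : ∀ p, dx (fun q : Cyl => q.1) p = 1 := fun p => by
    rw [dx_fst (fun x => x)]; simp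
  have d2 : dx (fun q : Cyl => q.1) = fun _ => 1 := funext d1
  have d3 : ∀ p, dtheta (fun q : Cyl => q.1) p = 0 := fun p => dtheta_fst (fun x => x)
  have d4 : dtheta (fun q : Cyl => q.1) = fun _ => 0 := funext d3
  refine markovian_energy hA h f ψ (-dxAdj α f) f (fun p hp => ?_) fun p hp => ?_
  · change -(dxAdj α f).1 p = _
    rw [laplace_apply, dxAdj_apply]
    rcases hψ p with h1 | h1
    · rw [dx_dx_congr h1, dtheta_dtheta_congr h1, dx_congr h1, dtheta_congr h1, d1, d3, d2, d4]
      simp only [dx, dtheta, deriv_const]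
      ring
    · rw [h1.self_of_nhds, dx_congr h1, dtheta_congr h1]
      simp only [dx, dtheta, deriv_const]
      ring
  · rcases hψ p with h1 | h1
    · rw [dx_congr h1, dtheta_congr h1, d1, d3]
      ring
    · rw [h1.self_of_nhds]
      ring

/-- The angle is not a function on the circle, so `ψ` is `cos θ` or `sin θ`, and `φ = σ|x|^{-α} ψ*
f` with `ψ*` the other harmonic and `σ` the sign in `∂_θψ = σψ*`. In the orthonormal frame `φ∇ψ` is
`(ψ*)² f` times the angular unit field, and the two choices add up to `f` times that field. -/
theorem markovian_energy_harmonic {A : L2 α →ₗ.[ℝ] L2 α} (hA : A ∈ markovianExtensions α) {u v : L2 α}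
    (h : (u, v) ∈ A.graph) (f : testFn) (b : Bool) : ∃ k : testFn,
    (∀ p : Cyl, p.1 ≠ 0 → k.1 p = harmonic 1 (!b) p.2 ^ 2 * (gradTheta α f).1 p -
      2 * (if b then -1 else 1) * |p.1| ^ α * harmonic 1 b p.2 * harmonic 1 (!b) p.2 * f.1 p) ∧
    0 ≤ -(inner ℝ v u : ℝ) + 2 * inner ℝ u (toL2 α k) + ‖toL2 α f‖ ^ 2 := by
  obtain ⟨ψ, hψ⟩ := exists_localization f (isSmooth_harmonic 1 b)
  set σ : ℝ := if b then -1 else 1 with hσ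
  have hσ2 : σ * σ = 1 := by rw [hσ]; split_ifs <;> norm_num
  have dH : ∀ p : Cyl, p.1 ≠ 0 → dtheta (fun q : Cyl => harmonic 1 b q.2) p =
      σ * harmonic 1 (!b) p.2 := fun p hp => by
    rw [dtheta_harmonic 1 b hp]; push_cast; rw [hσ]
  have dH' : ∀ p : Cyl, p.1 ≠ 0 → dtheta (fun q : Cyl => harmonic 1 (!b) q.2) p =
      -σ * harmonic 1 b p.2 := fun p hp => by
    rw [dtheta_harmonic 1 (!b) hp, hσ]; cases b <;> simp
  have ddH : ∀ p : Cyl, p.1 ≠ 0 → dtheta (dtheta fun q : Cyl => harmonic 1 b q.2) p =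
      -harmonic 1 b p.2 := fun p hp => by
    have e : dtheta (fun q : Cyl => harmonic 1 b q.2) =ᶠ[𝓝 p] fun q => σ * harmonic 1 (!b) q.2 := by
      filter_upwards [continuous_fst.continuousAt.eventually_ne hp] with q hq using dH q hq
    rw [dtheta_congr e, dtheta_const_mul σ (isSmooth_harmonic 1 (!b)) hp, dH' p hp]
    linear_combination (-harmonic 1 b p.2) * hσ2
  have hc : IsSmooth fun p : Cyl => σ * (|p.1| ^ (-α) * harmonic 1 (!b) p.2) :=
    (IsSmooth.const σ).mul ((IsSmooth.abs_rpow (-α)).mul (isSmooth_harmonic 1 (!b)))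
  have hk1 : (fun p : Cyl => harmonic 1 (!b) p.2 * harmonic 1 (!b) p.2 * (gradTheta α f).1 p) ∈ testFn :=
    ((isSmooth_harmonic 1 (!b)).mul (isSmooth_harmonic 1 (!b))).mul_mem (gradTheta α f).2
  have hk2 : (fun p : Cyl => 2 * (σ * (|p.1| ^ α * (harmonic 1 b p.2 * harmonic 1 (!b) p.2))) * f.1 p)
      ∈ testFn := ((IsSmooth.const 2).mul ((IsSmooth.const σ).mul ((IsSmooth.abs_rpow α).mul
        ((isSmooth_harmonic 1 b).mul (isSmooth_harmonic 1 (!b)))))).mul_mem f.2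
  have he : (fun p : Cyl => harmonic 1 (!b) p.2 * harmonic 1 (!b) p.2 * f.1 p) ∈ testFn :=
    ((isSmooth_harmonic 1 (!b)).mul (isSmooth_harmonic 1 (!b))).mul_mem f.2
  have hkp : ∀ p : Cyl, ((⟨_, hk1⟩ - ⟨_, hk2⟩ : testFn)).1 p =
      harmonic 1 (!b) p.2 * harmonic 1 (!b) p.2 * (gradTheta α f).1 p -
      2 * (σ * (|p.1| ^ α * (harmonic 1 b p.2 * harmonic 1 (!b) p.2))) * f.1 p := fun p => rfl
  refine ⟨⟨_, hk1⟩ - ⟨_, hk2⟩, fun p hp => ?_, ?_⟩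
  · rw [hkp]; ring
  have hen := markovian_energy hA h ⟨_, hc.mul_mem f.2⟩ ψ (⟨_, hk1⟩ - ⟨_, hk2⟩) ⟨_, he⟩
    (fun p hp => ?_) fun p hp => ?_
  · refine hen.trans ?_
    gcongr
    refine Lp.norm_le_norm_of_ae_le ?_
    filter_upwards [toL2_coeFn α ⟨_, he⟩, toL2_coeFn α f] with p h1 h2
    rw [h1, h2, norm_mul, norm_mul, Real.norm_eq_abs]
    have := abs_harmonic_le 1 (!b) p.2
    exact mul_le_of_le_one_left (norm_nonneg _) (mul_le_one₀ this (abs_nonneg _) this)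
  · have r1 : |p.1| ^ (2 * α) = |p.1| ^ α * |p.1| ^ α := by
      rw [two_mul, Real.rpow_add (abs_pos.mpr hp)]
    have r2 : |p.1| ^ (-α) * |p.1| ^ α = 1 := by rw [← Real.rpow_add (abs_pos.mpr hp)]; simp
    have dφ : dtheta (fun q : Cyl => σ * (|q.1| ^ (-α) * harmonic 1 (!b) q.2) * f.1 q) p =
        σ * |p.1| ^ (-α) * (-σ * harmonic 1 b p.2 * f.1 p + harmonic 1 (!b) p.2 * dtheta f.1 p) := by
      rw [dtheta_mul hc (testFn.isSmooth f.2) hp, dtheta_const_mul σ ((IsSmooth.abs_rpow (-α)).mul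
        (isSmooth_harmonic 1 (!b))) hp, dtheta_mul (IsSmooth.abs_rpow (-α))
        (isSmooth_harmonic 1 (!b)) hp, dtheta_fst (fun x => |x| ^ (-α)), dH' p hp]
      ring
    rw [hkp, laplace_apply, dφ, gradTheta_apply]
    rcases hψ p with h1 | h1
    · rw [dx_dx_congr h1, dtheta_dtheta_congr h1, dx_congr h1, dtheta_congr h1, ddH p hp, dH p hp]
      have d1 : dx (fun q : Cyl => harmonic 1 b q.2) = fun _ => 0 :=
        funext fun q => dx_snd (harmonic 1 b)
      rw [d1, r1]
      simp only [dx, deriv_const]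
      linear_combination
        (σ * harmonic 1 b p.2 * harmonic 1 (!b) p.2 * f.1 p * |p.1| ^ α -
          |p.1| ^ α * (harmonic 1 (!b) p.2 ^ 2 * dtheta f.1 p -
            σ * harmonic 1 b p.2 * f.1 p * harmonic 1 (!b) p.2) * (σ * σ)) * r2 -
        |p.1| ^ α * (harmonic 1 (!b) p.2 ^ 2 * dtheta f.1 p -
            σ * harmonic 1 b p.2 * f.1 p * harmonic 1 (!b) p.2) * hσ2
    · have hf0 : f.1 p = 0 := h1.self_of_nhds
      simp only [hf0]
      rw [dtheta_congr h1]
      have z : dx (fun q : Cyl => σ * (|q.1| ^ (-α) * harmonic 1 (!b) q.2) * f.1 q) p = 0 := by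
        have : (fun q : Cyl => σ * (|q.1| ^ (-α) * harmonic 1 (!b) q.2) * f.1 q) =ᶠ[𝓝 p] fun _ => 0 := by
          filter_upwards [h1] with q hq
          rw [hq, mul_zero]
        rw [dx_congr this]
        simp [dx]
      rw [z]
      simp only [dtheta, deriv_const]
      ring
  · have r1 : |p.1| ^ (2 * α) = |p.1| ^ α * |p.1| ^ α := by
      rw [two_mul, Real.rpow_add (abs_pos.mpr hp)]
    have r2 : |p.1| ^ (-α) * |p.1| ^ α = 1 := by rw [← Real.rpow_add (abs_pos.mpr hp)]; simp
    simp only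
    rcases hψ p with h1 | h1
    · rw [dx_congr h1, dtheta_congr h1, dx_snd (harmonic 1 b), dH p hp, r1]
      linear_combination -(harmonic 1 (!b) p.2 ^ 4 * f.1 p ^ 2) *
        ((σ * σ + 1) * (|p.1| ^ (-α) * |p.1| ^ α) ^ 2 * hσ2 + (|p.1| ^ (-α) * |p.1| ^ α + 1) * r2)
    · rw [h1.self_of_nhds]
      ring

/-- Replacing `f` by `sf` gives a quadratic polynomial in `s` that is non-negative, so its
discriminant is at most `0`: the functional `f ↦ (u, Kf)` is bounded by `√(EC) ‖f‖` and is
represented by an element of `L²`. -/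
theorem exists_riesz {u : L2 α} {C : ℝ} {K : testFn →ₗ[ℝ] testFn} {E : ℝ}
    (h : ∀ f, 0 ≤ E + 2 * (inner ℝ u (toL2 α (K f)) : ℝ) + C * ‖toL2 α f‖ ^ 2) :
    ∃ g : L2 α, ∀ f, (inner ℝ g (toL2 α f) : ℝ) = inner ℝ u (toL2 α (K f)) := by
  have hb : ∀ f, |(inner ℝ u (toL2 α (K f)) : ℝ)| ≤ Real.sqrt (E * C) * ‖toL2 α f‖ := by
    intro f
    have h1 := discrim_le_zero (a := C * ‖toL2 α f‖ ^ 2) (b := 2 * (inner ℝ u (toL2 α (K f)) : ℝ))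
      (c := E) fun s => by
        have := h (s • f)
        rw [map_smul, map_smul, map_smul, real_inner_smul_right, norm_smul, mul_pow,
          Real.norm_eq_abs, sq_abs] at this
        linarith
    rw [discrim] at h1
    have h2 : (inner ℝ u (toL2 α (K f)) : ℝ) ^ 2 ≤ E * C * ‖toL2 α f‖ ^ 2 := by linarith
    have h3 := Real.abs_le_sqrt h2
    rwa [Real.sqrt_mul' _ (sq_nonneg _), Real.sqrt_sq (norm_nonneg _)] at h3
  set ℓ : LinearMap.range (toL2 α) →ₗ[ℝ] ℝ := (innerₗ (L2 α) u) ∘ₗ toL2 α ∘ₗ K ∘ₗ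
    (LinearEquiv.ofInjective (toL2 α) (toL2_injective α)).symm.toLinearMap with hℓ
  have hℓa : ∀ f, ℓ ⟨toL2 α f, LinearMap.mem_range_self _ f⟩ = inner ℝ u (toL2 α (K f)) := by
    intro f
    have e : (LinearEquiv.ofInjective (toL2 α) (toL2_injective α)).symm
        ⟨toL2 α f, LinearMap.mem_range_self _ f⟩ = f := by
      rw [LinearEquiv.symm_apply_eq]
      rfl
    exact congrArg (fun k => (inner ℝ u (toL2 α (K k)) : ℝ)) e
  obtain ⟨L, hL, -⟩ := exists_extension_norm_eq (LinearMap.range (toL2 α))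
    (ℓ.mkContinuous (Real.sqrt (E * C)) (by
      rintro ⟨_, f, rfl⟩
      rw [hℓa]
      exact hb f))
  refine ⟨(InnerProductSpace.toDual ℝ (L2 α)).symm L, fun f => ?_⟩
  rw [InnerProductSpace.toDual_symm_apply, ← hℓa]
  exact hL ⟨toL2 α f, LinearMap.mem_range_self _ f⟩

theorem exists_weakGradient {A : L2 α →ₗ.[ℝ] L2 α} (hA : A ∈ markovianExtensions α) {u v : L2 α}
    (h : (u, v) ∈ A.graph) : ∃ g, (u, g) ∈ weakGradGraph α := by
  obtain ⟨g₁, h1⟩ := exists_riesz (u := u) (C := 1) (K := -dxAdj α) (E := -inner ℝ v u) fun f => by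
    rw [one_mul]
    exact markovian_energy_dx hA h f
  -- The constants `2` come from adding the inequalities for `cos` and `sin`; the terms without
  -- derivatives of `f` have opposite signs and cancel.
  obtain ⟨g₂, h2⟩ := exists_riesz (u := u) (C := 2) (K := gradTheta α) (E := 2 * -inner ℝ v u)
    fun f => by
      obtain ⟨k, hk, hk'⟩ := markovian_energy_harmonic hA h f true
      obtain ⟨l, hl, hl'⟩ := markovian_energy_harmonic hA h f false
      have e : k + l = gradTheta α f := testFn.ext_of_ne fun p hp => by
        change k.1 p + l.1 p = _
        have hcs : harmonic 1 true p.2 ^ 2 + harmonic 1 false p.2 ^ 2 = 1 := by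
          obtain ⟨s, hs⟩ := exists_coe_eq p.2
          rw [← hs, harmonic_true_coe, harmonic_false_coe]
          exact Real.cos_sq_add_sin_sq _
        rw [hk p hp, hl p hp]
        simp only [Bool.not_true, Bool.not_false, if_true, Bool.false_eq_true, if_false]
        linear_combination ((gradTheta α f).1 p) * hcs
      rw [← e, map_add, inner_add_right]
      linarith
  refine ⟨WithLp.toLp 2 (-g₁, -g₂), fun f => ⟨?_, ?_⟩⟩
  · have := h1 f
    simp only [LinearMap.neg_apply, map_neg, inner_neg_right] at this
    change (inner ℝ (-g₁) _ : ℝ) = _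
    rw [inner_neg_left, this, neg_neg]
  · change (inner ℝ (-g₂) _ : ℝ) = _
    rw [inner_neg_left, h2 f]

end WeakGradient

end

/-! ### Distributional derivatives on the half-line -/

section

section HalfLine

theorem exists_Icc_superset {K : Set ℝ} (hK : IsCompact K) (h0 : K ⊆ Ioi 0) :
    ∃ m M : ℝ, 0 < m ∧ m < 1 ∧ 1 < M ∧ K ⊆ Ioo m M := by
  have hK1 : IsCompact (insert 1 K) := hK.insert 1
  obtain ⟨m, hm, hm'⟩ := hK1.exists_isLeast (insert_nonempty 1 K)
  obtain ⟨M, hM, hM'⟩ := hK1.exists_isGreatest (insert_nonempty 1 K)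
  have hm0 : 0 < m := by
    rcases hm with rfl | hm
    · exact one_pos
    · exact h0 hm
  have h1 := hm' (mem_insert 1 K)
  have h2 := hM' (mem_insert 1 K)
  exact ⟨m / 2, M + 1, by linarith, by linarith, by linarith, fun x hx =>
    ⟨by linarith [hm' (mem_insert_of_mem 1 hx)], by linarith [hM' (mem_insert_of_mem 1 hx)]⟩⟩

theorem LocallyIntegrableOn.intervalIntegrable_of_pos {f : ℝ → ℝ} (hf : LocallyIntegrableOn f (Ioi 0))
    {a b : ℝ} (ha : 0 < a) (hb : 0 < b) : IntervalIntegrable f volume a b := by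
  refine (hf.integrableOn_compact_subset ?_ isCompact_uIcc).intervalIntegrable
  intro x hx
  exact (lt_min ha hb).trans_le hx.1

theorem LocallyIntegrableOn.integrable_mul_test {f : ℝ → ℝ} (hf : LocallyIntegrableOn f (Ioi 0))
    {ζ : ℝ → ℝ} (hζ : Continuous ζ) (hc : HasCompactSupport ζ) (h0 : tsupport ζ ⊆ Ioi 0) :
    Integrable fun x => f x * ζ x := by
  have h1 : IntegrableOn (fun x => f x * ζ x) (tsupport ζ) :=
    (hf.integrableOn_compact_subset h0 hc).mul_continuousOn hζ.continuousOn hc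
  refine (integrableOn_iff_integrable_of_support_subset fun x hx => ?_).mp h1
  exact subset_tsupport ζ (right_ne_zero_of_mul hx)

/-- A function on `(0, ∞)` whose distributional derivative vanishes is constant. -/
theorem exists_ae_eq_const {k : ℝ → ℝ} (hk : LocallyIntegrableOn k (Ioi 0))
    (h : ∀ η : ℝ → ℝ, ContDiff ℝ ∞ η → HasCompactSupport η → tsupport η ⊆ Ioi 0 →
      ∫ x, k x * deriv η x = 0) : ∃ c, ∀ᵐ x : ℝ, 0 < x → k x = c := by
  let B : ContDiffBump (1 : ℝ) := ⟨1 / 4, 1 / 2, by norm_num, by norm_num⟩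
  set ρ : ℝ → ℝ := B.normed volume
  have hρ : ContDiff ℝ ∞ ρ := B.contDiff_normed (n := ⊤)
  have hρc : HasCompactSupport ρ := B.hasCompactSupport_normed
  have hρ0 : tsupport ρ ⊆ Ioi 0 := by
    rw [B.tsupport_normed_eq, Real.closedBall_eq_Icc]
    intro x hx
    have : (1 : ℝ) - 1 / 2 ≤ x := hx.1
    exact mem_Ioi.mpr (by linarith)
  have hρ1 : ∫ x, ρ x = 1 := B.integral_normed
  set c := ∫ x, k x * ρ x with hcdef
  have hkρ := LocallyIntegrableOn.integrable_mul_test hk hρ.continuous hρc hρ0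
  refine ⟨c, ?_⟩
  have hloc : LocallyIntegrableOn (fun x => k x - c) (Ioi 0) :=
    hk.sub ((locallyIntegrable_const c).locallyIntegrableOn _)
  suffices key : ∀ ζ : ℝ → ℝ, ContDiff ℝ ∞ ζ → HasCompactSupport ζ → tsupport ζ ⊆ Ioi 0 →
      ∫ x, ζ x • (k x - c) = 0 by
    filter_upwards [isOpen_Ioi.ae_eq_zero_of_integral_contDiff_smul_eq_zero hloc key] with x hx h0
    exact sub_eq_zero.mp (hx h0)
  intro ζ hζ hζc hζ0
  set I := ∫ x, ζ x with hI
  -- Since `∫ ρ = 1`, `ξ` has integral zero, so its primitive has compact support in `(0, ∞)` and is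
  -- an admissible test function.
  set ξ : ℝ → ℝ := fun x => ζ x - I * ρ x with hξ
  have hξs : ContDiff ℝ ∞ ξ := hζ.sub (contDiff_const.mul hρ)
  have hζi : Integrable ζ := hζ.continuous.integrable_of_hasCompactSupport hζc
  have hρi : Integrable ρ := hρ.continuous.integrable_of_hasCompactSupport hρc
  have hξ0 : ∫ x, ξ x = 0 := by
    rw [hξ, integral_sub hζi (hρi.const_mul I), integral_const_mul, hρ1]
    simp [hI]
  obtain ⟨m, M, hm, hm1, hM1, hmM⟩ := exists_Icc_superset (hζc.isCompact.union hρc.isCompact)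
    (union_subset hζ0 hρ0)
  have hξz : ∀ x, x ∉ Ioo m M → ξ x = 0 := fun x hx => by
    have h1 : x ∉ tsupport ζ := fun hc => hx (hmM (Or.inl hc))
    have h2 : x ∉ tsupport ρ := fun hc => hx (hmM (Or.inr hc))
    simp [hξ, image_eq_zero_of_notMem_tsupport h1, image_eq_zero_of_notMem_tsupport h2]
  set η : ℝ → ℝ := fun x => ∫ t in m..x, ξ t with hη
  have hηd : ∀ x, HasDerivAt η (ξ x) x := fun x =>
    intervalIntegral.integral_hasDerivAt_right (hξs.continuous.intervalIntegrable _ _)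
      (hξs.continuous.stronglyMeasurableAtFilter _ _) hξs.continuous.continuousAt
  have hηd' : deriv η = ξ := funext fun x => (hηd x).deriv
  have hηs : ContDiff ℝ ∞ η := contDiff_infty_iff_deriv.mpr
    ⟨fun x => (hηd x).differentiableAt, by rw [hηd']; exact hξs⟩
  have hηz : ∀ x, x ∉ Icc m M → η x = 0 := fun x hx => by
    by_cases hxm : m ≤ x
    · have hxM : M < x := by
        by_contra hc
        exact hx ⟨hxm, not_lt.mp hc⟩
      rw [hη, ← hξ0]
      refine intervalIntegral.integral_eq_integral_of_support_subset fun y hy => ?_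
      have : y ∈ Ioo m M := by
        by_contra hc
        exact hy (hξz y hc)
      exact ⟨this.1, this.2.le.trans hxM.le⟩
    · refine (intervalIntegral.integral_congr (g := fun _ => 0) fun y hy => ?_).trans (by simp)
      refine hξz y fun hc => ?_
      rw [uIcc_of_ge (not_le.mp hxm).le] at hy
      exact absurd hc.1 (not_lt.mpr hy.2)
  have hts : tsupport η ⊆ Icc m M := closure_minimal (fun x hx => by
    by_contra hc
    exact hx (hηz x hc)) isClosed_Icc
  have h1 := h η hηs (isCompact_Icc.of_isClosed_subset (isClosed_tsupport η) hts)
    (hts.trans fun x hx => hm.trans_le hx.1)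
  rw [hηd'] at h1
  have hkζ := LocallyIntegrableOn.integrable_mul_test hk hζ.continuous hζc hζ0
  have e1 : ∫ x, k x * ξ x = (∫ x, k x * ζ x) - I * c := by
    rw [hcdef, ← integral_const_mul, ← integral_sub hkζ (hkρ.const_mul I)]
    refine integral_congr_ae (Eventually.of_forall fun x => ?_)
    simp only [hξ]
    ring
  have e2 : ∫ x, ζ x • (k x - c) = (∫ x, k x * ζ x) - c * I := by
    rw [hI, ← integral_const_mul, ← integral_sub hkζ (hζi.const_mul c)]
    refine integral_congr_ae (Eventually.of_forall fun x => ?_)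
    simp only [smul_eq_mul]
    ring
  rw [e2]
  linarith

theorem continuousOn_integral_of_locallyIntegrableOn {g : ℝ → ℝ} (hg : LocallyIntegrableOn g (Ioi 0)) :
    ContinuousOn (fun x => ∫ t in (1 : ℝ)..x, g t) (Ioi 0) := by
  intro x hx
  obtain ⟨m, M, hm, hm1, hM1, hmM⟩ := exists_Icc_superset (isCompact_singleton (x := x))
    (singleton_subset_iff.mpr hx)
  have hac := (LocallyIntegrableOn.intervalIntegrable_of_pos hg hm
    (by linarith)).absolutelyContinuousOnInterval_intervalIntegral (b := M) (c := 1)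
    (by rw [uIcc_of_le (by linarith)]; exact ⟨hm1.le, hM1.le⟩)
  have hxm := hmM rfl
  refine (hac.continuousOn.continuousAt ?_).continuousWithinAt
  rw [uIcc_of_le (by linarith)]
  exact Icc_mem_nhds hxm.1 hxm.2

/-- A function on `(0, ∞)` with a locally integrable distributional derivative is a primitive of
it. -/
theorem exists_ae_eq_add_integral {f g : ℝ → ℝ} (hf : LocallyIntegrableOn f (Ioi 0))
    (hg : LocallyIntegrableOn g (Ioi 0))
    (h : ∀ η : ℝ → ℝ, ContDiff ℝ ∞ η → HasCompactSupport η → tsupport η ⊆ Ioi 0 →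
      ∫ x, f x * deriv η x = -∫ x, g x * η x) :
    ∃ c, ∀ᵐ x : ℝ, 0 < x → f x = c + ∫ t in (1 : ℝ)..x, g t := by
  set G : ℝ → ℝ := fun x => ∫ t in (1 : ℝ)..x, g t with hG
  have hGl : LocallyIntegrableOn G (Ioi 0) :=
    (continuousOn_integral_of_locallyIntegrableOn hg).locallyIntegrableOn measurableSet_Ioi
  -- The difference of `f` and the primitive of `g` has vanishing distributional derivative, by
  -- integration by parts for absolutely continuous functions.
  obtain ⟨c, hc⟩ := exists_ae_eq_const (k := fun x => f x - G x) (hf.sub hGl)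
    fun η hη hηc hη0 => by
      have hη' : Continuous (deriv η) := (contDiff_infty_iff_deriv.mp hη).2.continuous
      have hc' : HasCompactSupport (deriv η) := hηc.deriv
      have h0' : tsupport (deriv η) ⊆ Ioi 0 := (tsupport_deriv_subset).trans hη0
      obtain ⟨m, M, hm, hm1, hM1, hmM⟩ := exists_Icc_superset hηc hη0
      have hmM' : m ≤ M := by linarith
      have hgi := LocallyIntegrableOn.intervalIntegrable_of_pos hg hm (by linarith : 0 < M)
      have h1 : (1 : ℝ) ∈ uIcc m M := by rw [uIcc_of_le hmM']; exact ⟨hm1.le, hM1.le⟩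
      have hparts := AbsolutelyContinuousOnInterval.integral_mul_deriv_eq_deriv_mul
        (hgi.absolutelyContinuousOnInterval_intervalIntegral h1)
        ((hη.of_le (by simp)).contDiffOn.absolutelyContinuousOnInterval (a := m) (b := M))
      have hηm : η m = 0 := image_eq_zero_of_notMem_tsupport fun hh => lt_irrefl _ (hmM hh).1
      have hηM : η M = 0 := image_eq_zero_of_notMem_tsupport fun hh => lt_irrefl _ (hmM hh).2
      have hd : ∫ x in m..M, deriv G x * η x = ∫ x in m..M, g x * η x := by
        refine intervalIntegral.integral_congr_ae ?_
        filter_upwards [hgi.ae_hasDerivAt_integral] with x hx hxm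
        rw [(hx (uIoc_subset_uIcc hxm) 1 h1).deriv]
      have s1 : ∫ x in m..M, G x * deriv η x = ∫ x, G x * deriv η x :=
        intervalIntegral.integral_eq_integral_of_support_subset fun x hx =>
          Ioo_subset_Ioc_self (hmM (tsupport_deriv_subset (subset_tsupport _ (right_ne_zero_of_mul hx))))
      have s2 : ∫ x in m..M, g x * η x = ∫ x, g x * η x :=
        intervalIntegral.integral_eq_integral_of_support_subset fun x hx =>
          Ioo_subset_Ioc_self (hmM (subset_tsupport _ (right_ne_zero_of_mul hx)))
      rw [hd, s2, hηm, hηM, s1] at hparts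
      have e : ∫ x, (f x - G x) * deriv η x = (∫ x, f x * deriv η x) - ∫ x, G x * deriv η x := by
        rw [← integral_sub (LocallyIntegrableOn.integrable_mul_test hf hη' hc' h0')
          (LocallyIntegrableOn.integrable_mul_test hGl hη' hc' h0')]
        simp only [sub_mul]
      rw [e, h η hη hηc hη0, hparts]
      ring
  refine ⟨c, ?_⟩
  filter_upwards [hc] with x hx h0
  linarith [hx h0]

end HalfLine

end

/-! ### The radial equation: regularity and vanishing of finite energy solutions -/

section

variable {α N : ℝ}

section Regularity

theorem continuousOn_abs_rpow (b : ℝ) : ContinuousOn (fun x : ℝ => |x| ^ b) (Ioi 0) := fun x hx =>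
  (contDiffAt_abs_rpow b x (ne_of_gt hx)).continuousAt.continuousWithinAt

theorem hasDerivAt_integral_of_continuousOn {q : ℝ → ℝ} (hq : ContinuousOn q (Ioi 0)) {x : ℝ}
    (hx : 0 < x) : HasDerivAt (fun x => ∫ t in (1 : ℝ)..x, q t) (q x) x :=
  intervalIntegral.integral_hasDerivAt_right
    (LocallyIntegrableOn.intervalIntegrable_of_pos (hq.locallyIntegrableOn measurableSet_Ioi)
      one_pos hx)
    (hq.stronglyMeasurableAtFilter isOpen_Ioi x hx) (hq.continuousAt (Ioi_mem_nhds hx))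

theorem integral_congr_of_ae_pos {f g : ℝ → ℝ} (h : ∀ᵐ x : ℝ, 0 < x → f x = g x) {x : ℝ}
    (hx : 0 < x) : ∫ t in (1 : ℝ)..x, f t = ∫ t in (1 : ℝ)..x, g t := by
  refine intervalIntegral.integral_congr_ae ?_
  filter_upwards [h] with t ht hm
  exact ht ((lt_min one_pos hx).trans hm.1)

/-- A weak solution on `(0, ∞)` of `a' = β`, `(|x|^{-α} β)' = |x|^{-α} (1 + N |x|^{2α}) a` is a
classical solution. -/
theorem exists_classical_solution {a β : ℝ → ℝ} (ha : LocallyIntegrableOn a (Ioi 0))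
    (hβ : LocallyIntegrableOn β (Ioi 0))
    (h1 : ∀ η : ℝ → ℝ, ContDiff ℝ ∞ η → HasCompactSupport η → tsupport η ⊆ Ioi 0 →
      ∫ x, a x * deriv η x = -∫ x, β x * η x)
    (h2 : ∀ η : ℝ → ℝ, ContDiff ℝ ∞ η → HasCompactSupport η → tsupport η ⊆ Ioi 0 →
      ∫ x, |x| ^ (-α) * β x * deriv η x = -∫ x, |x| ^ (-α) * (1 + N * |x| ^ (2 * α)) * a x * η x) :
    ∃ A P : ℝ → ℝ, (∀ x, 0 < x → HasDerivAt A (|x| ^ α * P x) x) ∧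
      (∀ x, 0 < x → HasDerivAt P (|x| ^ (-α) * (1 + N * |x| ^ (2 * α)) * A x) x) ∧
      (∀ᵐ x : ℝ, 0 < x → a x = A x) ∧ ∀ᵐ x : ℝ, 0 < x → β x = |x| ^ α * P x := by
  have hloc : ∀ {f k : ℝ → ℝ}, ContinuousOn f (Ioi 0) → LocallyIntegrableOn k (Ioi 0) →
      LocallyIntegrableOn (fun x => f x * k x) (Ioi 0) := fun hf hk =>
    hk.continuousOn_mul hf isOpen_Ioi.isLocallyClosed
  have hw : ContinuousOn (fun x : ℝ => |x| ^ (-α) * (1 + N * |x| ^ (2 * α))) (Ioi 0) :=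
    (continuousOn_abs_rpow _).mul (continuousOn_const.add
      (continuousOn_const.mul (continuousOn_abs_rpow _)))
  obtain ⟨c, hc⟩ := exists_ae_eq_add_integral ha hβ h1
  obtain ⟨d, hd⟩ := exists_ae_eq_add_integral (hloc (continuousOn_abs_rpow (-α)) hβ) (hloc hw ha) h2
  -- Bootstrap: `A₀` is a continuous representative of `a`, so `P`, a primitive of `q`, is
  -- differentiable. Hence `β` agrees a.e. with the continuous function `|x|^α P`, and the primitive
  -- `A` of the latter is differentiable and equal to `A₀`.
  set A₀ : ℝ → ℝ := fun x => c + ∫ t in (1 : ℝ)..x, β t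
  have hA₀ : ContinuousOn A₀ (Ioi 0) :=
    continuousOn_const.add (continuousOn_integral_of_locallyIntegrableOn hβ)
  set q : ℝ → ℝ := fun x => |x| ^ (-α) * (1 + N * |x| ^ (2 * α)) * A₀ x
  have hq : ContinuousOn q (Ioi 0) := hw.mul hA₀
  set P : ℝ → ℝ := fun x => d + ∫ t in (1 : ℝ)..x, q t
  have hPd : ∀ x, 0 < x → HasDerivAt P (q x) x := fun x hx =>
    (hasDerivAt_integral_of_continuousOn hq hx).const_add d
  have hPc : ContinuousOn P (Ioi 0) := fun x hx => (hPd x hx).continuousAt.continuousWithinAt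
  have hβP : ∀ᵐ x : ℝ, 0 < x → β x = |x| ^ α * P x := by
    filter_upwards [hd] with x hx h0
    have e : |x| ^ α * |x| ^ (-α) = 1 := by
      rw [← Real.rpow_add (abs_pos.mpr h0.ne')]; simp
    have h3 := hx h0
    rw [integral_congr_of_ae_pos (g := q) (hc.mono fun y hy hy0 => by rw [hy hy0]) h0] at h3
    change |x| ^ (-α) * β x = P x at h3
    rw [← h3, ← mul_assoc, e, one_mul]
  set r : ℝ → ℝ := fun x => |x| ^ α * P x
  have hr : ContinuousOn r (Ioi 0) := (continuousOn_abs_rpow α).mul hPc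
  set A : ℝ → ℝ := fun x => c + ∫ t in (1 : ℝ)..x, r t
  have hAA : ∀ x, 0 < x → A₀ x = A x := fun x hx =>
    congrArg (c + ·) (integral_congr_of_ae_pos hβP hx)
  refine ⟨A, P, fun x hx => (hasDerivAt_integral_of_continuousOn hr hx).const_add c,
    fun x hx => ?_, ?_, hβP⟩
  · rw [← hAA x hx]
    exact hPd x hx
  · filter_upwards [hc] with x hx h0
    rw [hx h0, ← hAA x h0]

end Regularity

section Vanishing

/-- For `α ∉ (-1, 1)`, the only solution of finite energy vanishes. -/
theorem eq_zero_of_finite_energy (hα : α ∉ Ioo (-1 : ℝ) 1) (hN : 0 ≤ N) {A P : ℝ → ℝ}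
    (hA : ∀ x, 0 < x → HasDerivAt A (|x| ^ α * P x) x)
    (hP : ∀ x, 0 < x → HasDerivAt P (|x| ^ (-α) * (1 + N * |x| ^ (2 * α)) * A x) x)
    (hAi : IntegrableOn (fun x => |x| ^ (-α) * A x ^ 2) (Ioi 0))
    (hPi : IntegrableOn (fun x => |x| ^ α * P x ^ 2) (Ioi 0)) : ∀ x, 0 < x → A x = 0 := by
  have hAc : ContinuousOn A (Ioi 0) := fun x hx => (hA x hx).continuousAt.continuousWithinAt
  have hPc : ContinuousOn P (Ioi 0) := fun x hx => (hP x hx).continuousAt.continuousWithinAt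
  have hpos : ∀ b x : ℝ, 0 < x → 0 < |x| ^ b := fun b x hx => Real.rpow_pos_of_pos (abs_pos.mpr hx.ne') _
  have hmul : ∀ x : ℝ, 0 < x → |x| ^ (-α) * |x| ^ α = 1 := fun x hx => by
    rw [← Real.rpow_add (abs_pos.mpr hx.ne')]; simp
  -- Here `F = |x|^{-α} A A'` is the flux of the equation. Its derivative is the energy density, so
  -- `F` is increasing, and it is integrable since `|AP| ≤ |x|^{-α}A² + |x|^α P²`.
  set F : ℝ → ℝ := fun x => A x * P x with hF
  set F' : ℝ → ℝ := fun x => |x| ^ α * P x ^ 2 + |x| ^ (-α) * (1 + N * |x| ^ (2 * α)) * A x ^ 2 with hF'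
  have hFd : ∀ x, 0 < x → HasDerivAt F (F' x) x := fun x hx =>
    ((hA x hx).mul (hP x hx)).congr_deriv (by simp only [hF']; ring)
  have hF'0 : ∀ x, 0 < x → 0 ≤ F' x := fun x hx => by
    have := hpos α x hx
    have := hpos (-α) x hx
    have := hpos (2 * α) x hx
    positivity
  have hmono : MonotoneOn F (Ioi 0) := by
    refine monotoneOn_of_deriv_nonneg (convex_Ioi 0) (fun x hx => (hFd x hx).continuousAt.continuousWithinAt)
      (fun x hx => ?_) fun x hx => ?_
    · rw [interior_Ioi] at hx
      exact (hFd x hx).differentiableAt.differentiableWithinAt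
    · rw [interior_Ioi] at hx
      rw [(hFd x hx).deriv]
      exact hF'0 x hx
  have hFi : IntegrableOn F (Ioi 0) := by
    refine (hAi.add hPi).mono' ((hAc.mul hPc).aestronglyMeasurable measurableSet_Ioi) ?_
    refine (ae_restrict_mem measurableSet_Ioi).mono fun x hx => ?_
    simp only [Pi.add_apply, hF, Real.norm_eq_abs]
    have h1 := hpos α x hx
    have h2 := hpos (-α) x hx
    have h3 := hmul x hx
    have e : |x| ^ (-α) = (|x| ^ α)⁻¹ := eq_inv_of_mul_eq_one_left h3
    have k1 : |A x * P x| ≤ (|x| ^ (-α) * A x ^ 2 + |x| ^ α * P x ^ 2) := by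
      rw [e]
      set w := |x| ^ α
      have k2 : w⁻¹ * A x ^ 2 + w * P x ^ 2 = w⁻¹ * (A x ^ 2 + (w * P x) ^ 2) := by
        field_simp
      have k3 : |A x * P x| = w⁻¹ * (|A x| * |w * P x|) := by
        rw [abs_mul, abs_mul, abs_of_pos h1]
        field_simp
      rw [k2, k3, ← sq_abs (A x), ← sq_abs (w * P x)]
      refine mul_le_mul_of_nonneg_left ?_ (inv_pos.mpr h1).le
      nlinarith [sq_nonneg (|A x| - |w * P x|), sq_nonneg (|A x|), sq_nonneg (|w * P x|)]
    exact k1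
  -- An increasing function that is positive somewhere is not integrable at infinity.
  have hle : ∀ x, 0 < x → F x ≤ 0 := by
    intro x hx
    by_contra hc
    rw [not_le] at hc
    have h1 : IntegrableOn (fun _ : ℝ => F x) (Ioi x) := by
      refine (hFi.mono_set (Ioi_subset_Ioi hx.le)).mono' aestronglyMeasurable_const ?_
      refine (ae_restrict_mem measurableSet_Ioi).mono fun y hy => ?_
      rw [Real.norm_of_nonneg hc.le]
      exact hmono hx (hx.trans hy) (le_of_lt hy)
    rw [integrableOn_const_iff] at h1
    simp [hc.ne'] at h1
  have hzero : ∀ x, 0 < x → F x = 0 := by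
    intro x₀ hx₀
    by_contra hne
    have hneg : F x₀ < 0 := lt_of_le_of_ne (hle x₀ hx₀) hne
    set x₁ := min x₀ 1 with hx₁
    have hx1 : 0 < x₁ := lt_min hx₀ one_pos
    have hx11 : x₁ ≤ 1 := min_le_right _ _
    set c := -F x₀ with hc
    have hc0 : 0 < c := neg_pos.mpr hneg
    have hFc : ∀ x, 0 < x → x ≤ x₁ → F x ≤ -c := fun x hx hxx => by
      rw [hc, neg_neg]
      exact hmono hx hx₀ (hxx.trans (min_le_left _ _))
    have hA0 : ∀ x, 0 < x → x ≤ x₁ → 0 < A x ^ 2 := fun x hx hxx => by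
      have : A x ≠ 0 := fun h0 => by
        have := hFc x hx hxx
        simp only [hF, h0, zero_mul] at this
        linarith
      positivity
    have hGd : ∀ x, 0 < x → HasDerivAt (fun x => A x ^ 2) (2 * |x| ^ α * F x) x := fun x hx =>
      ((hA x hx).pow 2).congr_deriv (by simp only [hF]; push_cast; ring)
    rw [mem_Ioo, not_and_or, not_lt, not_lt] at hα
    rcases hα with hα | hα
    -- Case `α ≤ -1`. On one hand `(A²)' = 2x^α F ≤ -2c/x`, so `A²` grows at least like `2c
    -- log(1/x)` at `0`. On the other hand `log A²` stays bounded above, being controlled by the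
    -- finite integral of `x^α P²`.
    · set J : ℝ → ℝ := fun x => ∫ t in (1 : ℝ)..x, |t| ^ α * P t ^ 2 with hJ
      have hJd : ∀ x, 0 < x → HasDerivAt J (|x| ^ α * P x ^ 2) x := fun x hx =>
        hasDerivAt_integral_of_continuousOn (q := fun t => |t| ^ α * P t ^ 2)
          ((continuousOn_abs_rpow α).mul (hPc.pow 2)) hx
      have hJle : ∀ x, 0 < x → x ≤ 1 → -J x ≤ ∫ t in Ioi (0 : ℝ), |t| ^ α * P t ^ 2 := fun x hx hx1 => by
        rw [hJ, ← intervalIntegral.integral_symm, intervalIntegral.integral_of_le hx1]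
        refine setIntegral_mono_set hPi ?_ (Ioc_subset_Ioi_self.trans (Ioi_subset_Ioi hx.le)).eventuallyLE
        exact Eventually.of_forall fun t => by positivity
      have hΦd : ∀ x, 0 < x → HasDerivAt (fun x => A x ^ 2 + 2 * c * Real.log x)
          (2 * |x| ^ α * F x + 2 * c * x⁻¹) x := fun x hx =>
        (hGd x hx).add ((Real.hasDerivAt_log hx.ne').const_mul (2 * c))
      have hΦ : AntitoneOn (fun x => A x ^ 2 + 2 * c * Real.log x) (Ioc 0 x₁) := by
        refine antitoneOn_of_deriv_nonpos (convex_Ioc 0 x₁)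
          (fun x hx => (hΦd x hx.1).continuousAt.continuousWithinAt) (fun x hx => ?_) fun x hx => ?_
        · rw [interior_Ioc] at hx
          exact (hΦd x hx.1).differentiableAt.differentiableWithinAt
        · rw [interior_Ioc] at hx
          rw [(hΦd x hx.1).deriv, abs_of_pos hx.1]
          have h1 : x⁻¹ ≤ x ^ α := by
            rw [← Real.rpow_neg_one]
            exact Real.rpow_le_rpow_of_exponent_ge hx.1 (hx.2.le.trans hx11) hα
          have h2 := hFc x hx.1 hx.2.le
          have h3 : 0 < x ^ α := Real.rpow_pos_of_pos hx.1 _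
          nlinarith
      have hLd : ∀ x, 0 < x → x ≤ x₁ → HasDerivAt (fun x => Real.log (A x ^ 2) + 2 / c * J x)
          (2 * |x| ^ α * F x / A x ^ 2 + 2 / c * (|x| ^ α * P x ^ 2)) x := fun x hx hxx =>
        ((hGd x hx).log (hA0 x hx hxx).ne').add ((hJd x hx).const_mul (2 / c))
      have hL : MonotoneOn (fun x => Real.log (A x ^ 2) + 2 / c * J x) (Ioc 0 x₁) := by
        refine monotoneOn_of_deriv_nonneg (convex_Ioc 0 x₁)
          (fun x hx => (hLd x hx.1 hx.2).continuousAt.continuousWithinAt) (fun x hx => ?_) fun x hx => ?_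
        · rw [interior_Ioc] at hx
          exact (hLd x hx.1 hx.2.le).differentiableAt.differentiableWithinAt
        · rw [interior_Ioc] at hx
          rw [(hLd x hx.1 hx.2.le).deriv]
          have h1 := hA0 x hx.1 hx.2.le
          have h2 := hFc x hx.1 hx.2.le
          have h3 := hpos α x hx.1
          -- Since `P = F/A`, the derivative is a positive multiple of `F(F + c)`, and `F ≤ -c < 0`.
          have e : 2 * |x| ^ α * F x / A x ^ 2 + 2 / c * (|x| ^ α * P x ^ 2) =
              2 * |x| ^ α / (c * A x ^ 2) * (F x * (F x + c)) := by
            simp only [hF]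
            have : A x ≠ 0 := fun h0 => by simp [h0] at h1
            field_simp
            ring
          rw [e]
          refine mul_nonneg (by positivity) (mul_nonneg_of_nonpos_of_nonpos ?_ ?_) <;> linarith
      set M := Real.log (A x₁ ^ 2) + 2 / c * J x₁ +
        2 / c * ∫ t in Ioi (0 : ℝ), |t| ^ α * P t ^ 2 with hM
      -- Chosen so that `2c log(x₁/ε) = e^M`: the lower bound becomes `A(x₁)² + e^M ≤ A(ε)²`,
      -- against `A(ε)² ≤ e^M`.
      set ε := x₁ * Real.exp (-(Real.exp M / (2 * c))) with hε
      have hε0 : 0 < ε := by positivity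
      have hεx : ε ≤ x₁ := mul_le_of_le_one_right hx1.le (Real.exp_le_one_iff.mpr (by
        rw [neg_nonpos]; positivity))
      have h1 := hΦ ⟨hε0, hεx⟩ ⟨hx1, le_rfl⟩ hεx
      have h2 := hL ⟨hε0, hεx⟩ ⟨hx1, le_rfl⟩ hεx
      simp only at h1 h2
      have h3 := mul_le_mul_of_nonneg_left (hJle ε hε0 (hεx.trans hx11)) (by positivity : 0 ≤ 2 / c)
      have h4 : Real.log (A ε ^ 2) ≤ M := by rw [hM]; linarith
      have h5 : A ε ^ 2 ≤ Real.exp M := (Real.log_le_iff_le_exp (hA0 ε hε0 hεx)).mp h4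
      have h6 : Real.log ε = Real.log x₁ - Real.exp M / (2 * c) := by
        rw [hε, Real.log_mul hx1.ne' (Real.exp_pos _).ne', Real.log_exp]; ring
      have h7 : 2 * c * (Real.exp M / (2 * c)) = Real.exp M := by field_simp
      have h8 := hA0 x₁ hx1 le_rfl
      rw [h6, mul_sub, h7] at h1
      linarith
    -- Case `α ≥ 1`. As `F ≤ 0`, `A²` decreases and stays above `A(x₁)² > 0` near `0`, so finite
    -- mass would make `x^{-α}` integrable there.
    · have hanti : AntitoneOn (fun x => A x ^ 2) (Ioc 0 x₁) := by
        refine antitoneOn_of_deriv_nonpos (convex_Ioc 0 x₁)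
          (fun x hx => (hGd x hx.1).continuousAt.continuousWithinAt) (fun x hx => ?_) fun x hx => ?_
        · rw [interior_Ioc] at hx
          exact (hGd x hx.1).differentiableAt.differentiableWithinAt
        · rw [interior_Ioc] at hx
          rw [(hGd x hx.1).deriv]
          exact mul_nonpos_of_nonneg_of_nonpos (by positivity) (hle x hx.1)
      have h1 : IntegrableOn (fun x : ℝ => x ^ (-α)) (Ioo 0 x₁) := by
        refine ((hAi.mono_set Ioo_subset_Ioi_self).const_mul (A x₁ ^ 2)⁻¹).mono'
          (by fun_prop) ?_
        refine (ae_restrict_mem measurableSet_Ioo).mono fun x hx => ?_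
        have h2 := hanti ⟨hx.1, hx.2.le⟩ ⟨hx1, le_rfl⟩ hx.2.le
        have h3 := hA0 x₁ hx1 le_rfl
        simp only at h2
        rw [Real.norm_of_nonneg (Real.rpow_nonneg hx.1.le _), abs_of_pos hx.1, mul_left_comm]
        refine le_mul_of_one_le_right (Real.rpow_nonneg hx.1.le _) ?_
        rw [← div_eq_inv_mul, one_le_div h3]
        exact h2
      rw [intervalIntegral.integrableOn_Ioo_rpow_iff hx1] at h1
      linarith
  intro x hx
  have h1 : F' x = 0 := by
    have : F =ᶠ[𝓝 x] fun _ => 0 := by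
      filter_upwards [Ioi_mem_nhds hx] with y hy using hzero y hy
    rw [← (hFd x hx).deriv, this.deriv_eq, deriv_const]
  have h2 := hpos α x hx
  have h3 := hpos (-α) x hx
  have h4 := hpos (2 * α) x hx
  have h5 : 0 ≤ |x| ^ α * P x ^ 2 := by positivity
  have h6 : 0 < |x| ^ (-α) * (1 + N * |x| ^ (2 * α)) := by positivity
  simp only [hF'] at h1
  have h7 : |x| ^ (-α) * (1 + N * |x| ^ (2 * α)) * A x ^ 2 = 0 :=
    le_antisymm (by linarith) (by positivity)
  exact pow_eq_zero_iff two_ne_zero |>.mp ((mul_eq_zero.mp h7).resolve_left h6.ne')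

end Vanishing

end

/-! ### `H¹ = H¹₀` for `α ∉ (-1, 1)` -/

section

variable {α N : ℝ}

section WeakSolutions

theorem ae_eq_zero_on_pos (hα : α ∉ Ioo (-1 : ℝ) 1) (hN : 0 ≤ N) {a β : ℝ → ℝ}
    (ham : StronglyMeasurable a) (hβm : StronglyMeasurable β)
    (ha : Integrable fun x => |x| ^ (-α) * a x ^ 2) (hβ : Integrable fun x => |x| ^ (-α) * β x ^ 2)
    (h1 : ∀ η : ℝ → ℝ, ContDiff ℝ ∞ η → HasCompactSupport η → tsupport η ⊆ Ioi 0 →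
      ∫ x, a x * deriv η x = -∫ x, β x * η x)
    (h2 : ∀ η : ℝ → ℝ, ContDiff ℝ ∞ η → HasCompactSupport η → tsupport η ⊆ Ioi 0 →
      ∫ x, |x| ^ (-α) * β x * deriv η x = -∫ x, |x| ^ (-α) * (1 + N * |x| ^ (2 * α)) * a x * η x) :
    ∀ᵐ x : ℝ, 0 < x → a x = 0 := by
  have hsub : Ioi (0 : ℝ) ⊆ {0}ᶜ := fun x hx => ne_of_gt hx
  obtain ⟨A, P, hA, hP, haA, hβP⟩ := exists_classical_solution
    ((locallyIntegrableOn_of_weighted_sq ham ha).mono_set hsub)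
    ((locallyIntegrableOn_of_weighted_sq hβm hβ).mono_set hsub) h1 h2
  have hz := eq_zero_of_finite_energy hα hN hA hP
    (ha.integrableOn.congr_fun_ae (by
      rw [EventuallyEq, ae_restrict_iff' measurableSet_Ioi]
      filter_upwards [haA] with x hx h0
      rw [hx h0]))
    (hβ.integrableOn.congr_fun_ae (by
      rw [EventuallyEq, ae_restrict_iff' measurableSet_Ioi]
      filter_upwards [hβP] with x hx h0
      have e : |x| ^ (-α) * |x| ^ α = 1 := by
        rw [← Real.rpow_add (abs_pos.mpr (ne_of_gt h0))]; simp
      rw [hx h0]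
      linear_combination (|x| ^ α * P x ^ 2) * e))
  filter_upwards [haA] with x hx h0
  rw [hx h0, hz x h0]

/-- For `α ∉ (-1, 1)`, a weak solution on `ℝ \ {0}` of finite energy vanishes. -/
theorem ae_eq_zero_of_weak_solution (hα : α ∉ Ioo (-1 : ℝ) 1) (hN : 0 ≤ N) {a β : ℝ → ℝ}
    (ham : StronglyMeasurable a) (hβm : StronglyMeasurable β)
    (ha : Integrable fun x => |x| ^ (-α) * a x ^ 2) (hβ : Integrable fun x => |x| ^ (-α) * β x ^ 2)
    (h1 : ∀ η : ℝ → ℝ, ContDiff ℝ ∞ η → HasCompactSupport η → tsupport η ⊆ {0}ᶜ →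
      ∫ x, a x * deriv η x = -∫ x, β x * η x)
    (h2 : ∀ η : ℝ → ℝ, ContDiff ℝ ∞ η → HasCompactSupport η → tsupport η ⊆ {0}ᶜ →
      ∫ x, |x| ^ (-α) * β x * deriv η x = -∫ x, |x| ^ (-α) * (1 + N * |x| ^ (2 * α)) * a x * η x) :
    a =ᵐ[volume] 0 := by
  have hsub : Ioi (0 : ℝ) ⊆ {0}ᶜ := fun x hx => ne_of_gt hx
  have hpos := ae_eq_zero_on_pos hα hN ham hβm ha hβ (fun η hη hc h0 => h1 η hη hc (h0.trans hsub))
    fun η hη hc h0 => h2 η hη hc (h0.trans hsub)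
  have hrefl : ∀ η : ℝ → ℝ, ContDiff ℝ ∞ η → HasCompactSupport η → tsupport η ⊆ Ioi 0 →
      ContDiff ℝ ∞ (fun x => η (-x)) ∧ HasCompactSupport (fun x => η (-x)) ∧
      tsupport (fun x => η (-x)) ⊆ {0}ᶜ := fun η hη hc h0 => by
    refine ⟨hη.comp contDiff_neg, hc.comp_homeomorph (Homeomorph.neg ℝ), fun x hx => ?_⟩
    have h3 : -x ∈ tsupport η := tsupport_comp_subset_preimage η continuous_neg hx
    have h4 : 0 < -x := h0 h3
    exact (neg_pos.mp h4).ne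
  -- The half-line `x < 0` is reduced to the other by reflection, under which the derivative `β`
  -- changes sign.
  have hneg := ae_eq_zero_on_pos hα hN (a := fun x => a (-x)) (β := fun x => -β (-x))
    (ham.comp_measurable measurable_neg) (hβm.comp_measurable measurable_neg).neg
    (by simpa using ha.comp_neg) (by simpa using hβ.comp_neg)
    (fun η hη hc h0 => by
      obtain ⟨k1, k2, k3⟩ := hrefl η hη hc h0
      have h3 := h1 _ k1 k2 k3
      rw [← integral_neg_eq_self (fun x => a x * _), ← integral_neg_eq_self (fun x => β x * _)] at h3
      simp only [deriv_comp_neg, neg_neg, mul_neg, integral_neg] at h3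
      simp only [neg_mul, integral_neg, neg_neg]
      linarith)
    (fun η hη hc h0 => by
      obtain ⟨k1, k2, k3⟩ := hrefl η hη hc h0
      have h3 := h2 _ k1 k2 k3
      rw [← integral_neg_eq_self (fun x => |x| ^ (-α) * β x * _),
        ← integral_neg_eq_self (fun x => |x| ^ (-α) * _ * a x * _)] at h3
      simp only [deriv_comp_neg, neg_neg, mul_neg, integral_neg, abs_neg] at h3
      simp only [neg_mul, mul_neg, integral_neg]
      linarith)
  have hneg' : ∀ᵐ x : ℝ, x < 0 → a x = 0 := by
    have := (Measure.measurePreserving_neg (volume : Measure ℝ)).quasiMeasurePreserving.ae hneg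
    filter_upwards [this] with x hx h0
    have := hx (neg_pos.mpr h0)
    rwa [neg_neg] at this
  filter_upwards [hpos, hneg', Measure.ae_ne volume 0] with x h3 h4 h5
  rcases lt_or_gt_of_ne h5 with h | h
  · exact h4 h
  · exact h3 h

end WeakSolutions

section WeakGradientClosure

theorem gradTheta_gradTheta_tensor {η : ℝ → ℝ} (hη : ContDiff ℝ ∞ η) (hc : HasCompactSupport η)
    (h0 : tsupport η ⊆ {0}ᶜ) (n : ℤ) (b : Bool) {p : Cyl} (hp : p.1 ≠ 0) :
    (gradTheta α (gradTheta α (tensor hη hc h0 n b))).1 p =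
      -((n : ℝ) ^ 2) * |p.1| ^ (2 * α) * η p.1 * harmonic n b p.2 := by
  have hs : IsSmooth fun q : Cyl => η q.1 := IsSmooth.of_fst fun _ _ => hη.contDiffAt
  have d1 : ∀ q : Cyl, q.1 ≠ 0 → (gradTheta α (tensor hη hc h0 n b)).1 q =
      (|q.1| ^ α * η q.1 * (if b then -n else n)) * harmonic n (!b) q.2 := fun q hq => by
    have h1 : dtheta (tensor hη hc h0 n b).1 q = _ := dtheta_mul hs (isSmooth_harmonic n b) hq
    rw [gradTheta_apply, h1, dtheta_fst η, dtheta_harmonic n b hq]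
    ring
  have e : (gradTheta α (tensor hη hc h0 n b)).1 =ᶠ[𝓝 p]
      fun q => (|q.1| ^ α * η q.1 * (if b then -n else n)) * harmonic n (!b) q.2 := by
    filter_upwards [continuous_fst.continuousAt.eventually_ne hp] with q hq using d1 q hq
  rw [gradTheta_apply, dtheta_congr e, dtheta_mul (((IsSmooth.abs_rpow α).mul hs).mul
    (IsSmooth.const _)) (isSmooth_harmonic n (!b)) hp,
    dtheta_fst (fun x => |x| ^ α * η x * (if b then -n else n)), dtheta_harmonic n (!b) hp,
    two_mul, Real.rpow_add (abs_pos.mpr hp)]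
  cases b <;> simp <;> ring

theorem dxL_tensor {η : ℝ → ℝ} (hη : ContDiff ℝ ∞ η) (hc : HasCompactSupport η)
    (h0 : tsupport η ⊆ {0}ᶜ) (n : ℤ) (b : Bool) : dxL (tensor hη hc h0 n b) =
      tensor (contDiff_infty_iff_deriv.mp hη).2 hc.deriv (tsupport_deriv_subset.trans h0) n b := by
  refine testFn.ext_of_ne fun p hp => ?_
  have d1 : dx (tensor hη hc h0 n b).1 p = _ :=
    dx_mul (IsSmooth.of_fst fun _ _ => hη.contDiffAt) (isSmooth_harmonic n b) hp
  refine d1.trans ?_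
  rw [dx_snd (harmonic n b), dx_fst η, mul_zero, add_zero]
  rfl

theorem inner_mulL_tensor (w : L2 α) {c : ℝ → ℝ} (hcs : ∀ x, x ≠ 0 → ContDiffAt ℝ ∞ c x) {η : ℝ → ℝ}
    (hη : ContDiff ℝ ∞ η) (hc : HasCompactSupport η) (h0 : tsupport η ⊆ {0}ᶜ) (n : ℤ) (b : Bool) :
    (inner ℝ w (toL2 α (mulL c hcs (tensor hη hc h0 n b))) : ℝ) =
      ∫ x, |x| ^ (-α) * (c x * η x * mode w n b x) := by
  have e : ∀ p, (mulL c hcs (tensor hη hc h0 n b)).1 p = c p.1 * η p.1 * harmonic n b p.2 :=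
    fun p => (mul_assoc _ _ _).symm
  have hi := integrable_mul_test w (mulL c hcs (tensor hη hc h0 n b)).2
  rw [inner_toL2]
  simp only [e] at hi ⊢
  exact integral_vol_tensor w (fun x => c x * η x) n b hi

/-- Orthogonality to `H¹₀` is the weak form of `w = Δw`. The angular derivative is moved onto the
test function, so that only `w` and its `x`-derivative remain, as needed for the mode equation. -/
theorem inner_of_orthogonal_formSpace {w : L2 α} {k : Grad α} (hw : (w, k) ∈ weakGradGraph α)
    (h : ∀ q ∈ formSpace α testFn, (inner ℝ w q.1 : ℝ) + inner ℝ k q.2 = 0) (f : testFn) :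
    (inner ℝ k.fst (toL2 α (dxL f)) : ℝ) = -inner ℝ w (toL2 α (f - gradTheta α (gradTheta α f))) := by
  have hm : (toL2 α f, (WithLp.toLp 2 (toL2 α (dxL f), toL2 α (gradTheta α f)) : Grad α)) ∈
      formSpace α testFn :=
    Submodule.le_topologicalClosure _ ((isFormCore_testFn α).mem_coreGraph f.2)
  have h1 := h _ hm
  have h2 := (hw (gradTheta α f)).2
  rw [WithLp.prod_inner_apply] at h1
  change (inner ℝ w (toL2 α f) : ℝ) + (inner ℝ k.fst (toL2 α (dxL f)) +
    inner ℝ k.snd (toL2 α (gradTheta α f))) = 0 at h1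
  simp only at h2
  rw [map_sub, inner_sub_right]
  linarith

theorem mode_eq_zero_of_orthogonal_formSpace (hα : α ∉ Ioo (-1 : ℝ) 1) {w : L2 α} {k : Grad α}
    (hw : (w, k) ∈ weakGradGraph α)
    (h : ∀ q ∈ formSpace α testFn, (inner ℝ w q.1 : ℝ) + inner ℝ k q.2 = 0) (n : ℤ) (b : Bool) :
    mode w n b =ᵐ[volume] 0 := by
  refine ae_eq_zero_of_weak_solution hα (N := (n : ℝ) ^ 2) (sq_nonneg _) (β := mode k.fst n b)
    (stronglyMeasurable_mode w n b) (stronglyMeasurable_mode k.fst n b)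
    (mode_sq_integrable w n b) (mode_sq_integrable k.fst n b) (fun η hη hc hη0 => ?_)
    fun η hη hc hη0 => ?_
  -- The factor `|x|^α` in the test function cancels the density, which leaves `∫ a η' = -∫ β η`
  -- without weights.
  · have h1 := (hw (mulL _ (contDiffAt_abs_rpow α) (tensor hη hc hη0 n b))).1
    have e : dxAdj α (mulL _ (contDiffAt_abs_rpow α) (tensor hη hc hη0 n b)) =
        -mulL _ (contDiffAt_abs_rpow α) (tensor (contDiff_infty_iff_deriv.mp hη).2 hc.deriv
          (tsupport_deriv_subset.trans hη0) n b) := by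
      refine testFn.ext_of_ne fun p hp => ?_
      have d1 : dx (mulL _ (contDiffAt_abs_rpow α) (tensor hη hc hη0 n b)).1 p =
          dx (fun q : Cyl => |q.1| ^ α) p * (tensor hη hc hη0 n b).1 p +
            |p.1| ^ α * (dxL (tensor hη hc hη0 n b)).1 p :=
        dx_mul (IsSmooth.abs_rpow α) (testFn.isSmooth (tensor hη hc hη0 n b).2) hp
      rw [dxAdj_apply, d1, dxL_tensor, dx_abs_rpow α hp]
      change α / p.1 * (|p.1| ^ α * (η p.1 * harmonic n b p.2)) -
        (_ * (η p.1 * harmonic n b p.2) + |p.1| ^ α * (deriv η p.1 * harmonic n b p.2)) =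
        -(|p.1| ^ α * (deriv η p.1 * harmonic n b p.2))
      ring
    simp only at h1
    rw [e, map_neg, inner_neg_right, inner_mulL_tensor, inner_mulL_tensor] at h1
    have hcancel : ∀ ζ : ℝ → ℝ, ∀ v : ℝ → ℝ, ∫ x, |x| ^ (-α) * (|x| ^ α * ζ x * v x) = ∫ x, v x * ζ x :=
      fun ζ v => integral_congr_ae (by
        filter_upwards [Measure.ae_ne volume 0] with x hx
        have e : |x| ^ (-α) * |x| ^ α = 1 := by
          rw [← Real.rpow_add (abs_pos.mpr hx)]; simp
        linear_combination (ζ x * v x) * e)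
    rw [hcancel, hcancel] at h1
    linarith
  · have h1 := inner_of_orthogonal_formSpace hw h (tensor hη hc hη0 n b)
    have hcs : ∀ x : ℝ, x ≠ 0 → ContDiffAt ℝ ∞ (fun x => 1 + (n : ℝ) ^ 2 * |x| ^ (2 * α)) x :=
      fun x hx => contDiffAt_const.add (contDiffAt_const.mul (contDiffAt_abs_rpow (2 * α) x hx))
    have e2 : tensor hη hc hη0 n b - gradTheta α (gradTheta α (tensor hη hc hη0 n b)) =
        mulL _ hcs (tensor hη hc hη0 n b) := by
      refine testFn.ext_of_ne fun p hp => ?_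
      change η p.1 * harmonic n b p.2 - (gradTheta α (gradTheta α (tensor hη hc hη0 n b))).1 p =
        (1 + (n : ℝ) ^ 2 * |p.1| ^ (2 * α)) * (η p.1 * harmonic n b p.2)
      rw [gradTheta_gradTheta_tensor hη hc hη0 n b hp]
      ring
    rw [dxL_tensor, e2, inner_mulL_tensor, inner_tensor] at h1
    refine Eq.trans (integral_congr_ae (Eventually.of_forall fun x => ?_)) (h1.trans
      (congrArg Neg.neg (integral_congr_ae (Eventually.of_forall fun x => ?_)))) <;>
    · simp only
      ring

/-- For `α ∉ (-1, 1)`, the weak gradient is the closure of the gradient on test functions. -/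
theorem exists_mem_formSpace_of_weakGradGraph (hα : α ∉ Ioo (-1 : ℝ) 1) {u : L2 α} {g : Grad α}
    (h : (u, g) ∈ weakGradGraph α) : ∃ g, (u, g) ∈ formSpace α testFn := by
  have hC := isFormCore_testFn α
  -- The residual of the projection on `H¹₀` still lies in `H¹`; all its modes vanish, so `u = u₀`.
  obtain ⟨u₀, g₀, h0, horth⟩ := exists_orthogonal_projection hC.isClosedForm.isClosed u g
  have hw : (u - u₀, g - g₀) ∈ weakGradGraph α := by
    rw [← Prod.mk_sub_mk]
    exact (weakGradGraph α).sub_mem h (hC.formSpace_le_weakGradGraph h0)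
  have hz : u - u₀ = 0 := eq_zero_of_mode_eq_zero (mode_eq_zero_of_orthogonal_formSpace hα hw horth)
  exact ⟨g₀, by rwa [sub_eq_zero.mp hz]⟩

/-- The domain of a Markovian extension lies in `H¹ = H¹₀`, so the extension is a restriction of
`Δ_F`, and maximality of self-adjoint operators gives equality. -/
theorem markovUnique_of_notMem (hα : α ∉ Ioo (-1 : ℝ) 1) : MarkovUnique α := by
  refine Subset.antisymm (fun A hA => ?_)
    (singleton_subset_iff.mpr (friedrichs_mem_markovianExtensions α))
  have hF := friedrichs_mem_markovianExtensions α
  refine eq_of_le_of_isSelfAdjoint hA.2.selfAdjoint hF.2.selfAdjoint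
    (LinearPMap.le_of_le_graph ?_)
  rintro ⟨u, v⟩ h
  obtain ⟨g, hg⟩ := exists_weakGradient hA h
  exact mem_friedrichs_graph_iff.mpr ⟨mem_H10_iff.mpr (exists_mem_formSpace_of_weakGradGraph hα hg),
    graph_le_adjoint_graph hA.2.selfAdjoint hA.1 h⟩

end WeakGradientClosure

end

end ConicSurface

end

theorem proposition3p6 :
    (∀ α : ℝ, ConicSurface.MarkovUnique α ↔ α ∉ Set.Ioo (-1 : ℝ) 1) ∧
    ((∀ α : ℝ, ConicSurface.EssentiallySelfAdjoint α → ConicSurface.MarkovUnique α) ∧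
      ∃ α : ℝ, ConicSurface.MarkovUnique α ∧ ¬ ConicSurface.EssentiallySelfAdjoint α) :=
  ⟨fun _ => ⟨fun h hα => ConicSurface.not_markovUnique hα.1 hα.2 h,
      ConicSurface.markovUnique_of_notMem⟩,
    fun _ h => h.markovUnique, -2, ConicSurface.markovUnique_of_notMem (by norm_num),
    ConicSurface.not_essentiallySelfAdjoint⟩
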